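/- Let $d\ge 1$ be an integer, $s\in\mathbb R$ and $\mu\in\{1,-1\}$, and consider the quintic fourth-order nonlinear Schrödinger equation $$ i\partial_t u+\Delta^2u+\mu|u|^4u=0,\qquad u:\mathbb R^d\times\mathbb R\to\mathbb C. \tag{1}$$ Assume that one of the following holds: (a) $d=1$ and $s\le -\tfrac12$; (b) $d\ge 2$ and $s<0$; (c) $3\le d\le 5$, $0<s<\tfrac d2-1$ and $\mu=1$. Then, for every $T>0$, the solution map $\Phi:H^s(\mathbb R^d)\to C([-T,T],H^s(\mathbb R^d))$, $u_0\mapsto u$ with $u|_{t=0}=u_0$, of (1) is discontinuous at every point of $H^s(\mathbb R^d)$. Here a strong solution of (1) on a compact interval $J\ni 0$ is a curve $u\in C(J,H^\sigma(\mathbb R^d))$, for some $\sigma>\tfrac d2$, that satisfies (1) in the sense of tempered distributions at every time $t\in J$, and the claim means both of the following. 1. Let $\Phi:H^s\to C([-T,T],H^s)$ be any map that extends the flow of the strong solutions, i.e. $\Phi(v(0))(t)=v(t)$ for all $t\in J$ whenever $v$ is a strong solution, with values in $H^s$, on a compact interval $J$ with $0\in J\subset[-T,T]$. Then $\Phi$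 is discontinuous at every $u_0\in H^s$. 2. (Without presupposing that such a globally defined $\Phi$ exists.) For every $u_0\in H^s$ and every $w\in C([-T,T],H^s)$ there is $\varepsilon>0$ such that for every $\delta>0$ there are a compact interval $J$ with $0\in J\subset[-T,T]$, a strong solution $v$ on $J$ with values in $H^s$, and a time $t\in J$ with $$\|v(0)-u_0\|_{H^s}<\delta\quad\text{and}\quad \|v(t)-w(t)\|_{H^s}\ge\varepsilon .$$ -/

import Mathlib

open MeasureTheory Set
open scoped SchwartzMap Laplacian

noncomputable section

/-- The space `ℝ^d` with its Euclidean structure. -/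
abbrev Rd (d : ℕ) : Type := EuclideanSpace ℝ (Fin d)

/-- The tempered distributions on `ℝ^d` of Sobolev regularity `s`, as a linear subspace. -/
def sobolevSubmodule (d : ℕ) (s : ℝ) : Submodule ℂ 𝓢'(Rd d, ℂ) where
  carrier := {f | TemperedDistribution.MemSobolev s 2 f}
  add_mem' hf hg := hf.add hg
  zero_mem' := TemperedDistribution.memSobolev_fun_zero (Rd d) ℂ s 2
  smul_mem' c _ hf := hf.smul c

/-- The inhomogeneous `L²`-based Sobolev space `H^s(ℝ^d)`, `s ∈ ℝ`. It is a type of its own (and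
not a reducible abbreviation), so that it carries the topology of the Sobolev norm and not the
one induced by the tempered distributions. -/
def Hs (d : ℕ) (s : ℝ) : Type := sobolevSubmodule d s

namespace Hs

variable {d : ℕ} {s : ℝ}

instance : AddCommGroup (Hs d s) := inferInstanceAs (AddCommGroup (sobolevSubmodule d s))

instance : Module ℂ (Hs d s) := inferInstanceAs (Module ℂ (sobolevSubmodule d s))

/-- An element of `H^s(ℝ^d)` seen as a tempered distribution. -/
def toDist : Hs d s →ₗ[ℂ] 𝓢'(Rd d, ℂ) := (sobolevSubmodule d s).subtype

theorem toDist_injective : Function.Injective (toDist : Hs d s →ₗ[ℂ] 𝓢'(Rd d, ℂ)) :=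
  (sobolevSubmodule d s).injective_subtype

theorem memSobolev (f : Hs d s) : TemperedDistribution.MemSobolev s 2 (toDist f) := f.2

theorem lp_toDist_injective {F G : Lp ℂ 2 (volume : Measure (Rd d))}
    (h : (F : 𝓢'(Rd d, ℂ)) = (G : 𝓢'(Rd d, ℂ))) : F = G := by
  have hker := Lp.ker_toTemperedDistributionCLM_eq_bot (F := ℂ) (p := 2)
    (μ := (volume : Measure (Rd d)))
  exact LinearMap.ker_eq_bot.mp hker h

/-- The Bessel potential `𝓕⁻¹ (1 + |ξ|²)^(s/2) 𝓕 f` of `f ∈ H^s`, as an element of `L²`. -/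
def besselFun (f : Hs d s) : Lp ℂ 2 (volume : Measure (Rd d)) := (memSobolev f).choose

theorem besselFun_spec (f : Hs d s) :
    TemperedDistribution.besselPotential (Rd d) ℂ s (toDist f) = (besselFun f : 𝓢'(Rd d, ℂ)) :=
  (memSobolev f).choose_spec

/-- The map `f ↦ 𝓕⁻¹ (1 + |ξ|²)^(s/2) 𝓕 f` from `H^s` to `L²`, as a linear map. -/
def bessel : Hs d s →ₗ[ℂ] Lp ℂ 2 (volume : Measure (Rd d)) where
  toFun := besselFun
  map_add' f g := by
    apply lp_toDist_injective
    rw [← besselFun_spec, map_add, map_add, besselFun_spec, besselFun_spec]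
    simp only [← Lp.toTemperedDistributionCLM_apply, map_add]
  map_smul' c f := by
    apply lp_toDist_injective
    rw [← besselFun_spec, map_smul, map_smul, besselFun_spec]
    simp only [← Lp.toTemperedDistributionCLM_apply, map_smul, RingHom.id_apply]

theorem bessel_spec (f : Hs d s) :
    TemperedDistribution.besselPotential (Rd d) ℂ s (toDist f) = (bessel f : 𝓢'(Rd d, ℂ)) :=
  besselFun_spec f

theorem bessel_injective :
    Function.Injective (bessel : Hs d s →ₗ[ℂ] Lp ℂ 2 (volume : Measure (Rd d))) := by
  intro f g h
  apply toDist_injective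
  have hfg : TemperedDistribution.besselPotential (Rd d) ℂ s (toDist f) =
      TemperedDistribution.besselPotential (Rd d) ℂ s (toDist g) := by
    rw [bessel_spec, bessel_spec, h]
  have h1 := (TemperedDistribution.besselPotential_neg_apply_eq_iff s _ (toDist f)).mpr rfl
  have h2 := (TemperedDistribution.besselPotential_neg_apply_eq_iff s _ (toDist g)).mpr rfl
  rw [← h1, ← h2, hfg]

/-- The norm `‖f‖_{H^s} = ‖𝓕⁻¹ (1 + |ξ|²)^(s/2) 𝓕 f‖_{L²} = ‖(1 + |ξ|²)^(s/2) 𝓕 f‖_{L²}`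
(Plancherel). Here `𝓕` is the unitary Fourier transform with the kernel `e^{-2πi x·ξ}`; other
normalizations of `𝓕` give an equivalent norm. -/
instance : NormedAddCommGroup (Hs d s) :=
  NormedAddCommGroup.induced (Hs d s) (Lp ℂ 2 (volume : Measure (Rd d))) bessel bessel_injective

instance : NormedSpace ℂ (Hs d s) :=
  NormedSpace.induced ℂ (Hs d s) (Lp ℂ 2 (volume : Measure (Rd d))) bessel

theorem norm_def (f : Hs d s) : ‖f‖ = ‖bessel f‖ := rfl

end Hs

/-- `g = |f|⁴ f`, for tempered distributions `f`, `g` that are given by functions in `L²`. -/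
def IsQuintic {d : ℕ} (f g : 𝓢'(Rd d, ℂ)) : Prop :=
  ∃ F G : Lp ℂ 2 (volume : Measure (Rd d)),
    f = (F : 𝓢'(Rd d, ℂ)) ∧ g = (G : 𝓢'(Rd d, ℂ)) ∧ ∀ᵐ x, G x = (‖F x‖ : ℂ) ^ 4 * F x

/-- `u` is a strong solution of `i ∂ₜu + Δ²u + μ |u|⁴u = 0` on the time interval `J`: it is a
continuous curve in `H^σ(ℝ^d)` for some `σ > d/2` (where `H^σ` is an algebra of bounded continuous
functions, so that the nonlinearity makes sense), and the equation holds at every time of `J` in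
the sense of tempered distributions. -/
structure IsStrongSolution {d : ℕ} (μ : ℝ) (J : Set ℝ) (u : ℝ → 𝓢'(Rd d, ℂ)) : Prop where
  regular : ∃ σ : ℝ, (d : ℝ) / 2 < σ ∧ ∃ U : ℝ → Hs d σ,
    ContinuousOn U J ∧ ∀ t ∈ J, Hs.toDist (U t) = u t
  equation : ∃ N : ℝ → 𝓢'(Rd d, ℂ), ∀ t ∈ J, IsQuintic (u t) (N t) ∧
    ∀ φ : 𝓢(Rd d, ℂ), ∃ D : ℂ, HasDerivWithinAt (fun τ => u τ φ) D J t ∧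
      Complex.I * D + Δ (Δ (u t)) φ + (μ : ℂ) * N t φ = 0

/-- `Φ : H^s → C([-T,T], H^s)` is a solution map of the equation: whenever `v` is a strong solution
on an interval `[a,b] ∋ 0` inside `[-T,T]`, with values in `H^s`, then `Φ` sends the
initial value `v(0)` to a curve that agrees with `v` on `[a,b]`. -/
def IsSolutionMap {d : ℕ} {s T : ℝ} (μ : ℝ) (Φ : Hs d s → C(Icc (-T) T, Hs d s)) : Prop :=
  ∀ a b : ℝ, -T ≤ a → a ≤ 0 → 0 ≤ b → b ≤ T → ∀ v : ℝ → Hs d s,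
    IsStrongSolution μ (Icc a b) (fun t => Hs.toDist (v t)) →
    ∀ t : Icc (-T) T, (t : ℝ) ∈ Icc a b → Φ (v 0) t = v t

/-- Continuity at `u₀`, in the topologies of `H^s` and of `C([-T,T], H^s)`, of the partially
defined flow of the equation: there is a curve `w` in `C([-T,T], H^s)` (the value at `u₀`) such that
all strong solutions `v` whose initial value is `H^s`-close to `u₀` are
uniformly `H^s`-close to `w`, on whatever interval `[a,b] ∋ 0` inside `[-T,T]` they exist. -/
def FlowContinuousAt {d : ℕ} {s : ℝ} (μ T : ℝ) (u₀ : Hs d s) : Prop :=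
  ∃ w : C(Icc (-T) T, Hs d s), ∀ ε > 0, ∃ δ > 0,
    ∀ a b : ℝ, -T ≤ a → a ≤ 0 → 0 ≤ b → b ≤ T → ∀ v : ℝ → Hs d s,
      IsStrongSolution μ (Icc a b) (fun t => Hs.toDist (v t)) → ‖v 0 - u₀‖ < δ →
      ∀ t : Icc (-T) T, (t : ℝ) ∈ Icc a b → ‖v t - w t‖ < ε

end

/-! Data `V` with continuous, compactly supported Fourier transform are dense in `H^s`, so it
suffices to prove norm inflation at these (`NormInflation`): arbitrarily close to `V` start strong
solutions whose `H^s` norm exceeds any given bound before any given time. A curve `w` in `C([-T,T],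
H^s)` is bounded, so such solutions cannot stay near it.

The solutions start from `V` plus a concentrated profile `M φ(n x)` with `M = n^(d/2-s)`, the
amplitude at which the homogeneous `H^s` norm of the profile does not depend on `n`. In the time
variable `τ = M⁴ t` the nonlinearity acts on `φ` at unit speed, the dispersion at frequency `n` has
strength `(n/M)⁴`, and `V` becomes a perturbation with the factor `1/M`. If `s < d/2 - 1`, then `n/M
→ 0`, and on a fixed interval of `τ` the solution follows the dispersionless flow `y(τ) =
exp(iμτ|φ|⁴) φ`, while the elapsed time `τ/M⁴` tends to zero (`inflation_at_scale`,
`exists_inflation_of_profile`). It remains to find profiles that are small in `H^s` but become large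
under this explicit flow.

For `s < 0`, energy is moved to low frequencies: two waves near the frequencies `K e` and `2K e` are
small in `H^s` for large `K`, and their quintic interaction has a nonoscillating component near
frequency zero (`exists_bump_profile`, `NormInflation.of_neg`).

For `s > 0`, energy is moved to high frequencies: the flow conserves the `L²` norm of a Gaussian,
but its phase `|φ|⁴` has level sets of measure zero, so that on time average the energy leaves every
ball of the frequency space (`exists_setIntegral_fourier_lt`, `NormInflation.of_pos`).

At the endpoint `d = 1`, `s = -1/2` one has `M = n`, and the dispersion is as strong as the
nonlinearity. For a short fixed time `τ`, however, the first order expansion of the solution is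
valid uniformly in `n` (`exists_solution_first_order`). The low frequency component then has a
Fourier transform bounded below for `R₀ < |ξ| ≤ r n`, and its `H^(-1/2)` norm diverges
logarithmically (`NormInflation.critical`).

The analysis takes place on the Fourier side, in spaces of functions `p h` with a fixed weight `p`
and `h` continuous and vanishing at infinity. Since `p * p ≤ C p`, such a space is a convolution
algebra; the nonlinearity is polynomial in it and the propagator is an isometry. The equation in the
interaction picture is then an ordinary differential equation with a locally Lipschitz right hand
side, and stability is the shadowing lemma `exists_solution_near`. The weights `scaleWeight` have
one component at frequency scale `n`, for the profile, and one at unit scale, for `V`; their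
convolution constant does not depend on `n`. -/

noncomputable section

open FourierTransform Filter Topology

/-! ### Elements of `H^s` described by their Fourier transform -/

section Fourier

variable {d : ℕ} {s : ℝ}

/-- The Japanese bracket `(1 + |ξ|²)^(s/2)`. -/
def bracket (s : ℝ) (ξ : Rd d) : ℝ := (1 + ‖ξ‖ ^ 2) ^ (s / 2)

theorem bracket_pos (s : ℝ) (ξ : Rd d) : 0 < bracket s ξ :=
  Real.rpow_pos_of_pos (by positivity) _

theorem bracket_mul (s r : ℝ) (ξ : Rd d) : bracket s ξ * bracket r ξ = bracket (s + r) ξ := by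
  rw [bracket, bracket, bracket, ← Real.rpow_add (by positivity)]
  congr 1; ring

theorem bracket_zero (ξ : Rd d) : bracket 0 ξ = 1 := by simp [bracket]

theorem bracket_neg_mul (s : ℝ) (ξ : Rd d) : bracket (-s) ξ * bracket s ξ = 1 := by
  rw [bracket_mul, neg_add_cancel, bracket_zero]

theorem bracket_sq (s : ℝ) (ξ : Rd d) : bracket s ξ ^ 2 = (1 + ‖ξ‖ ^ 2) ^ s := by
  rw [sq, bracket_mul, bracket]; congr 1; ring

theorem continuous_bracket (s : ℝ) : Continuous (bracket s : Rd d → ℝ) := by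
  unfold bracket
  exact Continuous.rpow_const (by fun_prop) fun x => Or.inl (by positivity)

theorem norm_toLp_sq {f : Rd d → ℂ} (hf : MemLp f 2) : ‖hf.toLp f‖ ^ 2 = ∫ ξ, ‖f ξ‖ ^ 2 := by
  have h := L2.inner_def (𝕜 := ℂ) (hf.toLp f) (hf.toLp f)
  rw [inner_self_eq_norm_sq_to_K] at h
  have h2 : ∫ a, inner ℂ ((hf.toLp f) a) ((hf.toLp f) a) = ∫ a, ((‖f a‖ ^ 2 : ℝ) : ℂ) := by
    refine integral_congr_ae ?_
    filter_upwards [hf.coeFn_toLp] with a ha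
    rw [ha, inner_self_eq_norm_sq_to_K]; simp
  rw [h2] at h
  have h3 := h.trans (integral_ofReal (𝕜 := ℂ) (f := fun a => ‖f a‖ ^ 2))
  exact_mod_cast h3

/-- `V` is the Fourier transform of an element of `H^s`. -/
abbrev MemFourierHs (s : ℝ) (V : Rd d → ℂ) : Prop :=
  MemLp (fun ξ => (bracket s ξ : ℂ) * V ξ) 2

namespace Hs

/-- The element of `H^s` with Fourier transform `V`. -/
def ofFourier (s : ℝ) (V : Rd d → ℂ) (hV : MemFourierHs s V) : Hs d s :=
  ⟨TemperedDistribution.besselPotential (Rd d) ℂ (-s)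
    (((𝓕⁻ (MemLp.toLp _ hV) : Lp ℂ 2 (volume : Measure (Rd d)))) : 𝓢'(Rd d, ℂ)), by
    refine ⟨𝓕⁻ (MemLp.toLp _ hV), ?_⟩
    simp⟩

theorem toDist_ofFourier {V : Rd d → ℂ} (hV : MemFourierHs s V) :
    toDist (ofFourier s V hV) = TemperedDistribution.besselPotential (Rd d) ℂ (-s)
    (((𝓕⁻ (MemLp.toLp _ hV) : Lp ℂ 2 (volume : Measure (Rd d)))) : 𝓢'(Rd d, ℂ)) := rfl

theorem bessel_ofFourier {V : Rd d → ℂ} (hV : MemFourierHs s V) :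
    bessel (ofFourier s V hV) = 𝓕⁻ (MemLp.toLp _ hV) := by
  apply lp_toDist_injective
  rw [← bessel_spec, toDist_ofFourier]
  simp

theorem norm_ofFourier_eq {V : Rd d → ℂ} (hV : MemFourierHs s V) :
    ‖ofFourier s V hV‖ = ‖MemLp.toLp _ hV‖ := by
  rw [norm_def, bessel_ofFourier]
  exact (Lp.fourierTransformₗᵢ (Rd d) ℂ).symm.norm_map _

theorem norm_ofFourier_sq {V : Rd d → ℂ} (hV : MemFourierHs s V) :
    ‖ofFourier s V hV‖ ^ 2 = ∫ ξ, (1 + ‖ξ‖ ^ 2) ^ s * ‖V ξ‖ ^ 2 := by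
  rw [norm_ofFourier_eq, norm_toLp_sq]
  refine integral_congr_ae (ae_of_all _ fun ξ => ?_)
  simp only [norm_mul, Complex.norm_real, Real.norm_eq_abs, mul_pow, sq_abs, bracket_sq]

/-- The Bessel weight and its inverse cancel once the Fourier transform is moved to the test
function. The result does not involve `s`, so equal Fourier transforms give equal distributions
across Sobolev spaces. -/
theorem toDist_ofFourier_apply {V : Rd d → ℂ} (hV : MemFourierHs s V) (φ : 𝓢(Rd d, ℂ)) :
    toDist (ofFourier s V hV) φ = ∫ ξ, (𝓕⁻ φ) ξ * V ξ := by
  rw [toDist_ofFourier, TemperedDistribution.besselPotential,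
    TemperedDistribution.fourierMultiplierCLM_apply_apply,
    ← Lp.fourierInv_toTemperedDistribution_eq, TemperedDistribution.fourierInv_apply,
    FourierTransform.fourierInv_fourier_eq, Lp.toTemperedDistribution_apply]
  refine integral_congr_ae ?_
  filter_upwards [hV.coeFn_toLp] with ξ hξ
  rw [hξ, SchwartzMap.smulLeftCLM_apply_apply (by fun_prop)]
  have := bracket_neg_mul s ξ
  simp only [smul_eq_mul]
  have h2 : (((1 + ‖ξ‖ ^ 2) ^ (-s / 2) : ℝ) : ℂ) * (bracket s ξ : ℂ) = 1 := by
    exact_mod_cast bracket_neg_mul s ξ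
  linear_combination (𝓕⁻ φ) ξ * V ξ * h2

theorem ofFourier_add {V W : Rd d → ℂ} (hV : MemFourierHs s V) (hW : MemFourierHs s W)
    (h : MemFourierHs s (fun ξ => V ξ + W ξ)) :
    ofFourier s (fun ξ => V ξ + W ξ) h = ofFourier s V hV + ofFourier s W hW := by
  apply bessel_injective
  rw [map_add, bessel_ofFourier, bessel_ofFourier, bessel_ofFourier, ← FourierTransform.fourierInv_add,
    ← MemLp.toLp_add]
  congr 1
  apply MemLp.toLp_congr
  filter_upwards with ξ
  simp [mul_add]

theorem ofFourier_smul {V : Rd d → ℂ} (c : ℂ) (hV : MemFourierHs s V)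
    (h : MemFourierHs s (fun ξ => c * V ξ)) :
    ofFourier s (fun ξ => c * V ξ) h = c • ofFourier s V hV := by
  apply bessel_injective
  rw [map_smul, bessel_ofFourier, bessel_ofFourier, ← FourierTransform.fourierInv_smul,
    ← MemLp.toLp_const_smul]
  congr 1
  apply MemLp.toLp_congr
  filter_upwards with ξ
  simp only [Pi.smul_apply, smul_eq_mul]; ring

/-- Approximate the `L²` function `𝓕 (bessel u)` by a continuous function with compact support, and
divide by the bracket. -/
theorem exists_ofFourier_near (u : Hs d s) {δ : ℝ} (hδ : 0 < δ) :
    ∃ (V : Rd d → ℂ) (hV : MemFourierHs s V), Continuous V ∧ HasCompactSupport V ∧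
      ‖ofFourier s V hV - u‖ ≤ δ := by
  set f : Lp ℂ 2 (volume : Measure (Rd d)) := 𝓕 (bessel u) with hf
  obtain ⟨g, hg1, hg2, hg3, hg4⟩ := (Lp.memLp f).exists_hasCompactSupport_eLpNorm_sub_le
    (by norm_num) (ε := ENNReal.ofReal δ) (by simpa using hδ)
  have key : (fun ξ => (bracket s ξ : ℂ) * ((bracket (-s) ξ : ℂ) * g ξ)) = g := by
    ext ξ
    rw [← mul_assoc, ← Complex.ofReal_mul, mul_comm (bracket s ξ), bracket_neg_mul]; simp
  have hV : MemFourierHs s (fun ξ => (bracket (-s) ξ : ℂ) * g ξ) := by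
    unfold MemFourierHs; rw [key]; exact hg4
  refine ⟨_, hV, ?_, ?_, ?_⟩
  · exact (Complex.continuous_ofReal.comp (continuous_bracket _)).mul hg3
  · exact hg1.mul_left
  · rw [norm_def, map_sub, bessel_ofFourier,
      ← (Lp.fourierTransformₗᵢ (Rd d) ℂ).norm_map]
    have h1 : (Lp.fourierTransformₗᵢ (Rd d) ℂ) (𝓕⁻ (MemLp.toLp _ hV) - bessel u)
        = MemLp.toLp g hg4 - f := by
      rw [map_sub]
      congr 1
      have : (Lp.fourierTransformₗᵢ (Rd d) ℂ) (𝓕⁻ (MemLp.toLp _ hV)) = MemLp.toLp _ hV :=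
        (Lp.fourierTransformₗᵢ (Rd d) ℂ).apply_symm_apply _
      rw [this]
      apply MemLp.toLp_congr
      rw [key]
    rw [h1, norm_sub_rev]
    have h2 : f - MemLp.toLp g hg4 = MemLp.toLp _ ((Lp.memLp f).sub hg4) := by
      rw [MemLp.toLp_sub (Lp.memLp f) hg4, Lp.toLp_coeFn]
    rw [h2, Lp.norm_toLp]
    exact ENNReal.toReal_le_of_le_ofReal hδ.le hg2

/-- Duality between `H^s` and `H^{-s}` on the Fourier side. -/
theorem norm_integral_mul_le {V G : Rd d → ℂ} (hV : MemFourierHs s V) (hG : MemFourierHs (-s) G) :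
    ‖∫ ξ, V ξ * G ξ‖ ≤ ‖ofFourier s V hV‖ * Real.sqrt (∫ ξ, (1 + ‖ξ‖ ^ 2) ^ (-s) * ‖G ξ‖ ^ 2) := by
  have hN : ‖MemLp.toLp _ hG‖ = Real.sqrt (∫ ξ, (1 + ‖ξ‖ ^ 2) ^ (-s) * ‖G ξ‖ ^ 2) := by
    rw [← norm_ofFourier_eq, ← norm_ofFourier_sq hG, Real.sqrt_sq (norm_nonneg _)]
  rw [← hN, norm_ofFourier_eq hV]
  have h1 : ∀ ξ, V ξ * G ξ = ((bracket s ξ : ℂ) * V ξ) * ((bracket (-s) ξ : ℂ) * G ξ) := by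
    intro ξ
    have h2 : (bracket (-s) ξ : ℂ) * (bracket s ξ : ℂ) = 1 := by
      rw [← Complex.ofReal_mul, bracket_neg_mul]; simp
    linear_combination - V ξ * G ξ * h2
  have hVs : MemLp (fun ξ => star ((bracket s ξ : ℂ) * V ξ)) 2 := hV.star
  have h3 : ∫ ξ, V ξ * G ξ = inner ℂ (hVs.toLp _) (hG.toLp _) := by
    rw [L2.inner_def]
    refine integral_congr_ae ?_
    filter_upwards [hVs.coeFn_toLp, hG.coeFn_toLp] with ξ h4 h5
    rw [h4, h5, h1 ξ]
    simp [mul_comm]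
  rw [h3]
  refine (norm_inner_le_norm _ _).trans_eq ?_
  congr 1
  rw [Lp.norm_toLp, Lp.norm_toLp]
  congr 1
  exact eLpNorm_congr_norm_ae (ae_of_all _ fun ξ => by simp)

end Hs

end Fourier

/-! ### Weighted convolution algebras on the Fourier side -/

/-- A positive even weight that dominates its own convolution square. -/
structure ConvWeight (d : ℕ) where
  /-- the weight -/
  toFun : Rd d → ℝ
  /-- the constant of the convolution estimate -/
  const : ℝ
  /-- the constant of the decay estimate -/
  bound : ℝ
  pos : ∀ ξ, 0 < toFun ξ
  even : ∀ ξ, toFun (-ξ) = toFun ξ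
  continuous_toFun : Continuous toFun
  decay : ∀ ξ, toFun ξ ≤ bound * ((1 + ‖ξ‖) ^ (d + 1))⁻¹
  conv_le : ∀ ξ, ∫ η, toFun η * toFun (ξ - η) ≤ const * toFun ξ

/-- The continuous functions on `ℝ^d` that vanish at infinity. -/
abbrev CZero (d : ℕ) : Type := ZeroAtInftyContinuousMap (Rd d) ℂ

theorem CZero.norm_apply_le {d : ℕ} (h : CZero d) (ξ : Rd d) : ‖h ξ‖ ≤ ‖h‖ := by
  rw [← ZeroAtInftyContinuousMap.norm_toBCF_eq_norm]
  exact h.toBCF.norm_coe_le_norm ξ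

theorem CZero.norm_le {d : ℕ} {h : CZero d} {C : ℝ} (hC : 0 ≤ C) (H : ∀ ξ, ‖h ξ‖ ≤ C) :
    ‖h‖ ≤ C := by
  rw [← ZeroAtInftyContinuousMap.norm_toBCF_eq_norm]
  exact (BoundedContinuousFunction.norm_le hC).2 H

theorem integrable_inv_one_add_norm_pow {d k : ℕ} (hk : d < k) :
    Integrable (fun ξ : Rd d => ((1 + ‖ξ‖) ^ k)⁻¹) := by
  have h := integrable_one_add_norm (E := Rd d) (μ := volume) (r := k) (by simpa using hk)
  refine h.congr (ae_of_all _ fun ξ => ?_)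
  simp only
  rw [Real.rpow_neg (by positivity), Real.rpow_natCast]

/-- The map `h ↦ conj h(-·)`, which on the Fourier side is the complex conjugation. -/
def conjRefl {d : ℕ} : CZero d →ₗᵢ[ℝ] CZero d where
  toFun h := ⟨⟨fun ξ => star (h (-ξ)), by fun_prop⟩, by
    have h1 : Tendsto (fun ξ : Rd d => h (-ξ)) (cocompact _) (𝓝 0) :=
      (zero_at_infty h).comp (Homeomorph.neg (Rd d)).isClosedEmbedding.tendsto_cocompact
    have h2 := h1.star
    rwa [star_zero] at h2⟩
  map_add' h k := by ext ξ; simp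
  map_smul' c h := by ext ξ; simp
  norm_map' h := by
    apply le_antisymm
    · refine CZero.norm_le (norm_nonneg _) fun ξ => ?_
      simpa using CZero.norm_apply_le h (-ξ)
    · refine CZero.norm_le (norm_nonneg _) fun ξ => ?_
      have := CZero.norm_apply_le (d := d) ⟨⟨fun ξ => star (h (-ξ)), by fun_prop⟩, by
        have h1 : Tendsto (fun ξ : Rd d => h (-ξ)) (cocompact _) (𝓝 0) :=
          (zero_at_infty h).comp (Homeomorph.neg (Rd d)).isClosedEmbedding.tendsto_cocompact
        have h2 := h1.star
        rwa [star_zero] at h2⟩ (-ξ)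
      simpa using this

@[simp] theorem conjRefl_apply {d : ℕ} (h : CZero d) (ξ : Rd d) :
    conjRefl h ξ = star (h (-ξ)) := rfl

namespace ConvWeight

variable {d : ℕ} (p : ConvWeight d)

theorem bound_nonneg : 0 ≤ p.bound := by
  have h1 := p.pos 0
  have h2 := p.decay 0
  simp at h2
  linarith

theorem le_bound (ξ : Rd d) : p.toFun ξ ≤ p.bound := by
  refine (p.decay ξ).trans ?_
  have : ((1 + ‖ξ‖) ^ (d + 1))⁻¹ ≤ 1 := inv_le_one_of_one_le₀ (one_le_pow₀ (by simp))
  nlinarith [p.bound_nonneg]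

theorem integrable_toFun : Integrable p.toFun := by
  refine ((integrable_inv_one_add_norm_pow (Nat.lt_succ_self d)).const_mul p.bound).mono'
    p.continuous_toFun.aestronglyMeasurable (ae_of_all _ fun ξ => ?_)
  rw [Real.norm_of_nonneg (p.pos ξ).le]
  exact p.decay ξ

theorem integrable_conv (ξ : Rd d) : Integrable (fun η => p.toFun η * p.toFun (ξ - η)) := by
  refine (p.integrable_toFun.mul_const p.bound).mono'
    (p.continuous_toFun.mul (p.continuous_toFun.comp (by fun_prop))).aestronglyMeasurable
    (ae_of_all _ fun η => ?_)
  rw [Real.norm_of_nonneg (mul_pos (p.pos _) (p.pos _)).le]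
  exact mul_le_mul_of_nonneg_left (p.le_bound _) (p.pos _).le

theorem const_nonneg : 0 ≤ p.const := by
  have h1 : 0 ≤ ∫ η, p.toFun η * p.toFun (0 - η) :=
    integral_nonneg fun η => (mul_pos (p.pos _) (p.pos _)).le
  have h2 := p.conv_le 0
  by_contra h
  nlinarith [p.pos 0]

/-- The function on the Fourier side represented by `h`. -/
def hat (h : CZero d) (ξ : Rd d) : ℂ := p.toFun ξ * h ξ

theorem continuous_hat (h : CZero d) : Continuous (p.hat h) :=
  (Complex.continuous_ofReal.comp p.continuous_toFun).mul h.continuous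

theorem norm_hat_le (h : CZero d) (ξ : Rd d) : ‖p.hat h ξ‖ ≤ p.toFun ξ * ‖h‖ := by
  rw [hat, norm_mul, Complex.norm_real, Real.norm_of_nonneg (p.pos ξ).le]
  exact mul_le_mul_of_nonneg_left (CZero.norm_apply_le h ξ) (p.pos ξ).le

theorem integrable_hat (h : CZero d) : Integrable (p.hat h) :=
  (p.integrable_toFun.mul_const ‖h‖).mono' (p.continuous_hat h).aestronglyMeasurable
    (ae_of_all _ fun ξ => p.norm_hat_le h ξ)

theorem hat_injective {h k : CZero d} (H : ∀ ξ, p.hat h ξ = p.hat k ξ) : h = k := by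
  ext ξ
  have := H ξ
  unfold hat at this
  exact mul_left_cancel₀ (by exact_mod_cast (p.pos ξ).ne') this

theorem hat_add (h k : CZero d) (ξ : Rd d) : p.hat (h + k) ξ = p.hat h ξ + p.hat k ξ := by
  simp [hat, mul_add]

theorem hat_sub (h k : CZero d) (ξ : Rd d) : p.hat (h - k) ξ = p.hat h ξ - p.hat k ξ := by
  simp [hat, mul_sub]

theorem hat_smul (c : ℂ) (h : CZero d) (ξ : Rd d) : p.hat (c • h) ξ = c * p.hat h ξ := by
  simp [hat]; ring

theorem hat_conjRefl (h : CZero d) (ξ : Rd d) : p.hat (conjRefl h) ξ = star (p.hat h (-ξ)) := by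
  simp [hat, p.even]

/-- Convolution on the Fourier side. -/
def fconv (V W : Rd d → ℂ) (ξ : Rd d) : ℂ := ∫ η, V η * W (ξ - η)

theorem norm_integrand_le (h k : CZero d) (ξ η : Rd d) :
    ‖p.hat h η * p.hat k (ξ - η)‖ ≤ ‖h‖ * ‖k‖ * (p.toFun η * p.toFun (ξ - η)) := by
  rw [norm_mul]
  calc _ ≤ (p.toFun η * ‖h‖) * (p.toFun (ξ - η) * ‖k‖) :=
        mul_le_mul (p.norm_hat_le _ _) (p.norm_hat_le _ _) (norm_nonneg _)
          (mul_nonneg (p.pos _).le (norm_nonneg _))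
    _ = _ := by ring

theorem continuous_integrand (h k : CZero d) (ξ : Rd d) :
    Continuous fun η => p.hat h η * p.hat k (ξ - η) :=
  (p.continuous_hat h).mul ((p.continuous_hat k).comp (by fun_prop))

theorem integrable_integrand (h k : CZero d) (ξ : Rd d) :
    Integrable fun η => p.hat h η * p.hat k (ξ - η) :=
  ((p.integrable_conv ξ).const_mul (‖h‖ * ‖k‖)).mono'
    (p.continuous_integrand h k ξ).aestronglyMeasurable
    (ae_of_all _ fun η => p.norm_integrand_le h k ξ η)

theorem fconv_eq (V W : Rd d → ℂ) :
    fconv V W = convolution V W (ContinuousLinearMap.mul ℂ ℂ) volume := rfl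

theorem norm_fconv_hat_le (h k : CZero d) (ξ : Rd d) :
    ‖fconv (p.hat h) (p.hat k) ξ‖ ≤ p.const * ‖h‖ * ‖k‖ * p.toFun ξ := by
  have h1 : ‖fconv (p.hat h) (p.hat k) ξ‖ ≤ ‖h‖ * ‖k‖ * ∫ η, p.toFun η * p.toFun (ξ - η) := by
    rw [← integral_const_mul]
    exact norm_integral_le_of_norm_le ((p.integrable_conv ξ).const_mul _)
      (ae_of_all _ fun η => p.norm_integrand_le h k ξ η)
  refine h1.trans ?_
  calc _ ≤ ‖h‖ * ‖k‖ * (p.const * p.toFun ξ) :=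
        mul_le_mul_of_nonneg_left (p.conv_le ξ) (by positivity)
    _ = _ := by ring

theorem continuous_fconv_hat (h k : CZero d) : Continuous (fconv (p.hat h) (p.hat k)) := by
  rw [fconv_eq]
  refine BddAbove.continuous_convolution_right_of_integrable _ ?_ (p.integrable_hat h)
    (p.continuous_hat k)
  refine ⟨p.bound * ‖k‖, ?_⟩
  rintro _ ⟨ξ, rfl⟩
  exact (p.norm_hat_le k ξ).trans (mul_le_mul_of_nonneg_right (p.le_bound ξ) (norm_nonneg _))

/-- If `2R ≤ |ξ|`, then `η` or `ξ - η` has norm at least `R`, so one of the factors `h η`, `k (ξ -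
η)` is small, and the convolution estimate of the weight absorbs the rest. -/
theorem tendsto_fconv_hat (h k : CZero d) :
    Tendsto (fun ξ => (p.toFun ξ : ℂ)⁻¹ * fconv (p.hat h) (p.hat k) ξ) (cocompact _) (𝓝 0) := by
  rw [Metric.tendsto_nhds]
  intro ε hε
  set D := p.const * (‖h‖ + ‖k‖) + 1 with hD
  have hDpos : 0 < D := by have := p.const_nonneg; positivity
  have e1 : ∀ g : CZero d, ∀ᶠ ξ in cocompact (Rd d), ‖g ξ‖ < ε / D := fun g => by
    have := (zero_at_infty g).norm
    rw [norm_zero] at this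
    exact this.eventually (gt_mem_nhds (by positivity))
  have e2 : ∃ R : ℝ, ∀ ξ : Rd d, R ≤ ‖ξ‖ → ‖h ξ‖ < ε / D ∧ ‖k ξ‖ < ε / D := by
    have := (e1 h).and (e1 k)
    rw [← Metric.cobounded_eq_cocompact, ← comap_norm_atTop, eventually_comap] at this
    obtain ⟨R, hR⟩ := eventually_atTop.1 this
    exact ⟨R, fun ξ hξ => hR _ hξ ξ rfl⟩
  obtain ⟨R, hR⟩ := e2
  have e3 : ∀ᶠ ξ in cocompact (Rd d), 2 * R ≤ ‖ξ‖ := by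
    rw [← Metric.cobounded_eq_cocompact, ← comap_norm_atTop, eventually_comap]
    filter_upwards [eventually_ge_atTop (2 * R)] with b hb a ha
    rw [ha]; exact hb
  filter_upwards [e3] with ξ hξ
  have h1 : ‖fconv (p.hat h) (p.hat k) ξ‖ ≤
      ε / D * (‖h‖ + ‖k‖) * ∫ η, p.toFun η * p.toFun (ξ - η) := by
    rw [← integral_const_mul]
    refine norm_integral_le_of_norm_le ((p.integrable_conv ξ).const_mul _)
      (ae_of_all _ fun η => ?_)
    have h2 : ‖p.hat h η * p.hat k (ξ - η)‖ =
        ‖h η‖ * ‖k (ξ - η)‖ * (p.toFun η * p.toFun (ξ - η)) := by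
      simp only [hat, norm_mul, Complex.norm_real, Real.norm_of_nonneg (p.pos _).le]; ring
    rw [h2]
    refine mul_le_mul_of_nonneg_right ?_ (mul_pos (p.pos _) (p.pos _)).le
    have h3 : R ≤ ‖η‖ ∨ R ≤ ‖ξ - η‖ := by
      by_contra hc
      push Not at hc
      have := norm_add_le η (ξ - η)
      rw [add_sub_cancel] at this
      linarith
    have h4 := CZero.norm_apply_le h η
    have h5 := CZero.norm_apply_le k (ξ - η)
    have h6 : 0 < ε / D := by positivity
    rcases h3 with h3 | h3
    · have := (hR _ h3).1
      nlinarith [norm_nonneg (h η), norm_nonneg (k (ξ - η)), norm_nonneg h, norm_nonneg k]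
    · have := (hR _ h3).2
      nlinarith [norm_nonneg (h η), norm_nonneg (k (ξ - η)), norm_nonneg h, norm_nonneg k]
  rw [dist_zero_right, norm_mul, norm_inv, Complex.norm_real, Real.norm_of_nonneg (p.pos ξ).le,
    inv_mul_lt_iff₀ (p.pos ξ)]
  have h2 := p.conv_le ξ
  have h3 := p.pos ξ
  have h4 : ε / D * (‖h‖ + ‖k‖) * ∫ η, p.toFun η * p.toFun (ξ - η) ≤
      ε / D * (‖h‖ + ‖k‖) * (p.const * p.toFun ξ) :=
    mul_le_mul_of_nonneg_left h2 (by positivity)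
  have h5 : ε / D * (‖h‖ + ‖k‖) * (p.const * p.toFun ξ) = (ε / D) * (D - 1) * p.toFun ξ := by
    rw [hD]; ring
  have h6 : (ε / D) * (D - 1) < ε := by
    rw [div_mul_eq_mul_div, div_lt_iff₀ hDpos]; nlinarith
  nlinarith

/-- The convolution product. -/
def mulFun (h k : CZero d) : CZero d :=
  ⟨⟨fun ξ => (p.toFun ξ : ℂ)⁻¹ * fconv (p.hat h) (p.hat k) ξ,
    ((Complex.continuous_ofReal.comp p.continuous_toFun).inv₀
      fun ξ => Complex.ofReal_ne_zero.2 (p.pos ξ).ne').mul (p.continuous_fconv_hat h k)⟩,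
    p.tendsto_fconv_hat h k⟩

theorem hat_mulFun (h k : CZero d) (ξ : Rd d) :
    p.hat (p.mulFun h k) ξ = fconv (p.hat h) (p.hat k) ξ := by
  change (p.toFun ξ : ℂ) * ((p.toFun ξ : ℂ)⁻¹ * fconv (p.hat h) (p.hat k) ξ) = _
  rw [mul_inv_cancel_left₀ (by exact_mod_cast (p.pos ξ).ne')]

theorem norm_mulFun_le (h k : CZero d) : ‖p.mulFun h k‖ ≤ p.const * ‖h‖ * ‖k‖ := by
  refine CZero.norm_le (by have := p.const_nonneg; positivity) fun ξ => ?_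
  change ‖(p.toFun ξ : ℂ)⁻¹ * fconv (p.hat h) (p.hat k) ξ‖ ≤ _
  rw [norm_mul, norm_inv, Complex.norm_real, Real.norm_of_nonneg (p.pos ξ).le,
    inv_mul_le_iff₀ (p.pos ξ), mul_comm (p.toFun ξ)]
  exact p.norm_fconv_hat_le h k ξ

/-- The convolution product as a continuous bilinear map. -/
def mul : CZero d →L[ℂ] CZero d →L[ℂ] CZero d :=
  LinearMap.mkContinuous₂
    (LinearMap.mk₂ ℂ p.mulFun
      (fun h h' k => p.hat_injective fun ξ => by
        rw [hat_add]; simp only [hat_mulFun, fconv, hat_add, add_mul]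
        exact integral_add (p.integrable_integrand h k ξ) (p.integrable_integrand h' k ξ))
      (fun c h k => p.hat_injective fun ξ => by
        rw [hat_smul]; simp only [hat_mulFun, fconv, hat_smul, mul_assoc]
        exact integral_const_mul _ _)
      (fun h k k' => p.hat_injective fun ξ => by
        rw [hat_add]; simp only [hat_mulFun, fconv, hat_add, mul_add]
        exact integral_add (p.integrable_integrand h k ξ) (p.integrable_integrand h k' ξ))
      (fun c h k => p.hat_injective fun ξ => by
        rw [hat_smul]; simp only [hat_mulFun, fconv, hat_smul, mul_left_comm _ c]
        exact integral_const_mul _ _))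
    p.const p.norm_mulFun_le

theorem hat_mul (h k : CZero d) (ξ : Rd d) :
    p.hat (p.mul h k) ξ = fconv (p.hat h) (p.hat k) ξ := p.hat_mulFun h k ξ

theorem norm_mul_le (h k : CZero d) : ‖p.mul h k‖ ≤ p.const * ‖h‖ * ‖k‖ := p.norm_mulFun_le h k

/-- The nonlinearity `|u|⁴` on the Fourier side. -/
def quartic (h : CZero d) : CZero d :=
  p.mul (p.mul (p.mul h (conjRefl h)) h) (conjRefl h)

/-- The nonlinearity `|u|⁴u` on the Fourier side. -/
def quintic (h : CZero d) : CZero d := p.mul (p.quartic h) h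

theorem norm_mul_sub_le {h k h' k' : CZero d} {a b e f : ℝ} (ha : ‖h‖ ≤ a)
    (hb : ‖k'‖ ≤ b) (he : ‖h - h'‖ ≤ e) (hf : ‖k - k'‖ ≤ f) :
    ‖p.mul h k - p.mul h' k'‖ ≤ p.const * (a * f + e * b) := by
  have h1 : p.mul h k - p.mul h' k' = p.mul h (k - k') + p.mul (h - h') k' := by
    simp [map_sub]
  rw [h1]
  have hc := p.const_nonneg
  have a0 := (norm_nonneg _).trans ha
  have e0 := (norm_nonneg _).trans he
  calc _ ≤ ‖p.mul h (k - k')‖ + ‖p.mul (h - h') k'‖ := norm_add_le _ _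
    _ ≤ p.const * ‖h‖ * ‖k - k'‖ + p.const * ‖h - h'‖ * ‖k'‖ :=
        add_le_add (p.norm_mul_le _ _) (p.norm_mul_le _ _)
    _ ≤ p.const * a * f + p.const * e * b := by gcongr
    _ = _ := by ring

theorem norm_mul_le_of_le {h k : CZero d} {a b : ℝ} (ha : ‖h‖ ≤ a) (hb : ‖k‖ ≤ b) :
    ‖p.mul h k‖ ≤ p.const * a * b := by
  have hc := p.const_nonneg
  have a0 := (norm_nonneg _).trans ha
  exact (p.norm_mul_le h k).trans (by gcongr)

theorem norm_quartic_le {h : CZero d} {A : ℝ} (hA : ‖h‖ ≤ A) :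
    ‖p.quartic h‖ ≤ p.const ^ 3 * A ^ 4 := by
  have hs : ‖conjRefl h‖ ≤ A := by rwa [LinearIsometry.norm_map]
  have := p.norm_mul_le_of_le (p.norm_mul_le_of_le (p.norm_mul_le_of_le hA hs) hA) hs
  exact this.trans_eq (by ring)

theorem norm_quintic_le {h : CZero d} {A : ℝ} (hA : ‖h‖ ≤ A) :
    ‖p.quintic h‖ ≤ p.const ^ 4 * A ^ 5 := by
  have := p.norm_mul_le_of_le (p.norm_quartic_le hA) hA
  exact this.trans_eq (by ring)

/-- The five factors are exchanged one at a time, whence the constant 5. -/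
theorem norm_quintic_sub_le {h k : CZero d} {A : ℝ} (hA : ‖h‖ ≤ A) (kA : ‖k‖ ≤ A) :
    ‖p.quintic h - p.quintic k‖ ≤ 5 * p.const ^ 4 * A ^ 4 * ‖h - k‖ := by
  have hs : ‖conjRefl h‖ ≤ A := by rwa [LinearIsometry.norm_map]
  have ks : ‖conjRefl k‖ ≤ A := by rwa [LinearIsometry.norm_map]
  have hks : ‖conjRefl h - conjRefl k‖ ≤ ‖h - k‖ := by
    rw [← map_sub, LinearIsometry.norm_map]
  have m2 := p.norm_mul_le_of_le hA hs
  have m3 := p.norm_mul_le_of_le m2 hA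
  have m4 := p.norm_mul_le_of_le m3 hs
  have d2 := p.norm_mul_sub_le hA ks (le_refl ‖h - k‖) hks
  have d3 := p.norm_mul_sub_le m2 kA d2 (le_refl ‖h - k‖)
  have d4 := p.norm_mul_sub_le m3 ks d3 hks
  have d5 := p.norm_mul_sub_le m4 kA d4 (le_refl ‖h - k‖)
  exact d5.trans_eq (by ring)

theorem quintic_zero : p.quintic 0 = 0 := by simp [quintic]

theorem continuous_quintic : Continuous p.quintic := by
  have key : ∀ f g : CZero d → CZero d, Continuous f → Continuous g →
      Continuous fun h => p.mul (f h) (g h) :=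
    fun f g hf hg => (p.mul.continuous.comp hf).clm_apply hg
  have hi : Continuous fun h : CZero d => h := continuous_id
  have hs : Continuous fun h : CZero d => conjRefl h := conjRefl.continuous
  exact key _ _ (key _ _ (key _ _ (key _ _ hi hs) hi) hs) hi

/-- The function on the physical side represented by `h`. -/
def ev (h : CZero d) (x : Rd d) : ℂ := 𝓕⁻ (p.hat h) x

theorem ev_eq (h : CZero d) (x : Rd d) :
    p.ev h x = ∫ ξ, Real.fourierChar (inner ℝ ξ x) • p.hat h ξ := Real.fourierInv_eq _ _

theorem integrable_ev_integrand (h : CZero d) (x : Rd d) :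
    Integrable fun ξ => Real.fourierChar (inner ℝ ξ x) • p.hat h ξ := by
  have := (Real.fourierIntegral_convergent_iff (-x)).2 (p.integrable_hat h)
  simpa using this

theorem norm_ev_le (h : CZero d) (x : Rd d) : ‖p.ev h x‖ ≤ ∫ ξ, ‖p.hat h ξ‖ := by
  rw [ev_eq]
  refine (norm_integral_le_integral_norm _).trans_eq ?_
  simp

theorem norm_ev_le' (h : CZero d) (x : Rd d) : ‖p.ev h x‖ ≤ (∫ ξ, p.toFun ξ) * ‖h‖ := by
  refine (p.norm_ev_le h x).trans ?_
  rw [← integral_mul_const]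
  exact integral_mono (p.integrable_hat h).norm (p.integrable_toFun.mul_const _)
    fun ξ => p.norm_hat_le h ξ

/-- Evaluation on the physical side, as a continuous linear form. -/
def evCLM (x : Rd d) : CZero d →L[ℂ] ℂ :=
  LinearMap.mkContinuous
    { toFun := fun h => p.ev h x
      map_add' := fun h k => by
        simp only [ev_eq, hat_add, smul_add]
        exact integral_add (p.integrable_ev_integrand h x) (p.integrable_ev_integrand k x)
      map_smul' := fun c h => by
        simp only [ev_eq, hat_smul, Circle.smul_def, smul_eq_mul, RingHom.id_apply,
          mul_left_comm _ c]
        exact integral_const_mul _ _ }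
    (∫ ξ, p.toFun ξ) fun h => p.norm_ev_le' h x

theorem evCLM_apply (h : CZero d) (x : Rd d) : p.evCLM x h = p.ev h x := rfl

theorem ev_mul (h k : CZero d) (x : Rd d) : p.ev (p.mul h k) x = p.ev h x * p.ev k x := by
  have h1 : p.hat (p.mul h k) = convolution (p.hat h) (p.hat k) (ContinuousLinearMap.mul ℂ ℂ)
      volume := by
    ext ξ; rw [hat_mul, fconv_eq]
  unfold ev
  rw [h1, Real.fourierInv_eq_fourier_neg, Real.fourierInv_eq_fourier_neg,
    Real.fourierInv_eq_fourier_neg]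
  exact Real.fourier_mul_convolution_eq (p.integrable_hat h) (p.integrable_hat k) (-x)

theorem ev_conjRefl (h : CZero d) (x : Rd d) : p.ev (conjRefl h) x = star (p.ev h x) := by
  rw [ev_eq, ev_eq, Complex.star_def, ← integral_conj, ← integral_neg_eq_self]
  refine integral_congr_ae (ae_of_all _ fun ξ => ?_)
  simp only [hat_conjRefl, neg_neg, inner_neg_left, Circle.smul_def, smul_eq_mul, map_mul,
    AddChar.map_neg_eq_inv, Circle.coe_inv_eq_conj, Complex.star_def]

theorem ev_quartic (h : CZero d) (x : Rd d) : p.ev (p.quartic h) x = (‖p.ev h x‖ : ℂ) ^ 4 := by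
  unfold quartic
  rw [ev_mul, ev_mul, ev_mul, ev_conjRefl, Complex.star_def, Complex.mul_conj,
    mul_assoc, Complex.mul_conj, Complex.normSq_eq_norm_sq]
  push_cast; ring

theorem ev_quintic (h : CZero d) (x : Rd d) :
    p.ev (p.quintic h) x = (‖p.ev h x‖ : ℂ) ^ 4 * p.ev h x := by
  unfold quintic
  rw [ev_mul, ev_quartic]

/-- This permits identities in the algebra to be verified pointwise in physical space, where the
product is the ordinary one. -/
theorem ev_injective {h k : CZero d} (H : ∀ x, p.ev h x = p.ev k x) : h = k := by
  rw [← sub_eq_zero]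
  have h0 : 𝓕⁻ (p.hat (h - k)) = 0 := by
    ext x
    have : p.evCLM x (h - k) = 0 := by rw [map_sub, evCLM_apply, evCLM_apply, H, sub_self]
    exact this
  have h0' : 𝓕 (p.hat (h - k)) = 0 := by
    ext x
    have := congrFun h0 (-x)
    rw [Real.fourierInv_eq_fourier_neg, neg_neg] at this
    exact this
  have h1 := (p.continuous_hat (h - k)).fourierInv_fourier_eq (p.integrable_hat (h - k))
    (by rw [h0']; exact integrable_zero _ _ _)
  apply p.hat_injective
  intro ξ
  rw [← h1, h0']
  simp [hat, Real.fourierInv_eq]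

end ConvWeight

/-! ### Exact solutions of an ordinary differential equation near approximate ones -/

section Shadowing

variable {E : Type*} [NormedAddCommGroup E] [NormedSpace ℝ E]

/-- The radial retraction onto the ball of radius `r`. -/
def radialRetract (r : ℝ) (x : E) : E := if ‖x‖ ≤ r then x else (r / ‖x‖) • x

theorem norm_radialRetract_le {r : ℝ} (hr : 0 ≤ r) (x : E) : ‖radialRetract r x‖ ≤ r := by
  unfold radialRetract
  split_ifs with h
  · exact h
  · push Not at h
    have hx : 0 < ‖x‖ := hr.trans_lt h
    rw [norm_smul, norm_div, norm_norm, Real.norm_of_nonneg hr, div_mul_cancel₀ _ hx.ne']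

theorem radialRetract_of_le {r : ℝ} {x : E} (h : ‖x‖ ≤ r) : radialRetract r x = x := if_pos h

theorem norm_radialRetract_sub_le_of_ge {r : ℝ} (hr : 0 ≤ r) {x y : E} (hxy : ‖y‖ ≤ ‖x‖) :
    ‖radialRetract r x - radialRetract r y‖ ≤ 2 * ‖x - y‖ := by
  have htri : ‖x‖ - ‖y‖ ≤ ‖x - y‖ := norm_sub_norm_le x y
  have hn := norm_nonneg (x - y)
  unfold radialRetract
  split_ifs with h1 h2 h2
  · linarith
  · exact absurd (hxy.trans h1) h2
  · push Not at h1
    have hx : 0 < ‖x‖ := hr.trans_lt h1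
    have e1 : (r / ‖x‖) • x - y = (x - y) - (1 - r / ‖x‖) • x := by
      rw [sub_smul, one_smul]; abel
    have e2 : ‖(1 - r / ‖x‖) • x‖ = ‖x‖ - r := by
      rw [norm_smul, Real.norm_of_nonneg (by rw [sub_nonneg, div_le_one hx]; exact h1.le), sub_mul,
        div_mul_cancel₀ _ hx.ne', one_mul]
    rw [e1]
    refine (norm_sub_le _ _).trans ?_
    rw [e2]; linarith
  · push Not at h1 h2
    have hx : 0 < ‖x‖ := hr.trans_lt h1
    have hy : 0 < ‖y‖ := hr.trans_lt h2
    have e1 : (r / ‖x‖) • x - (r / ‖y‖) • y =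
        (r / ‖x‖) • (x - y) - (r / ‖y‖ - r / ‖x‖) • y := by
      rw [smul_sub, sub_smul]; abel
    have h3 : r / ‖x‖ ≤ 1 := (div_le_one hx).2 h1.le
    have h4 : r / ‖x‖ ≤ r / ‖y‖ := div_le_div_of_nonneg_left hr hy hxy
    have e2 : ‖(r / ‖y‖ - r / ‖x‖) • y‖ = (r / ‖x‖) * (‖x‖ - ‖y‖) := by
      rw [norm_smul, Real.norm_of_nonneg (sub_nonneg.2 h4)]
      field_simp
    rw [e1]
    refine (norm_sub_le _ _).trans ?_
    rw [e2, norm_smul, Real.norm_of_nonneg (by positivity)]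
    have h5 : 0 ≤ r / ‖x‖ := by positivity
    nlinarith

theorem norm_radialRetract_sub_le {r : ℝ} (hr : 0 ≤ r) (x y : E) :
    ‖radialRetract r x - radialRetract r y‖ ≤ 2 * ‖x - y‖ := by
  rcases le_total ‖y‖ ‖x‖ with h | h
  · exact norm_radialRetract_sub_le_of_ge hr h
  · rw [norm_sub_rev, norm_sub_rev x]
    exact norm_radialRetract_sub_le_of_ge hr h

/-- Replaces the quotient by `K` in the Gronwall bound by an expression that also makes sense for `K
= 0`. -/
theorem gronwallBound_le {δ K ε x : ℝ} (hK : 0 ≤ K) (hε : 0 ≤ ε) :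
    gronwallBound δ K ε x ≤ (δ + ε * x) * Real.exp (K * x) := by
  rcases hK.eq_or_lt with rfl | hK
  · simp [gronwallBound_K0]
  · rw [gronwallBound_of_K_ne_0 hK.ne', add_mul]
    have h1 : Real.exp (K * x) - 1 ≤ K * x * Real.exp (K * x) := by
      have h2 := Real.add_one_le_exp (-(K * x))
      have h3 := Real.exp_pos (K * x)
      have h4 : Real.exp (-(K * x)) * Real.exp (K * x) = 1 := by
        rw [← Real.exp_add]; simp
      nlinarith
    have h5 : ε / K * (Real.exp (K * x) - 1) ≤ ε / K * (K * x * Real.exp (K * x)) :=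
      mul_le_mul_of_nonneg_left h1 (by positivity)
    have h6 : ε / K * (K * x * Real.exp (K * x)) = ε * x * Real.exp (K * x) := by
      field_simp
    linarith

/-- An approximate solution of an ordinary differential equation with a locally Lipschitz right
hand side is shadowed by an exact solution, on the whole interval of existence of the former. -/
theorem exists_solution_near [CompleteSpace E] {F : ℝ → E → E} {τ A K e e₀ : ℝ} (hτ : 0 ≤ τ)
    (hA : 0 ≤ A) (hK : 0 ≤ K) (he : 0 ≤ e) (he₀ : 0 ≤ e₀) (hcont : ∀ x, Continuous fun t => F t x)
    (hlip : ∀ t x y, ‖x‖ ≤ 2 * A → ‖y‖ ≤ 2 * A → ‖F t x - F t y‖ ≤ K * ‖x - y‖)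
    (h0 : ∀ t, F t 0 = 0) {y y' : ℝ → E}
    (hy : ∀ t ∈ Icc 0 τ, HasDerivWithinAt y (y' t) (Icc 0 τ) t)
    (hyA : ∀ t ∈ Icc 0 τ, ‖y t‖ ≤ A) (hye : ∀ t ∈ Icc 0 τ, ‖y' t - F t (y t)‖ ≤ e)
    {x₀ : E} (hx₀ : ‖x₀ - y 0‖ ≤ e₀) (hsmall : (e₀ + e * τ) * Real.exp (2 * K * τ) ≤ A) :
    ∃ z : ℝ → E, z 0 = x₀ ∧
      (∀ t ∈ Icc 0 τ, HasDerivWithinAt z (F t (z t)) (Icc 0 τ) t) ∧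
      ∀ t ∈ Icc 0 τ, ‖z t - y t‖ ≤ (e₀ + e * τ) * Real.exp (2 * K * τ) := by
  have h2A : 0 ≤ 2 * A := by positivity
  -- Truncation to the ball of radius `2A` makes the field bounded and globally Lipschitz, so that a
  -- solution exists on all of `[0, τ]`. The retraction has Lipschitz constant 2, whence the rate
  -- `2K`.
  set G : ℝ → E → E := fun t x => F t (radialRetract (2 * A) x) with hG
  have hGlip : ∀ t, LipschitzWith (2 * K).toNNReal (G t) := fun t => by
    refine LipschitzWith.of_dist_le_mul fun x x' => ?_
    rw [dist_eq_norm, dist_eq_norm, Real.coe_toNNReal _ (by positivity)]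
    have h1 := hlip t _ _ (norm_radialRetract_le h2A x) (norm_radialRetract_le h2A x')
    have h2 := norm_radialRetract_sub_le h2A x x'
    calc _ ≤ K * ‖radialRetract (2 * A) x - radialRetract (2 * A) x'‖ := h1
      _ ≤ K * (2 * ‖x - x'‖) := by gcongr
      _ = _ := by ring
  have hGb : ∀ t x, ‖G t x‖ ≤ K * (2 * A) := fun t x => by
    have h1 := hlip t (radialRetract (2 * A) x) 0 (norm_radialRetract_le h2A x) (by simpa)
    rw [h0, sub_zero, sub_zero] at h1
    exact h1.trans (mul_le_mul_of_nonneg_left (norm_radialRetract_le h2A x) hK)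
  have hPL : IsPicardLindelof G (⟨0, le_refl 0, hτ⟩ : Icc (0 : ℝ) τ) x₀
      (K * (2 * A) * τ).toNNReal 0 (K * (2 * A)).toNNReal (2 * K).toNNReal :=
    { lipschitzOnWith := fun t _ => (hGlip t).lipschitzOnWith
      continuousOn := fun x _ => (hcont _).continuousOn
      norm_le := fun t _ x _ => by
        rw [Real.coe_toNNReal _ (by positivity)]; exact hGb t x
      mul_max_le := by
        rw [Real.coe_toNNReal _ (by positivity), Real.coe_toNNReal _ (by positivity)]
        simp [hτ] }
  obtain ⟨z, hz0, hz⟩ := hPL.exists_eq_forall_mem_Icc_hasDerivWithinAt₀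
  have hz0 : z 0 = x₀ := hz0
  have hIci : ∀ {f : ℝ → E} {f' : E} {t : ℝ}, t ∈ Ico 0 τ →
      HasDerivWithinAt f f' (Icc 0 τ) t → HasDerivWithinAt f f' (Ici t) t := by
    intro f f' t ht hf
    refine hf.mono_of_mem_nhdsWithin ?_
    exact Filter.mem_of_superset (Icc_mem_nhdsGE ht.2) (Icc_subset_Icc_left ht.1)
  have hgw := dist_le_of_approx_trajectories_ODE (v := G) (f := z) (g := y) (f' := fun t => G t (z t))
    (g' := y') (a := 0) (b := τ) (εf := 0) (εg := e) (δ := e₀) hGlip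
    (fun t ht => (hz t ht).continuousWithinAt)
    (fun t ht => hIci ht (hz t (Ico_subset_Icc_self ht))) (fun t _ => by simp)
    (fun t ht => (hy t ht).continuousWithinAt)
    (fun t ht => hIci ht (hy t (Ico_subset_Icc_self ht)))
    (fun t ht => by
      have ht' := Ico_subset_Icc_self ht
      rw [dist_eq_norm, hG]
      simp only
      rw [radialRetract_of_le ((hyA t ht').trans (by linarith))]
      exact hye t ht')
    (by rw [dist_eq_norm, hz0]; exact hx₀)
  have hclose : ∀ t ∈ Icc 0 τ, ‖z t - y t‖ ≤ (e₀ + e * τ) * Real.exp (2 * K * τ) := by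
    intro t ht
    have h1 := hgw t ht
    rw [dist_eq_norm, sub_zero, zero_add, Real.coe_toNNReal _ (by positivity)] at h1
    refine h1.trans ((gronwallBound_le (by positivity) he).trans ?_)
    have := ht.2
    have := ht.1
    gcongr
  refine ⟨z, hz0, fun t ht => ?_, hclose⟩
  -- The solution is within `A` of a curve bounded by `A`, so it never feels the truncation.
  have h1 : ‖z t‖ ≤ 2 * A := by
    have h2 := norm_le_norm_add_norm_sub (y t) (z t)
    have h3 := hclose t ht
    rw [norm_sub_rev] at h2
    have h4 := hyA t ht
    linarith
  have h2 := hz t ht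
  simp only [hG] at h2
  rwa [radialRetract_of_le h1] at h2

end Shadowing

/-! ### The propagator of `Δ²` and its derivative in time -/

variable {d : ℕ}

/-- The derivative in `a` is `i (exp(ia) - 1)`, of norm at most `|a|`, and the mean value inequality
gives `a²`, without the optimal factor `1/2`. -/
theorem norm_exp_I_mul_sub_one_sub_le (a : ℝ) :
    ‖Complex.exp (Complex.I * a) - 1 - Complex.I * a‖ ≤ a ^ 2 := by
  have hder : ∀ x ∈ Set.uIcc 0 a, HasDerivWithinAt
      (fun x : ℝ => Complex.exp (Complex.I * x) - 1 - Complex.I * x)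
      (Complex.I * (Complex.exp (Complex.I * x) - 1)) (Set.uIcc 0 a) x := by
    intro x _
    have h1 : HasDerivAt (fun x : ℝ => Complex.I * (x : ℂ)) (Complex.I * 1) x :=
      (Complex.ofRealCLM.hasDerivAt (x := x)).const_mul _
    have h2 := ((h1.cexp).sub_const 1).sub h1
    refine (h2.congr_deriv ?_).hasDerivWithinAt
    simp only [mul_one]; ring
  have h := Convex.norm_image_sub_le_of_norm_hasDerivWithin_le (C := |a|) hder (fun x hx => ?_)
    (convex_uIcc 0 a) Set.left_mem_uIcc Set.right_mem_uIcc
  · simpa [sq, Real.norm_eq_abs] using h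
  · rw [norm_mul, Complex.norm_I, one_mul]
    refine Real.norm_exp_I_mul_ofReal_sub_one_le.trans ?_
    rw [Real.norm_eq_abs]
    simpa using Set.abs_sub_left_of_mem_uIcc hx

theorem integral_fourierInv_mul {f g : Rd d → ℂ} (hf : Integrable f) (hg : Integrable g) :
    ∫ ξ, 𝓕⁻ f ξ * g ξ = ∫ x, f x * 𝓕⁻ g x := by
  have hg' : Integrable fun x => g (-x) := hg.comp_neg
  have h := VectorFourier.integral_fourierIntegral_smul_eq_flip (L := innerₗ (Rd d))
    (e := Real.fourierChar) (μ := volume) (ν := volume) (f := f) (g := fun x => g (-x))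
    Real.continuous_fourierChar continuous_inner hf hg'
  rw [flip_innerₗ] at h
  calc ∫ ξ, 𝓕⁻ f ξ * g ξ = ∫ ξ, 𝓕⁻ f (-ξ) * g (-ξ) := (integral_neg_eq_self _ _).symm
    _ = ∫ ξ, 𝓕 f ξ * g (-ξ) := by simp_rw [Real.fourierInv_eq_fourier_neg, neg_neg]
    _ = ∫ x, f x * 𝓕 (fun x => g (-x)) x := h
    _ = _ := by simp_rw [Real.fourierInv_eq_fourier_comp_neg]

theorem continuous_fourierInv {f : Rd d → ℂ} (hf : Integrable f) : Continuous (𝓕⁻ f) := by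
  have h : Continuous (𝓕 f) := VectorFourier.fourierIntegral_continuous
    Real.continuous_fourierChar (L := innerₗ (Rd d)) continuous_inner hf
  have : 𝓕⁻ f = fun x => 𝓕 f (-x) := by ext x; exact Real.fourierInv_eq_fourier_neg f x
  rw [this]; fun_prop

/-- The symbol of `Δ²`. -/
def symbol (ξ : Rd d) : ℝ := (2 * Real.pi * ‖ξ‖) ^ 4

theorem symbol_nonneg (ξ : Rd d) : 0 ≤ symbol ξ := by unfold symbol; positivity

theorem continuous_symbol : Continuous (symbol : Rd d → ℝ) := by unfold symbol; fun_prop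

theorem continuous_phase (t : ℝ) :
    Continuous fun ξ : Rd d => Complex.exp (Complex.I * ((t * symbol ξ : ℝ) : ℂ)) := by
  have := continuous_symbol (d := d)
  fun_prop

theorem norm_phase (a : ℝ) : ‖Complex.exp (Complex.I * (a : ℂ))‖ = 1 := by
  rw [mul_comm]; exact Complex.norm_exp_ofReal_mul_I a

theorem CZero.exists_radius (h : CZero d) {ε : ℝ} (hε : 0 < ε) :
    ∃ R : ℝ, ∀ ξ : Rd d, R ≤ ‖ξ‖ → ‖h ξ‖ < ε := by
  have := (zero_at_infty h).norm
  rw [norm_zero] at this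
  have := this.eventually (gt_mem_nhds hε)
  rw [← Metric.cobounded_eq_cocompact, ← comap_norm_atTop, eventually_comap] at this
  obtain ⟨R, hR⟩ := eventually_atTop.1 this
  exact ⟨R, fun ξ hξ => hR _ hξ ξ rfl⟩

/-- The propagator `e^{itΔ²}` on the Fourier side. -/
def propagator (t : ℝ) : CZero d →ₗᵢ[ℂ] CZero d where
  toFun h := ⟨⟨fun ξ => Complex.exp (Complex.I * ((t * symbol ξ : ℝ) : ℂ)) * h ξ,
    (continuous_phase t).mul h.continuous⟩, by
      rw [tendsto_zero_iff_norm_tendsto_zero]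
      have := (zero_at_infty h).norm
      rw [norm_zero] at this
      refine this.congr fun ξ => ?_
      change _ = ‖Complex.exp (Complex.I * ((t * symbol ξ : ℝ) : ℂ)) * h ξ‖
      rw [norm_mul, norm_phase, one_mul]⟩
  map_add' h k := by
    ext ξ
    exact mul_add _ _ _
  map_smul' c h := by
    ext ξ
    exact mul_left_comm _ _ _
  norm_map' h := by
    have key : ∀ k : CZero d, (∀ ξ, ‖k ξ‖ = ‖h ξ‖) → ‖k‖ = ‖h‖ := fun k hk =>
      le_antisymm (CZero.norm_le (norm_nonneg _) fun ξ => (hk ξ).le.trans (CZero.norm_apply_le _ _))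
        (CZero.norm_le (norm_nonneg _) fun ξ => (hk ξ).ge.trans (CZero.norm_apply_le _ _))
    refine key _ fun ξ => ?_
    change ‖Complex.exp (Complex.I * ((t * symbol ξ : ℝ) : ℂ)) * h ξ‖ = _
    rw [norm_mul, norm_phase, one_mul]

theorem propagator_apply (t : ℝ) (h : CZero d) (ξ : Rd d) :
    propagator t h ξ = Complex.exp (Complex.I * ((t * symbol ξ : ℝ) : ℂ)) * h ξ := rfl

theorem propagator_zero (h : CZero d) : propagator 0 h = h := by
  ext ξ; simp [propagator_apply]

theorem propagator_add (s t : ℝ) (h : CZero d) :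
    propagator s (propagator t h) = propagator (s + t) h := by
  ext ξ
  rw [propagator_apply, propagator_apply, propagator_apply, ← mul_assoc, ← Complex.exp_add]
  congr 2; push_cast; ring

theorem norm_propagator_sub_apply_le (t : ℝ) (h : CZero d) (ξ : Rd d) :
    ‖(propagator t h - h) ξ‖ ≤ |t| * symbol ξ * ‖h ξ‖ := by
  have : (propagator t h - h) ξ =
      (Complex.exp (Complex.I * ((t * symbol ξ : ℝ) : ℂ)) - 1) * h ξ := by
    rw [ZeroAtInftyContinuousMap.sub_apply, propagator_apply]; ring
  rw [this, norm_mul]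
  refine mul_le_mul_of_nonneg_right ?_ (norm_nonneg _)
  refine Real.norm_exp_I_mul_ofReal_sub_one_le.trans_eq ?_
  rw [Real.norm_eq_abs, abs_mul, abs_of_nonneg (symbol_nonneg ξ)]

/-- Outside a large ball `h` is small and phases do not matter; inside it the symbol is bounded.
This strong continuity is all that holds: the symbol is unbounded. -/
theorem tendsto_propagator_sub (h : CZero d) :
    Tendsto (fun t => ‖propagator t h - h‖) (𝓝 0) (𝓝 0) := by
  rw [Metric.tendsto_nhds]
  intro ε hε
  obtain ⟨R, hR⟩ := h.exists_radius (ε := ε / 4) (by positivity)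
  set B : ℝ := (2 * Real.pi * |R|) ^ 4 * ‖h‖ + 1 with hB
  have hBpos : 0 < B := by positivity
  have : ∀ᶠ t : ℝ in 𝓝 0, |t| < ε / 2 / B := by
    have := Metric.ball_mem_nhds (0 : ℝ) (ε := ε / 2 / B) (by positivity)
    filter_upwards [this] with t ht
    simpa using ht
  filter_upwards [this] with t ht
  rw [dist_zero_right, norm_norm]
  have : ‖propagator t h - h‖ ≤ ε / 2 := by
    refine CZero.norm_le (by positivity) fun ξ => ?_
    rcases le_or_gt R ‖ξ‖ with h1 | h1
    · have h2 := hR ξ h1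
      rw [ZeroAtInftyContinuousMap.sub_apply]
      refine (norm_sub_le _ _).trans ?_
      rw [propagator_apply, norm_mul, norm_phase]; linarith
    · refine (norm_propagator_sub_apply_le t h ξ).trans ?_
      have h3 : symbol ξ * ‖h ξ‖ ≤ (2 * Real.pi * |R|) ^ 4 * ‖h‖ := by
        refine mul_le_mul ?_ (CZero.norm_apply_le _ _) (norm_nonneg _) (by positivity)
        unfold symbol
        have := Real.pi_pos
        gcongr
        exact h1.le.trans (le_abs_self R)
      rw [mul_assoc]
      calc _ ≤ ε / 2 / B * B := by
            refine mul_le_mul ht.le (h3.trans (by simp [hB])) (by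
              have := symbol_nonneg ξ; positivity) (by positivity)
        _ = ε / 2 := by field_simp
  linarith

theorem continuous_propagator_apply (h : CZero d) : Continuous fun t => propagator t h := by
  rw [continuous_iff_continuousAt]
  intro t
  rw [ContinuousAt, tendsto_iff_norm_sub_tendsto_zero]
  have h1 : Tendsto (fun s : ℝ => s - t) (𝓝 t) (𝓝 0) := by
    have : Continuous fun s : ℝ => s - t := by fun_prop
    simpa using this.tendsto t
  refine ((tendsto_propagator_sub h).comp h1).congr fun s => ?_
  have : propagator s h - propagator t h = propagator t (propagator (s - t) h - h) := by
    rw [map_sub, propagator_add, add_sub_cancel]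
  rw [this, LinearIsometry.norm_map, Function.comp]

theorem continuous_propagator : Continuous fun q : CZero d × ℝ => propagator q.2 q.1 :=
  continuous_prod_of_continuous_lipschitzWith _ 1 (fun h => continuous_propagator_apply h)
    (fun t => (propagator t).lipschitz)

/-- The pairing with an integrable function. -/
def pairCLM (k : Rd d → ℂ) (hk : Integrable k) : CZero d →L[ℝ] ℂ :=
  have hi : ∀ h : CZero d, Integrable fun ξ => k ξ * h ξ := fun h =>
    hk.mul_bdd (c := ‖h‖) h.continuous.aestronglyMeasurable
      (ae_of_all _ fun ξ => CZero.norm_apply_le h ξ)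
  LinearMap.mkContinuous
    { toFun := fun h => ∫ ξ, k ξ * h ξ
      map_add' := fun h h' => by
        simp only [ZeroAtInftyContinuousMap.add_apply, mul_add]
        exact integral_add (hi h) (hi h')
      map_smul' := fun c h => by
        simp only [ZeroAtInftyContinuousMap.smul_apply, RingHom.id_apply, mul_smul_comm]
        exact integral_smul _ _ }
    (∫ ξ, ‖k ξ‖) fun h => by
      rw [← integral_mul_const]
      refine norm_integral_le_of_norm_le (hk.norm.mul_const _) (ae_of_all _ fun ξ => ?_)
      rw [norm_mul]
      exact mul_le_mul_of_nonneg_left (CZero.norm_apply_le h ξ) (norm_nonneg _)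

theorem pairCLM_apply (k : Rd d → ℂ) (hk : Integrable k) (h : CZero d) :
    pairCLM k hk h = ∫ ξ, k ξ * h ξ := rfl

theorem integrable_mul_phase {k : Rd d → ℂ} (hk : Integrable k) (t : ℝ) :
    Integrable fun ξ => k ξ * Complex.exp (Complex.I * ((t * symbol ξ : ℝ) : ℂ)) :=
  hk.mul_bdd (c := 1) (continuous_phase t).aestronglyMeasurable
    (ae_of_all _ fun _ => (norm_phase _).le)

/-- The propagator need not be differentiable in time on the weighted space. Paired with a `k` that
absorbs two powers of the symbol, it is differentiable even in operator norm, with a quadratic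
remainder. A product rule then applies to the pairing with a moving element. -/
theorem hasDerivAt_pairCLM_phase {k : Rd d → ℂ} (hk : Integrable k)
    (hk2 : Integrable fun ξ => (symbol ξ : ℂ) ^ 2 * k ξ) (t : ℝ)
    (hk3 : Integrable fun ξ => Complex.I * (symbol ξ : ℂ) * k ξ *
      Complex.exp (Complex.I * ((t * symbol ξ : ℝ) : ℂ))) :
    HasDerivAt (fun t => pairCLM _ (integrable_mul_phase hk t)) (pairCLM _ hk3) t := by
  refine (hasDerivAt_iff_isLittleO (𝕜 := ℝ) (F := CZero d →L[ℝ] ℂ)).2 ?_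
  set B : ℝ := ∫ ξ, ‖(symbol ξ : ℂ) ^ 2 * k ξ‖ with hB
  have hbound : ∀ s : ℝ, ‖pairCLM _ (integrable_mul_phase hk s) - pairCLM _ (integrable_mul_phase hk t)
      - (s - t) • pairCLM _ hk3‖ ≤ B * (s - t) ^ 2 := by
    intro s
    refine ContinuousLinearMap.opNorm_le_bound _
      (mul_nonneg (integral_nonneg fun _ => norm_nonneg _) (sq_nonneg _)) fun h => ?_
    simp only [sub_apply, smul_apply, pairCLM_apply]
    have hi : ∀ {k : Rd d → ℂ}, Integrable k → Integrable fun ξ => k ξ * h ξ := fun hk =>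
      hk.mul_bdd (c := ‖h‖) h.continuous.aestronglyMeasurable
        (ae_of_all _ fun ξ => CZero.norm_apply_le h ξ)
    rw [← integral_sub (hi (integrable_mul_phase hk s)) (hi (integrable_mul_phase hk t)),
      ← integral_smul]
    have hsub := integral_sub ((hi (integrable_mul_phase hk s)).sub
        (hi (integrable_mul_phase hk t))) ((hi hk3).smul (s - t))
    simp only [Pi.sub_apply, Pi.smul_apply] at hsub
    rw [← hsub, hB, ← integral_mul_const, ← integral_mul_const]
    refine norm_integral_le_of_norm_le ((hk2.norm.mul_const _).mul_const _)
      (ae_of_all _ fun ξ => ?_)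
    have e1 : k ξ * Complex.exp (Complex.I * ((s * symbol ξ : ℝ) : ℂ)) * h ξ -
        k ξ * Complex.exp (Complex.I * ((t * symbol ξ : ℝ) : ℂ)) * h ξ -
        (s - t) • (Complex.I * (symbol ξ : ℂ) * k ξ *
          Complex.exp (Complex.I * ((t * symbol ξ : ℝ) : ℂ)) * h ξ) =
        k ξ * h ξ * Complex.exp (Complex.I * ((t * symbol ξ : ℝ) : ℂ)) *
        (Complex.exp (Complex.I * (((s - t) * symbol ξ : ℝ) : ℂ)) - 1 -
          Complex.I * (((s - t) * symbol ξ : ℝ) : ℂ)) := by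
      have e2 : Complex.exp (Complex.I * ((s * symbol ξ : ℝ) : ℂ)) =
          Complex.exp (Complex.I * ((t * symbol ξ : ℝ) : ℂ)) *
          Complex.exp (Complex.I * (((s - t) * symbol ξ : ℝ) : ℂ)) := by
        rw [← Complex.exp_add]; congr 1; push_cast; ring
      rw [e2, Complex.real_smul]; push_cast; ring
    rw [e1, norm_mul, norm_mul, norm_phase, norm_mul]
    have e3 := norm_exp_I_mul_sub_one_sub_le ((s - t) * symbol ξ)
    have e4 := CZero.norm_apply_le h ξ
    rw [norm_mul, norm_pow, Complex.norm_real, Real.norm_of_nonneg (symbol_nonneg ξ)]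
    calc _ ≤ ‖k ξ‖ * ‖h‖ * 1 * ((s - t) * symbol ξ) ^ 2 := by gcongr
      _ = _ := by ring
  refine Asymptotics.IsBigO.trans_isLittleO (g := fun s : ℝ => (s - t) ^ 2) ?_ ?_
  · refine Asymptotics.IsBigO.of_bound B (Eventually.of_forall fun s => ?_)
    rw [Real.norm_of_nonneg (sq_nonneg (s - t))]
    exact hbound s
  · simp_rw [sq]
    have h1 : (fun s : ℝ => s - t) =o[𝓝 t] fun _ => (1 : ℝ) := by
      rw [Asymptotics.isLittleO_one_iff]
      have : Continuous fun s : ℝ => s - t := by fun_prop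
      simpa using this.tendsto t
    simpa using h1.mul_isBigO (Asymptotics.isBigO_refl (fun s : ℝ => s - t) (𝓝 t))

theorem fourier_laplacian_apply (φ : 𝓢(Rd d, ℂ)) (ξ : Rd d) :
    (𝓕 (Δ φ)) ξ = ((-(2 * Real.pi * ‖ξ‖) ^ 2 : ℝ) : ℂ) * (𝓕 φ) ξ := by
  rw [SchwartzMap.laplacian_eq_fourierMultiplierCLM, FourierTransform.fourier_smul,
    SchwartzMap.fourierMultiplierCLM_apply, FourierTransform.fourier_fourierInv_eq,
    smul_apply, SchwartzMap.smulLeftCLM_apply_apply (by fun_prop)]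
  simp only [Complex.real_smul]
  push_cast; ring

theorem fourierInv_bilaplacian_apply (φ : 𝓢(Rd d, ℂ)) (ξ : Rd d) :
    (𝓕⁻ (Δ (Δ φ))) ξ = (symbol ξ : ℂ) * (𝓕⁻ φ) ξ := by
  have h : ∀ ψ : 𝓢(Rd d, ℂ), (𝓕⁻ ψ) ξ = (𝓕 ψ) (-ξ) := fun ψ => by
    rw [SchwartzMap.fourierInv_coe, SchwartzMap.fourier_coe, Real.fourierInv_eq_fourier_neg]
  rw [h, h, fourier_laplacian_apply, fourier_laplacian_apply, norm_neg, symbol]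
  push_cast; ring

theorem HasDerivAt.clm_apply_within {E F : Type*} [NormedAddCommGroup E] [NormedSpace ℝ E]
    [NormedAddCommGroup F] [NormedSpace ℝ F] {L : ℝ → E →L[ℝ] F} {L' : E →L[ℝ] F} {z : ℝ → E}
    {z' : E} {S : Set ℝ} {t : ℝ} (hL : HasDerivAt L L' t) (hz : HasDerivWithinAt z z' S t) :
    HasDerivWithinAt (fun t => L t (z t)) (L' (z t) + L t z') S t :=
  hL.hasDerivWithinAt.clm_apply hz

/-! ### From the interaction picture to strong solutions -/

namespace ConvWeight

variable (p : ConvWeight d)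

/-- The weight decays like `|ξ|^(-d-1)`, so the integrand decays like `|ξ|^(2s-2d-2)`, which is
integrable exactly in the stated range. The range contains Sobolev exponents above `d/2`. -/
theorem integrable_sobolev {s : ℝ} (hs : s < d / 2 + 1) :
    Integrable fun ξ => (1 + ‖ξ‖ ^ 2) ^ s * p.toFun ξ ^ 2 := by
  have h := integrable_rpow_neg_one_add_norm_sq (E := Rd d) (μ := volume)
    (r := 2 * (d + 1 - s)) (by simp only [finrank_euclideanSpace, Fintype.card_fin]; linarith)
  refine (h.const_mul (p.bound ^ 2)).mono' ?_ (ae_of_all _ fun ξ => ?_)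
  · refine Continuous.aestronglyMeasurable ?_
    refine (Continuous.rpow_const (by fun_prop) fun x => Or.inl (by positivity)).mul
      (p.continuous_toFun.pow 2)
  · rw [Real.norm_of_nonneg (by positivity)]
    have h1 := p.decay ξ
    have h2 : (((1 + ‖ξ‖) ^ (d + 1))⁻¹) ^ 2 ≤ (1 + ‖ξ‖ ^ 2) ^ (-((d : ℝ) + 1)) := by
      rw [Real.rpow_neg (by positivity), inv_pow]
      refine inv_anti₀ (by positivity) ?_
      have : (1 + ‖ξ‖ ^ 2 : ℝ) ^ ((d : ℝ) + 1) = (1 + ‖ξ‖ ^ 2) ^ (d + 1) := by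
        rw [← Nat.cast_succ, Real.rpow_natCast]
      rw [this, ← pow_mul, mul_comm (d + 1), pow_mul]
      gcongr
      nlinarith [norm_nonneg ξ]
    have h3 : p.toFun ξ ^ 2 ≤ p.bound ^ 2 * (1 + ‖ξ‖ ^ 2) ^ (-((d : ℝ) + 1)) := by
      calc p.toFun ξ ^ 2 ≤ (p.bound * ((1 + ‖ξ‖) ^ (d + 1))⁻¹) ^ 2 := by
            have := (p.pos ξ).le
            gcongr
        _ = p.bound ^ 2 * (((1 + ‖ξ‖) ^ (d + 1))⁻¹) ^ 2 := by ring
        _ ≤ _ := by gcongr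
    calc _ ≤ (1 + ‖ξ‖ ^ 2) ^ s * (p.bound ^ 2 * (1 + ‖ξ‖ ^ 2) ^ (-((d : ℝ) + 1))) := by gcongr
      _ = p.bound ^ 2 * ((1 + ‖ξ‖ ^ 2) ^ s * (1 + ‖ξ‖ ^ 2) ^ (-((d : ℝ) + 1))) := by ring
      _ = _ := by
        rw [← Real.rpow_add (by positivity)]
        congr 2; ring

theorem memFourierHs_hat {s : ℝ} (hs : s < d / 2 + 1) (h : CZero d) :
    MemFourierHs s (p.hat h) := by
  have hm : AEStronglyMeasurable (fun ξ => (bracket s ξ : ℂ) * p.hat h ξ) volume :=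
    ((Complex.continuous_ofReal.comp (continuous_bracket s)).mul
      (p.continuous_hat h)).aestronglyMeasurable
  rw [MemFourierHs, memLp_two_iff_integrable_sq_norm hm]
  refine ((p.integrable_sobolev hs).mul_const (‖h‖ ^ 2)).mono' (hm.norm.pow 2)
    (ae_of_all _ fun ξ => ?_)
  rw [Real.norm_of_nonneg (by positivity), norm_mul, Complex.norm_real,
    Real.norm_of_nonneg (bracket_pos s ξ).le, mul_pow, bracket_sq, mul_assoc, ← mul_pow]
  gcongr
  exact p.norm_hat_le h ξ

/-- The embedding of the weighted space into `H^s`. -/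
def toHs (s : ℝ) (hs : s < d / 2 + 1) : CZero d →L[ℂ] Hs d s :=
  LinearMap.mkContinuous
    { toFun := fun h => Hs.ofFourier s (p.hat h) (p.memFourierHs_hat hs h)
      map_add' := fun h k => by
        rw [← Hs.ofFourier_add (p.memFourierHs_hat hs h) (p.memFourierHs_hat hs k)
          (by simpa only [← hat_add] using p.memFourierHs_hat hs (h + k))]
        congr 1; ext ξ; exact p.hat_add h k ξ
      map_smul' := fun c h => by
        rw [RingHom.id_apply, ← Hs.ofFourier_smul c (p.memFourierHs_hat hs h)
          (by simpa only [← hat_smul] using p.memFourierHs_hat hs (c • h))]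
        congr 1; ext ξ; exact p.hat_smul c h ξ }
    (Real.sqrt (∫ ξ, (1 + ‖ξ‖ ^ 2) ^ s * p.toFun ξ ^ 2)) fun h => by
      refine le_of_sq_le_sq ?_ (by positivity)
      change ‖Hs.ofFourier s (p.hat h) (p.memFourierHs_hat hs h)‖ ^ 2 ≤ _
      rw [Hs.norm_ofFourier_sq, mul_pow, Real.sq_sqrt
        (integral_nonneg fun ξ => by positivity), ← integral_mul_const]
      refine integral_mono_of_nonneg (ae_of_all _ fun ξ => by positivity)
        ((p.integrable_sobolev hs).mul_const _) (ae_of_all _ fun ξ => ?_)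
      simp only
      rw [mul_assoc, ← mul_pow]
      gcongr
      exact p.norm_hat_le h ξ

theorem toHs_apply {s : ℝ} (hs : s < d / 2 + 1) (h : CZero d) :
    p.toHs s hs h = Hs.ofFourier s (p.hat h) (p.memFourierHs_hat hs h) := rfl

theorem toDist_toHs_apply {s : ℝ} (hs : s < d / 2 + 1) (h : CZero d) (φ : 𝓢(Rd d, ℂ)) :
    Hs.toDist (p.toHs s hs h) φ = ∫ ξ, (𝓕⁻ φ) ξ * p.hat h ξ := by
  rw [toHs_apply, Hs.toDist_ofFourier_apply]

theorem toDist_smul_toHs_apply {s : ℝ} (hs : s < d / 2 + 1) (c : ℂ) (h : CZero d)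
    (φ : 𝓢(Rd d, ℂ)) :
    Hs.toDist (c • p.toHs s hs h) φ = c * ∫ ξ, (𝓕⁻ φ) ξ * p.hat h ξ := by
  rw [map_smul, ← p.toDist_toHs_apply hs]
  rfl

theorem toDist_toHs_eq {s r : ℝ} (hs : s < d / 2 + 1) (hr : r < d / 2 + 1) (h : CZero d) :
    Hs.toDist (p.toHs s hs h) = Hs.toDist (p.toHs r hr h) := by
  ext φ
  rw [toDist_toHs_apply, toDist_toHs_apply]

theorem zero_lt_half_add_one : (0 : ℝ) < d / 2 + 1 := by positivity

theorem toDist_eq_bessel (f : Hs d 0) : Hs.toDist f = (Hs.bessel f : 𝓢'(Rd d, ℂ)) := by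
  have := Hs.bessel_spec f
  simpa using this

theorem continuous_ev (h : CZero d) : Continuous (p.ev h) :=
  continuous_fourierInv (p.integrable_hat h)

/-- Identifies the `L²` representative of the distribution with the continuous function `p.ev h`, by
testing against smooth functions with compact support. This is what links the convolution product to
the pointwise power in `IsQuintic`. -/
theorem bessel_toHs_ae (h : CZero d) :
    ∀ᵐ x, (Hs.bessel (p.toHs 0 zero_lt_half_add_one h)) x = p.ev h x := by
  refine ae_eq_of_integral_contDiff_smul_eq ?_ (p.continuous_ev h).locallyIntegrable ?_
  · exact (Lp.memLp _).locallyIntegrable (by norm_num)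
  · intro g g_smooth g_cpt
    have hg₁ : HasCompactSupport (Complex.ofRealCLM ∘ g) := g_cpt.comp_left rfl
    have hg₂ : ContDiff ℝ (⊤ : ℕ∞) (Complex.ofRealCLM ∘ g) := by fun_prop
    set φ : 𝓢(Rd d, ℂ) := hg₁.toSchwartzMap hg₂ with hφ
    have hφx : ∀ x, φ x = (g x : ℂ) := fun x => rfl
    have h1 := p.toDist_toHs_apply zero_lt_half_add_one h φ
    rw [toDist_eq_bessel, Lp.toTemperedDistribution_apply] at h1
    have h2 : ∫ ξ, (𝓕⁻ φ) ξ * p.hat h ξ = ∫ x, φ x * p.ev h x := by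
      rw [SchwartzMap.fourierInv_coe]
      exact integral_fourierInv_mul φ.integrable (p.integrable_hat h)
    rw [h2] at h1
    simp only [hφx, smul_eq_mul] at h1
    simp only [Complex.real_smul]
    exact h1

/-- The right hand side of the equation in the interaction picture. -/
def field (μ ν t : ℝ) (z : CZero d) : CZero d :=
  (Complex.I * μ) • propagator (-(ν * t)) (p.quintic (propagator (ν * t) z))

theorem field_zero (μ ν t : ℝ) : p.field μ ν t 0 = 0 := by simp [field, quintic_zero]

theorem continuous_field (μ ν : ℝ) (z : CZero d) : Continuous fun t => p.field μ ν t z := by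
  have h1 : Continuous fun t : ℝ => p.quintic (propagator (ν * t) z) :=
    p.continuous_quintic.comp ((continuous_propagator_apply z).comp (by fun_prop))
  have h2 : Continuous fun t : ℝ => propagator (-(ν * t)) (p.quintic (propagator (ν * t) z)) :=
    continuous_propagator.comp (h1.prodMk (by fun_prop : Continuous fun t : ℝ => -(ν * t)))
  exact h2.const_smul (Complex.I * (μ : ℂ))

theorem norm_I_mul {μ : ℝ} (hμ : |μ| = 1) : ‖Complex.I * (μ : ℂ)‖ = 1 := by
  rw [norm_mul, Complex.norm_I, Complex.norm_real, Real.norm_eq_abs, hμ, one_mul]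

theorem norm_field_sub_le {μ : ℝ} (hμ : |μ| = 1) (ν t : ℝ) {x y : CZero d} {A : ℝ}
    (hx : ‖x‖ ≤ A) (hy : ‖y‖ ≤ A) :
    ‖p.field μ ν t x - p.field μ ν t y‖ ≤ 5 * p.const ^ 4 * A ^ 4 * ‖x - y‖ := by
  unfold field
  have e : ∀ u v : CZero d, (Complex.I * (μ : ℂ)) • u - (Complex.I * (μ : ℂ)) • v =
      (Complex.I * (μ : ℂ)) • (u - v) := fun u v => by
    ext x; simp [mul_sub]
  rw [e, ← map_sub, norm_smul, norm_I_mul hμ, one_mul, LinearIsometry.norm_map]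
  refine (p.norm_quintic_sub_le (A := A) (by rwa [LinearIsometry.norm_map])
    (by rwa [LinearIsometry.norm_map])).trans_eq ?_
  rw [← map_sub, LinearIsometry.norm_map]

theorem integrable_symbol_pow_mul (g : 𝓢(Rd d, ℂ)) (m : ℕ) :
    Integrable fun ξ : Rd d => (symbol ξ : ℂ) ^ m * (g ξ * p.toFun ξ) := by
  refine ((g.integrable_pow_mul volume (4 * m)).const_mul
    ((2 * Real.pi) ^ (4 * m) * p.bound)).mono' ?_ (ae_of_all _ fun ξ => ?_)
  · exact (((Complex.continuous_ofReal.comp continuous_symbol).pow m).mul (g.continuous.mul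
      (Complex.continuous_ofReal.comp p.continuous_toFun))).aestronglyMeasurable
  · rw [norm_mul, norm_mul, norm_pow, Complex.norm_real, Complex.norm_real,
      Real.norm_of_nonneg (symbol_nonneg ξ), Real.norm_of_nonneg (p.pos ξ).le, symbol]
    have := p.le_bound ξ
    calc _ ≤ ((2 * Real.pi * ‖ξ‖) ^ 4) ^ m * (‖g ξ‖ * p.bound) := by gcongr
      _ = _ := by rw [← pow_mul, mul_pow]; ring

theorem integral_mul_hat_propagator {g : Rd d → ℂ} (hk : Integrable fun ξ => g ξ * p.toFun ξ)
    (t : ℝ) (h : CZero d) :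
    ∫ ξ, g ξ * p.hat (propagator t h) ξ =
      pairCLM (fun ξ => g ξ * p.toFun ξ * Complex.exp (Complex.I * ((t * symbol ξ : ℝ) : ℂ)))
        (integrable_mul_phase hk t) h := by
  rw [pairCLM_apply]
  refine integral_congr_ae (ae_of_all _ fun ξ => ?_)
  simp only [hat, propagator_apply]; ring

/-- Product rule: the first term is the derivative of the phase, which produces the symbol of `Δ²`,
and the second comes from the motion of `ζ`. -/
theorem hasDerivWithinAt_pairing {ζ : ℝ → CZero d} {ζ' : CZero d} {S : Set ℝ} {t : ℝ}
    (hζ : HasDerivWithinAt ζ ζ' S t) (g : 𝓢(Rd d, ℂ)) :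
    HasDerivWithinAt (fun t => ∫ ξ, g ξ * p.hat (propagator t (ζ t)) ξ)
      (Complex.I * (∫ ξ, symbol ξ * g ξ * p.hat (propagator t (ζ t)) ξ) +
        ∫ ξ, g ξ * p.hat (propagator t ζ') ξ) S t := by
  have hk : Integrable fun ξ : Rd d => g ξ * p.toFun ξ := by
    simpa using p.integrable_symbol_pow_mul g 0
  have hk1 : Integrable fun ξ : Rd d => (symbol ξ : ℂ) * (g ξ * p.toFun ξ) := by
    simpa using p.integrable_symbol_pow_mul g 1
  have hk3 : Integrable fun ξ => Complex.I * (symbol ξ : ℂ) * (g ξ * p.toFun ξ) *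
      Complex.exp (Complex.I * ((t * symbol ξ : ℝ) : ℂ)) := by
    refine (integrable_mul_phase (hk1.const_mul Complex.I) t).congr (ae_of_all _ fun ξ => ?_)
    simp only; ring
  have h := HasDerivAt.clm_apply_within
    (hasDerivAt_pairCLM_phase hk (p.integrable_symbol_pow_mul g 2) t hk3) hζ
  have e : (fun t => ∫ ξ, g ξ * p.hat (propagator t (ζ t)) ξ) = fun t => pairCLM _ _ (ζ t) :=
    funext fun r => p.integral_mul_hat_propagator hk r (ζ r)
  rw [e, p.integral_mul_hat_propagator hk t ζ']
  refine h.congr_deriv ?_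
  congr 1
  rw [pairCLM_apply, ← integral_const_mul]
  refine integral_congr_ae (ae_of_all _ fun ξ => ?_)
  simp only [hat, propagator_apply]; ring

/-- The curve in the weighted space that belongs to a solution in the interaction picture. -/
theorem continuousOn_toHs_propagator {s : ℝ} (hs : s < d / 2 + 1) {ζ : ℝ → CZero d} {S : Set ℝ}
    (hζ : ContinuousOn ζ S) (c : ℂ) :
    ContinuousOn (fun t => c • p.toHs s hs (propagator t (ζ t))) S := by
  have h1 : ContinuousOn (fun t : ℝ => propagator t (ζ t)) S :=
    Continuous.comp_continuousOn (g := fun q : CZero d × ℝ => propagator q.2 q.1)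
      (f := fun t => (ζ t, t)) continuous_propagator (hζ.prodMk (continuousOn_id (s := S)))
  have h2 : ContinuousOn (fun t => p.toHs s hs (propagator t (ζ t))) S :=
    (p.toHs s hs).continuous.comp_continuousOn h1
  exact h2.const_smul c

theorem isQuintic_toDist {s : ℝ} (hs : s < d / 2 + 1) {M : ℝ} (hM : 0 < M) (w : CZero d) :
    IsQuintic (Hs.toDist ((M : ℂ) • p.toHs s hs w))
      (Hs.toDist (((M : ℂ) ^ 5) • p.toHs 0 zero_lt_half_add_one (p.quintic w))) := by
  refine ⟨Hs.bessel ((M : ℂ) • p.toHs 0 zero_lt_half_add_one w),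
    Hs.bessel (((M : ℂ) ^ 5) • p.toHs 0 zero_lt_half_add_one (p.quintic w)), ?_, ?_, ?_⟩
  · rw [← toDist_eq_bessel, map_smul, map_smul, p.toDist_toHs_eq hs zero_lt_half_add_one w]
  · rw [← toDist_eq_bessel]
  · have e : ∀ (c : ℂ) (h : CZero d), Hs.bessel (c • p.toHs 0 zero_lt_half_add_one h) =
        c • Hs.bessel (p.toHs 0 zero_lt_half_add_one h) := fun c h => Hs.bessel.map_smul c _
    rw [e, e]
    filter_upwards [Lp.coeFn_smul (M : ℂ) (Hs.bessel (p.toHs 0 zero_lt_half_add_one w)),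
      Lp.coeFn_smul ((M : ℂ) ^ 5) (Hs.bessel (p.toHs 0 zero_lt_half_add_one (p.quintic w))),
      p.bessel_toHs_ae w, p.bessel_toHs_ae (p.quintic w)] with x h1 h2 h3 h4
    rw [h1, h2, Pi.smul_apply, Pi.smul_apply, h3, h4, ev_quintic, smul_eq_mul, smul_eq_mul,
      norm_mul, Complex.norm_real, Real.norm_of_nonneg hM.le]
    push_cast; ring

theorem propagator_smul_field {μ M t : ℝ} (hM : 0 < M) (z : CZero d) :
    propagator t (M ^ 4 • p.field μ (M ^ 4)⁻¹ (M ^ 4 * t) z) =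
      ((M : ℂ) ^ 4 * (Complex.I * μ)) • p.quintic (propagator t z) := by
  have e1 : (M ^ 4)⁻¹ * (M ^ 4 * t) = t := by field_simp
  have e2 : (M ^ 4 : ℝ) • p.field μ (M ^ 4)⁻¹ (M ^ 4 * t) z =
    ((M : ℂ) ^ 4) • p.field μ (M ^ 4)⁻¹ (M ^ 4 * t) z := by
    ext ξ
    simp
  rw [e2, field, e1, smul_smul, map_smul, propagator_add, add_neg_cancel, propagator_zero]

/-- The curve `u(t) = M e^{itΔ²} z(M⁴ t)` solves the equation: the factor `M⁴` from the change of
time and the amplitude `M` make up the `M⁵` of the quintic term, and the phases `(M⁴)⁻¹ (M⁴ t) = t`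
match. -/
theorem equation_of_hasDerivWithinAt {μ M s t : ℝ} (hM : 0 < M) (hs : s < d / 2 + 1)
    {ζ : ℝ → CZero d} {S : Set ℝ}
    (hζ : HasDerivWithinAt ζ (M ^ 4 • p.field μ (M ^ 4)⁻¹ (M ^ 4 * t) (ζ t)) S t)
    (φ : 𝓢(Rd d, ℂ)) :
    ∃ D : ℂ, HasDerivWithinAt
        (fun t => Hs.toDist ((M : ℂ) • p.toHs s hs (propagator t (ζ t))) φ) D S t ∧
      Complex.I * D + Δ (Δ (Hs.toDist ((M : ℂ) • p.toHs s hs (propagator t (ζ t))))) φ +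
        (μ : ℂ) * Hs.toDist (((M : ℂ) ^ 5) •
          p.toHs 0 zero_lt_half_add_one (p.quintic (propagator t (ζ t)))) φ = 0 := by
  have hD := (p.hasDerivWithinAt_pairing hζ (𝓕⁻ φ)).const_mul (M : ℂ)
  rw [p.propagator_smul_field hM] at hD
  set w := propagator t (ζ t) with hw
  have e : (fun t => Hs.toDist ((M : ℂ) • p.toHs s hs (propagator t (ζ t))) φ) =
      fun t => (M : ℂ) * ∫ ξ, (𝓕⁻ φ) ξ * p.hat (propagator t (ζ t)) ξ :=
    funext fun r => p.toDist_smul_toHs_apply hs _ _ φ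
  rw [e]
  refine ⟨_, hD, ?_⟩
  rw [TemperedDistribution.laplacian_apply_apply, TemperedDistribution.laplacian_apply_apply,
    toDist_smul_toHs_apply, toDist_smul_toHs_apply]
  simp only [fourierInv_bilaplacian_apply, hat_smul]
  have h2 : ∫ ξ, (𝓕⁻ φ) ξ * ((M : ℂ) ^ 4 * (Complex.I * μ) * p.hat (p.quintic w) ξ) =
      (M : ℂ) ^ 4 * (Complex.I * μ) * ∫ ξ, (𝓕⁻ φ) ξ * p.hat (p.quintic w) ξ := by
    rw [← integral_const_mul]
    refine integral_congr_ae (ae_of_all _ fun ξ => ?_)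
    simp only; ring
  rw [h2]
  linear_combination ((M : ℂ) * (∫ ξ, symbol ξ * (𝓕⁻ φ) ξ * p.hat w ξ) +
    (M : ℂ) ^ 5 * μ * ∫ ξ, (𝓕⁻ φ) ξ * p.hat (p.quintic w) ξ) * Complex.I_mul_I

/-- A solution in the interaction picture gives a strong solution. -/
theorem isStrongSolution {μ M τ s : ℝ} (hM : 0 < M) (hs : s < d / 2 + 1) {z : ℝ → CZero d}
    (hz : ∀ t ∈ Icc 0 τ, HasDerivWithinAt z (p.field μ (M ^ 4)⁻¹ t (z t)) (Icc 0 τ) t) :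
    IsStrongSolution μ (Icc 0 (τ / M ^ 4))
      fun t => Hs.toDist ((M : ℂ) • p.toHs s hs (propagator t (z (M ^ 4 * t)))) := by
  have hM4 : 0 < M ^ 4 := by positivity
  have hmaps : MapsTo (fun t : ℝ => M ^ 4 * t) (Icc 0 (τ / M ^ 4)) (Icc 0 τ) := fun t ht =>
    ⟨mul_nonneg hM4.le ht.1, by have := ht.2; rw [le_div_iff₀ hM4] at this; linarith⟩
  have hζ : ∀ t ∈ Icc 0 (τ / M ^ 4), HasDerivWithinAt (fun t => z (M ^ 4 * t))
      (M ^ 4 • p.field μ (M ^ 4)⁻¹ (M ^ 4 * t) (z (M ^ 4 * t))) (Icc 0 (τ / M ^ 4)) t := by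
    intro t ht
    have h1 : HasDerivWithinAt (fun t : ℝ => M ^ 4 * t) (M ^ 4) (Icc 0 (τ / M ^ 4)) t := by
      simpa using ((hasDerivAt_id t).const_mul (M ^ 4)).hasDerivWithinAt
    exact (hz _ (hmaps ht)).scomp t h1 hmaps
  -- Strong solutions need an exponent above `d/2`, the embedding one below `d/2 + 1`; this is the
  -- midpoint.
  have hr : (d : ℝ) / 2 + 1 / 2 < d / 2 + 1 := by linarith
  constructor
  · refine ⟨(d : ℝ) / 2 + 1 / 2, by linarith,
      fun t => (M : ℂ) • p.toHs _ hr (propagator t (z (M ^ 4 * t))),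
      p.continuousOn_toHs_propagator hr (fun t ht => (hζ t ht).continuousWithinAt) _,
      fun t _ => ?_⟩
    simp only
    rw [map_smul, map_smul, p.toDist_toHs_eq hr hs]
  · exact ⟨fun t => Hs.toDist (((M : ℂ) ^ 5) •
      p.toHs 0 zero_lt_half_add_one (p.quintic (propagator t (z (M ^ 4 * t))))), fun t ht =>
      ⟨p.isQuintic_toDist hs hM _, fun φ => p.equation_of_hasDerivWithinAt hM hs (hζ t ht) φ⟩⟩

end ConvWeight

/-! ### Polynomial weights, and the weight with two scales -/

/-- The polynomial weight at frequency scale `n`, normalized in `L¹`. -/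
def polyWeight (d k : ℕ) (n : ℝ) (ξ : Rd d) : ℝ := (n ^ d)⁻¹ * ((1 + ‖ξ‖ / n) ^ k)⁻¹

/-- The integral of the polynomial weight. -/
def polyMass (d k : ℕ) : ℝ := ∫ ξ : Rd d, ((1 + ‖ξ‖) ^ k)⁻¹

theorem polyMass_nonneg (d k : ℕ) : 0 ≤ polyMass d k := integral_nonneg fun _ => by positivity

theorem polyMass_anti {d k l : ℕ} (hk : d < k) (hkl : k ≤ l) : polyMass d l ≤ polyMass d k := by
  refine integral_mono (integrable_inv_one_add_norm_pow (hk.trans_le hkl))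
    (integrable_inv_one_add_norm_pow hk) fun ξ => ?_
  simp only
  gcongr
  linarith [norm_nonneg ξ]

theorem integral_dilate {F : Type*} [NormedAddCommGroup F] [NormedSpace ℝ F] (f : Rd d → F)
    {n : ℝ} (hn : 0 < n) : ∫ ξ, f (n⁻¹ • ξ) = n ^ d • ∫ ξ, f ξ := by
  have h := Measure.integral_comp_inv_smul (volume : Measure (Rd d)) f n
  rw [h, finrank_euclideanSpace, Fintype.card_fin, abs_of_pos (by positivity)]

theorem integrable_dilate {F : Type*} [NormedAddCommGroup F] {f : Rd d → F} (hf : Integrable f)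
    {n : ℝ} (hn : 0 < n) : Integrable fun ξ => f (n⁻¹ • ξ) :=
  hf.comp_smul (inv_ne_zero hn.ne')

theorem norm_inv_smul {n : ℝ} (hn : 0 < n) (ξ : Rd d) : ‖n⁻¹ • ξ‖ = ‖ξ‖ / n := by
  rw [norm_smul, norm_inv, Real.norm_of_nonneg hn.le]; ring

section polyWeight

variable {k : ℕ} {n : ℝ}

theorem polyWeight_pos (hn : 0 < n) (ξ : Rd d) : 0 < polyWeight d k n ξ := by
  unfold polyWeight; positivity

theorem polyWeight_neg (ξ : Rd d) : polyWeight d k n (-ξ) = polyWeight d k n ξ := by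
  simp [polyWeight]

theorem continuous_polyWeight (hn : 0 < n) : Continuous (polyWeight d k n) := by
  unfold polyWeight
  exact continuous_const.mul (Continuous.inv₀ (by fun_prop) fun ξ => by positivity)

theorem polyWeight_one (ξ : Rd d) : polyWeight d k 1 ξ = ((1 + ‖ξ‖) ^ k)⁻¹ := by
  simp [polyWeight]

theorem integrable_polyWeight (hk : d < k) (hn : 0 < n) : Integrable (polyWeight d k n) := by
  have := (integrable_dilate (integrable_inv_one_add_norm_pow hk) hn).const_mul (n ^ d)⁻¹
  simp only [norm_inv_smul hn] at this
  exact this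

theorem integral_polyWeight (hn : 0 < n) : ∫ ξ, polyWeight d k n ξ = polyMass d k := by
  have h := integral_dilate (fun ξ : Rd d => ((1 + ‖ξ‖) ^ k)⁻¹) hn
  simp only [norm_inv_smul hn] at h
  simp only [polyWeight]
  rw [integral_const_mul, h, polyMass, smul_eq_mul, inv_mul_cancel_left₀ (by positivity)]

theorem polyWeight_le_of_half_le (hn : 0 < n) {ξ η : Rd d} (h : ‖ξ‖ / 2 ≤ ‖η‖) :
    polyWeight d k n η ≤ 2 ^ k * polyWeight d k n ξ := by
  unfold polyWeight
  have h1 : (1 + ‖ξ‖ / n) ≤ 2 * (1 + ‖η‖ / n) := by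
    have : ‖ξ‖ / n ≤ (2 * ‖η‖) / n := by gcongr; linarith
    rw [mul_div_assoc] at this
    linarith
  have h2 : (1 + ‖ξ‖ / n) ^ k ≤ 2 ^ k * (1 + ‖η‖ / n) ^ k := by
    rw [← mul_pow]; gcongr
  have h3 : ((1 + ‖η‖ / n) ^ k)⁻¹ ≤ 2 ^ k * ((1 + ‖ξ‖ / n) ^ k)⁻¹ := by
    rw [← div_eq_mul_inv, inv_le_comm₀ (by positivity) (by positivity), inv_div]
    rw [div_le_iff₀ (by positivity)]; linarith
  calc _ ≤ (n ^ d)⁻¹ * (2 ^ k * ((1 + ‖ξ‖ / n) ^ k)⁻¹) := by gcongr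
    _ = _ := by ring

/-- One of `η`, `ξ - η` has norm at least `|ξ|/2`; the weight there is at most `2^k` times the
weight at `ξ`. Integration in `η` gives the convolution estimate. -/
theorem polyWeight_mul_le (hn : 0 < n) (ξ η : Rd d) :
    polyWeight d k n η * polyWeight d k n (ξ - η) ≤
      2 ^ k * polyWeight d k n ξ * (polyWeight d k n η + polyWeight d k n (ξ - η)) := by
  have p1 := (polyWeight_pos (k := k) hn η).le
  have p2 := (polyWeight_pos (k := k) hn (ξ - η)).le
  have p3 := (polyWeight_pos (k := k) hn ξ).le
  rcases le_total (‖ξ‖ / 2) ‖η‖ with h | h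
  · have := polyWeight_le_of_half_le (k := k) hn h
    calc _ ≤ 2 ^ k * polyWeight d k n ξ * polyWeight d k n (ξ - η) := by gcongr
      _ ≤ _ := by gcongr; linarith
  · have h' : ‖ξ‖ / 2 ≤ ‖ξ - η‖ := by
      have := norm_sub_norm_le ξ η; linarith
    have := polyWeight_le_of_half_le (k := k) hn h'
    calc _ ≤ polyWeight d k n η * (2 ^ k * polyWeight d k n ξ) := by gcongr
      _ = 2 ^ k * polyWeight d k n ξ * polyWeight d k n η := by ring
      _ ≤ _ := by gcongr; linarith

/-- For `n ≥ 1`, a shift by `η` changes the weight at scale `n` by a factor of at most `(1 +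
|η|)^k`. The unit scale weight pays for it and keeps `l` powers of decay. -/
theorem polyWeight_mul_one_le (hn : 1 ≤ n) {l : ℕ} (ξ η : Rd d) :
    polyWeight d k n (ξ - η) * polyWeight d (k + l) 1 η ≤
      polyWeight d k n ξ * ((1 + ‖η‖) ^ l)⁻¹ := by
  have hn0 : 0 < n := by linarith
  have h1 : 1 + ‖ξ‖ / n ≤ (1 + ‖ξ - η‖ / n) * (1 + ‖η‖) := by
    have e1 : ‖ξ‖ ≤ ‖ξ - η‖ + ‖η‖ := by simpa using norm_add_le (ξ - η) η
    have e2 : ‖ξ‖ / n ≤ ‖ξ - η‖ / n + ‖η‖ / n := by rw [← add_div]; gcongr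
    have e3 : ‖η‖ / n ≤ ‖η‖ := div_le_self (norm_nonneg _) hn
    have e4 : 0 ≤ ‖ξ - η‖ / n * ‖η‖ := by positivity
    linarith
  have h2 : (1 + ‖ξ‖ / n) ^ k ≤ (1 + ‖ξ - η‖ / n) ^ k * (1 + ‖η‖) ^ k := by
    rw [← mul_pow]; gcongr
  rw [polyWeight_one, polyWeight, polyWeight, pow_add, mul_inv]
  have h3 : ((1 + ‖ξ - η‖ / n) ^ k)⁻¹ * ((1 + ‖η‖) ^ k)⁻¹ ≤ ((1 + ‖ξ‖ / n) ^ k)⁻¹ := by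
    rw [← mul_inv]; gcongr
  calc _ = (n ^ d)⁻¹ * (((1 + ‖ξ - η‖ / n) ^ k)⁻¹ * ((1 + ‖η‖) ^ k)⁻¹) * ((1 + ‖η‖) ^ l)⁻¹ := by
        ring
    _ ≤ _ := by gcongr

theorem polyWeight_decay (hn : 1 ≤ n) (hk : d + 1 ≤ k) (ξ : Rd d) :
    polyWeight d k n ξ ≤ n * ((1 + ‖ξ‖) ^ (d + 1))⁻¹ := by
  have hn0 : 0 < n := by linarith
  have h0 : 1 ≤ 1 + ‖ξ‖ / n := by have := div_nonneg (norm_nonneg ξ) hn0.le; linarith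
  have h1 : (1 + ‖ξ‖) ≤ n * (1 + ‖ξ‖ / n) := by
    rw [mul_add, mul_div_cancel₀ _ hn0.ne']; linarith
  have h2 : (1 + ‖ξ‖) ^ (d + 1) ≤ n ^ (d + 1) * (1 + ‖ξ‖ / n) ^ k := by
    calc _ ≤ (n * (1 + ‖ξ‖ / n)) ^ (d + 1) := by gcongr
      _ = n ^ (d + 1) * (1 + ‖ξ‖ / n) ^ (d + 1) := mul_pow _ _ _
      _ ≤ _ := by gcongr
  unfold polyWeight
  rw [← mul_inv, ← div_eq_mul_inv, inv_le_comm₀ (by positivity) (by positivity), inv_div,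
    div_le_iff₀ hn0]
  calc _ ≤ _ := h2
    _ = _ := by ring

end polyWeight

/-- The convolution weight `(1 + |ξ|)^(-k)`. -/
def profileWeight (d k : ℕ) (hk : d + 1 ≤ k) : ConvWeight d where
  toFun := polyWeight d k 1
  const := 2 ^ (k + 1) * polyMass d k
  bound := 1
  pos := polyWeight_pos one_pos
  even := polyWeight_neg
  continuous_toFun := continuous_polyWeight one_pos
  decay := polyWeight_decay le_rfl hk
  conv_le ξ := by
    have hi := integrable_polyWeight (d := d) (k := k) hk one_pos
    have h : ∫ η, 2 ^ k * polyWeight d k 1 ξ * (polyWeight d k 1 η + polyWeight d k 1 (ξ - η)) =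
        2 ^ (k + 1) * polyMass d k * polyWeight d k 1 ξ := by
      rw [integral_const_mul, integral_add hi (hi.comp_sub_left ξ),
        integral_sub_left_eq_self, integral_polyWeight one_pos]
      ring
    rw [← h]
    exact integral_mono_of_nonneg (ae_of_all _ fun η => mul_nonneg (polyWeight_pos one_pos _).le
      (polyWeight_pos one_pos _).le) ((hi.add (hi.comp_sub_left ξ)).const_mul _)
      (ae_of_all _ fun η => polyWeight_mul_le one_pos ξ η)

/-- The constant in the convolution estimates, uniform in the scale. -/
def scaleConst (d : ℕ) : ℝ := (2 ^ (2 * d + 3) + 2) * polyMass d (d + 1)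

theorem scaleConst_nonneg (d : ℕ) : 0 ≤ scaleConst d :=
  mul_nonneg (by positivity) (polyMass_nonneg _ _)

/-- The weight at frequency scale `n`, with a component of size `c` at unit scale. -/
def scaleWeight (d : ℕ) (n c : ℝ) (hn : 1 ≤ n) (hc : 0 < c) (hc1 : c ≤ 1) : ConvWeight d where
  toFun ξ := polyWeight d (d + 1) n ξ + c * polyWeight d (d + 1 + (d + 1)) 1 ξ
  const := scaleConst d
  bound := n + c
  pos ξ := add_pos (polyWeight_pos (by linarith) _) (mul_pos hc (polyWeight_pos one_pos _))
  even ξ := by simp only [polyWeight_neg]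
  continuous_toFun := (continuous_polyWeight (by linarith)).add
    (continuous_const.mul (continuous_polyWeight one_pos))
  decay ξ := by
    have h1 := polyWeight_decay hn (le_refl (d + 1)) ξ
    have h2 := polyWeight_decay (d := d) le_rfl (show d + 1 ≤ d + 1 + (d + 1) by omega) ξ
    rw [add_mul]
    rw [one_mul] at h2
    gcongr
  conv_le ξ := by
    have hn0 : 0 < n := by linarith
    set ψ : Rd d → ℝ := polyWeight d (d + 1) n with hψ
    set ρ : Rd d → ℝ := polyWeight d (d + 1 + (d + 1)) 1 with hρ
    set σ : Rd d → ℝ := fun η => ((1 + ‖η‖) ^ (d + 1))⁻¹ with hσ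
    have iψ : Integrable ψ := integrable_polyWeight (by omega) hn0
    have iρ : Integrable ρ := integrable_polyWeight (by omega) one_pos
    have iσ : Integrable σ := integrable_inv_one_add_norm_pow (by omega)
    have pψ : ∀ η, 0 < ψ η := polyWeight_pos hn0
    have pρ : ∀ η, 0 < ρ η := polyWeight_pos one_pos
    have i1 := (iψ.add (iψ.comp_sub_left ξ)).const_mul (2 ^ (d + 1) * ψ ξ)
    have i2 := (iσ.add (iσ.comp_sub_left ξ)).const_mul (c * ψ ξ)
    have i3 := (iρ.add (iρ.comp_sub_left ξ)).const_mul (c ^ 2 * (2 ^ (d + 1 + (d + 1)) * ρ ξ))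
    -- The square expands into four terms. The mixed ones are bounded by `ψ ξ`, because convolution
    -- with the unit scale component hardly changes the component at scale `n`; this is why `ρ`
    -- decays `d + 1` powers faster than `ψ`.
    have key : ∀ η, (ψ η + c * ρ η) * (ψ (ξ - η) + c * ρ (ξ - η)) ≤
        2 ^ (d + 1) * ψ ξ * (ψ η + ψ (ξ - η)) + c * ψ ξ * (σ η + σ (ξ - η)) +
          c ^ 2 * (2 ^ (d + 1 + (d + 1)) * ρ ξ) * (ρ η + ρ (ξ - η)) := fun η => by
      have h1 := polyWeight_mul_le (k := d + 1) hn0 ξ η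
      have h2 := polyWeight_mul_le (k := d + 1 + (d + 1)) one_pos ξ η
      have h3 := polyWeight_mul_one_le (k := d + 1) (l := d + 1) hn ξ η
      have h4 := polyWeight_mul_one_le (k := d + 1) (l := d + 1) hn ξ (ξ - η)
      rw [sub_sub_cancel] at h4
      have h2' := mul_le_mul_of_nonneg_left h2 (sq_nonneg c)
      have h3' := mul_le_mul_of_nonneg_left h3 hc.le
      have h4' := mul_le_mul_of_nonneg_left h4 hc.le
      simp only [← hψ, ← hρ] at h1 h2' h3' h4'
      calc (ψ η + c * ρ η) * (ψ (ξ - η) + c * ρ (ξ - η)) = ψ η * ψ (ξ - η) +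
          c * (ψ (ξ - η) * ρ η) + c * (ψ η * ρ (ξ - η)) + c ^ 2 * (ρ η * ρ (ξ - η)) := by ring
        _ ≤ _ := by
          simp only [hσ]
          linarith
    have hint : ∫ η, (2 ^ (d + 1) * ψ ξ * (ψ η + ψ (ξ - η)) + c * ψ ξ * (σ η + σ (ξ - η)) +
          c ^ 2 * (2 ^ (d + 1 + (d + 1)) * ρ ξ) * (ρ η + ρ (ξ - η))) =
        2 ^ (d + 1) * ψ ξ * (2 * polyMass d (d + 1)) + c * ψ ξ * (2 * polyMass d (d + 1)) +
          c ^ 2 * (2 ^ (d + 1 + (d + 1)) * ρ ξ) * (2 * polyMass d (d + 1 + (d + 1))) := by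
      have e := integral_add (i1.add i2) i3
      have e' := integral_add i1 i2
      simp only [Pi.add_apply] at e e'
      rw [e, e', integral_const_mul, integral_const_mul, integral_const_mul,
        integral_add iψ (iψ.comp_sub_left ξ), integral_add iρ (iρ.comp_sub_left ξ),
        integral_add iσ (iσ.comp_sub_left ξ), integral_sub_left_eq_self,
        integral_sub_left_eq_self, integral_sub_left_eq_self, integral_polyWeight hn0,
        integral_polyWeight one_pos]
      simp only [polyMass, hσ]
      ring
    calc _ ≤ _ := integral_mono_of_nonneg (ae_of_all _ fun η => mul_nonneg
          (add_pos (pψ _) (mul_pos hc (pρ _))).le (add_pos (pψ _) (mul_pos hc (pρ _))).le)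
          ((i1.add i2).add i3) (ae_of_all _ key)
      _ = _ := hint
      _ ≤ _ := by
        have m0 := polyMass_nonneg d (d + 1)
        have m1 := polyMass_anti (d := d) (k := d + 1) (l := d + 1 + (d + 1)) (by omega) (by omega)
        have e1 : (2 : ℝ) ^ (d + 1) * 2 ≤ 2 ^ (2 * d + 3) := by
          rw [← pow_succ]; exact pow_le_pow_right₀ (by norm_num) (by omega)
        have e2 : (2 : ℝ) ^ (d + 1 + (d + 1)) * 2 = 2 ^ (2 * d + 3) := by
          rw [← pow_succ]; congr 1; omega
        have a1 : 2 ^ (d + 1) * ψ ξ * (2 * polyMass d (d + 1)) ≤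
            2 ^ (2 * d + 3) * (ψ ξ * polyMass d (d + 1)) := by
          calc _ = (2 ^ (d + 1) * 2) * (ψ ξ * polyMass d (d + 1)) := by ring
            _ ≤ _ := mul_le_mul_of_nonneg_right e1 (mul_nonneg (pψ ξ).le m0)
        have a2 : c * ψ ξ * (2 * polyMass d (d + 1)) ≤ 2 * (ψ ξ * polyMass d (d + 1)) := by
          calc _ = c * (2 * (ψ ξ * polyMass d (d + 1))) := by ring
            _ ≤ 1 * (2 * (ψ ξ * polyMass d (d + 1))) := mul_le_mul_of_nonneg_right hc1
              (mul_nonneg (by norm_num) (mul_nonneg (pψ ξ).le m0))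
            _ = _ := one_mul _
        have a3 : c ^ 2 * (2 ^ (d + 1 + (d + 1)) * ρ ξ) * (2 * polyMass d (d + 1 + (d + 1))) ≤
            2 ^ (2 * d + 3) * (c * ρ ξ * polyMass d (d + 1)) := by
          calc _ = c * (2 ^ (d + 1 + (d + 1)) * 2) * (c * ρ ξ * polyMass d (d + 1 + (d + 1))) := by
                ring
            _ ≤ 1 * (2 ^ (d + 1 + (d + 1)) * 2) * (c * ρ ξ * polyMass d (d + 1)) := by
                have := (pρ ξ).le
                have := polyMass_nonneg d (d + 1 + (d + 1))
                gcongr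
            _ = _ := by rw [e2, one_mul]
        have a4 : 0 ≤ 2 * (c * ρ ξ * polyMass d (d + 1)) := by
          have := (pρ ξ).le
          positivity
        rw [scaleConst]
        linarith

section scaleWeight

variable {n c : ℝ} (hn : 1 ≤ n) (hc : 0 < c) (hc1 : c ≤ 1)

theorem scaleWeight_toFun (ξ : Rd d) : (scaleWeight d n c hn hc hc1).toFun ξ =
    polyWeight d (d + 1) n ξ + c * polyWeight d (d + 1 + (d + 1)) 1 ξ := rfl

theorem integral_scaleWeight_le :
    ∫ ξ, (scaleWeight d n c hn hc hc1).toFun ξ ≤ 2 * polyMass d (d + 1) := by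
  simp only [scaleWeight_toFun]
  rw [integral_add (integrable_polyWeight (by omega) (by linarith))
    ((integrable_polyWeight (by omega) one_pos).const_mul _), integral_const_mul,
    integral_polyWeight (by linarith), integral_polyWeight one_pos]
  have m0 := polyMass_nonneg d (d + 1 + (d + 1))
  have m1 := polyMass_anti (d := d) (k := d + 1) (l := d + 1 + (d + 1)) (by omega) (by omega)
  nlinarith

end scaleWeight

/-! ### Dilation of profiles to frequency scale `n` -/

namespace ConvWeight

variable (p : ConvWeight d)

/-- The element of the weighted space with a given Fourier transform. -/
def ofHat (V : Rd d → ℂ) (hV : Continuous V)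
    (h0 : Tendsto (fun ξ => (p.toFun ξ : ℂ)⁻¹ * V ξ) (cocompact _) (𝓝 0)) : CZero d :=
  ⟨⟨fun ξ => (p.toFun ξ : ℂ)⁻¹ * V ξ,
    ((Complex.continuous_ofReal.comp p.continuous_toFun).inv₀
      fun ξ => Complex.ofReal_ne_zero.2 (p.pos ξ).ne').mul hV⟩, h0⟩

theorem ofHat_apply {V : Rd d → ℂ} (hV : Continuous V)
    (h0 : Tendsto (fun ξ => (p.toFun ξ : ℂ)⁻¹ * V ξ) (cocompact _) (𝓝 0)) (ξ : Rd d) :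
    p.ofHat V hV h0 ξ = (p.toFun ξ : ℂ)⁻¹ * V ξ := rfl

theorem hat_ofHat {V : Rd d → ℂ} (hV : Continuous V)
    (h0 : Tendsto (fun ξ => (p.toFun ξ : ℂ)⁻¹ * V ξ) (cocompact _) (𝓝 0)) (ξ : Rd d) :
    p.hat (p.ofHat V hV h0) ξ = V ξ := by
  rw [hat, ofHat_apply, mul_inv_cancel_left₀ (by exact_mod_cast (p.pos ξ).ne')]

theorem norm_le_of_norm_hat_le {h : CZero d} {B : ℝ} (hB : 0 ≤ B)
    (H : ∀ ξ, ‖p.hat h ξ‖ ≤ B * p.toFun ξ) : ‖h‖ ≤ B := by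
  refine CZero.norm_le hB fun ξ => ?_
  have h1 := H ξ
  rw [hat, norm_mul, Complex.norm_real, Real.norm_of_nonneg (p.pos ξ).le, mul_comm] at h1
  exact le_of_mul_le_mul_right h1 (p.pos ξ)

theorem tendsto_of_hasCompactSupport {V : Rd d → ℂ} (hV : HasCompactSupport V) :
    Tendsto (fun ξ => (p.toFun ξ : ℂ)⁻¹ * V ξ) (cocompact _) (𝓝 0) := by
  have h : HasCompactSupport fun ξ => (p.toFun ξ : ℂ)⁻¹ * V ξ := hV.mul_left
  rw [hasCompactSupport_iff_eventuallyEq, coclosedCompact_eq_cocompact] at h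
  exact (tendsto_congr' h).2 tendsto_const_nhds

end ConvWeight

/-- The weight of the space that contains the profiles. -/
def profWeight (d : ℕ) : ConvWeight d := profileWeight d (d + 5) (by omega)

theorem profWeight_toFun (ξ : Rd d) : (profWeight d).toFun ξ = ((1 + ‖ξ‖) ^ (d + 5))⁻¹ :=
  polyWeight_one ξ

/-- Profiles have four more powers of decay than the weight at scale `n` requires. These four powers
will pay for the symbol `|ξ|⁴` of `Δ²`. -/
theorem profWeight_dilate {n : ℝ} (hn : 0 < n) (ξ : Rd d) :
    (n ^ d)⁻¹ * (profWeight d).toFun (n⁻¹ • ξ) * (1 + ‖ξ‖ / n) ^ 4 = polyWeight d (d + 1) n ξ := by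
  rw [profWeight_toFun, norm_inv_smul hn, polyWeight, show d + 5 = d + 1 + 4 by omega, pow_add]
  field_simp

namespace ConvWeight

variable (p : ConvWeight d) {n : ℝ}

theorem norm_dilate_le (hn : 0 < n) (hle : ∀ ξ, polyWeight d (d + 1) n ξ ≤ p.toFun ξ)
    (h : CZero d) (ξ : Rd d) :
    (1 + ‖ξ‖ / n) ^ 4 * ‖((n ^ d)⁻¹ : ℂ) * (profWeight d).hat h (n⁻¹ • ξ)‖ ≤
      p.toFun ξ * ‖h (n⁻¹ • ξ)‖ := by
  have h1 := profWeight_dilate hn ξ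
  have h2 := hle ξ
  rw [norm_mul, hat, norm_mul, Complex.norm_real, Real.norm_of_nonneg ((profWeight d).pos _).le,
    norm_inv, norm_pow, Complex.norm_real, Real.norm_of_nonneg hn.le]
  calc _ = (n ^ d)⁻¹ * (profWeight d).toFun (n⁻¹ • ξ) * (1 + ‖ξ‖ / n) ^ 4 * ‖h (n⁻¹ • ξ)‖ := by
        ring
    _ ≤ _ := by rw [h1]; gcongr

theorem one_le_one_add_pow (hn : 0 < n) (ξ : Rd d) : 1 ≤ (1 + ‖ξ‖ / n) ^ 4 :=
  one_le_pow₀ (by have := div_nonneg (norm_nonneg ξ) hn.le; linarith)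

theorem norm_dilate_le' (hn : 0 < n) (hle : ∀ ξ, polyWeight d (d + 1) n ξ ≤ p.toFun ξ)
    (h : CZero d) (ξ : Rd d) :
    ‖((n ^ d)⁻¹ : ℂ) * (profWeight d).hat h (n⁻¹ • ξ)‖ ≤ p.toFun ξ * ‖h (n⁻¹ • ξ)‖ :=
  (le_mul_of_one_le_left (norm_nonneg _) (one_le_one_add_pow hn ξ)).trans
    (p.norm_dilate_le hn hle h ξ)

theorem tendsto_dilate (hn : 0 < n) (hle : ∀ ξ, polyWeight d (d + 1) n ξ ≤ p.toFun ξ)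
    (h : CZero d) :
    Tendsto (fun ξ => (p.toFun ξ : ℂ)⁻¹ * (((n ^ d)⁻¹ : ℂ) * (profWeight d).hat h (n⁻¹ • ξ)))
      (cocompact _) (𝓝 0) := by
  have h1 : Tendsto (fun ξ : Rd d => h (n⁻¹ • ξ)) (cocompact _) (𝓝 0) :=
    (zero_at_infty h).comp
      (Homeomorph.smulOfNeZero n⁻¹ (inv_ne_zero hn.ne')).isClosedEmbedding.tendsto_cocompact
  refine squeeze_zero_norm (fun ξ => ?_) (tendsto_zero_iff_norm_tendsto_zero.1 h1)
  rw [norm_mul, norm_inv, Complex.norm_real, Real.norm_of_nonneg (p.pos ξ).le,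
    inv_mul_le_iff₀ (p.pos ξ)]
  exact p.norm_dilate_le' hn hle h ξ

/-- Dilation to the frequency scale `n`. -/
def dilate (n : ℝ) (hn : 0 < n) (hle : ∀ ξ, polyWeight d (d + 1) n ξ ≤ p.toFun ξ) :
    CZero d →L[ℂ] CZero d :=
  LinearMap.mkContinuous
    { toFun := fun h => p.ofHat (fun ξ => ((n ^ d)⁻¹ : ℂ) * (profWeight d).hat h (n⁻¹ • ξ))
        (continuous_const.mul (((profWeight d).continuous_hat h).comp (by fun_prop)))
        (p.tendsto_dilate hn hle h)
      map_add' := fun h k => p.hat_injective fun ξ => by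
        rw [hat_add]; simp only [hat_ofHat, hat_add]; ring
      map_smul' := fun c h => p.hat_injective fun ξ => by
        rw [RingHom.id_apply, hat_smul]; simp only [hat_ofHat, hat_smul]; ring }
    1 fun h => by
      rw [one_mul]
      refine p.norm_le_of_norm_hat_le (norm_nonneg _) fun ξ => ?_
      simp only [LinearMap.coe_mk, AddHom.coe_mk]
      rw [hat_ofHat, mul_comm ‖h‖]
      refine (p.norm_dilate_le' hn hle h ξ).trans ?_
      have := (p.pos ξ).le
      have := CZero.norm_apply_le h (n⁻¹ • ξ)
      gcongr

variable (hn : 0 < n) (hle : ∀ ξ, polyWeight d (d + 1) n ξ ≤ p.toFun ξ)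

theorem hat_dilate (h : CZero d) (ξ : Rd d) : p.hat (p.dilate n hn hle h) ξ =
    ((n ^ d)⁻¹ : ℂ) * (profWeight d).hat h (n⁻¹ • ξ) :=
  p.hat_ofHat (continuous_const.mul (((profWeight d).continuous_hat h).comp (by fun_prop)))
    (p.tendsto_dilate hn hle h) ξ

theorem norm_dilate_apply_le (h : CZero d) : ‖p.dilate n hn hle h‖ ≤ ‖h‖ := by
  have := (p.dilate n hn hle).le_of_opNorm_le (LinearMap.mkContinuous_norm_le _ zero_le_one _) h
  rwa [one_mul] at this

theorem dilate_conjRefl (h : CZero d) :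
    p.dilate n hn hle (conjRefl h) = conjRefl (p.dilate n hn hle h) :=
  p.hat_injective fun ξ => by
    rw [hat_conjRefl, hat_dilate, hat_dilate, hat_conjRefl, smul_neg, star_mul']
    simp

/-- With the factor `n^(-d)` on the Fourier side, dilation is `φ(x) ↦ φ(nx)` in physical space,
which is multiplicative. -/
theorem dilate_mul (h k : CZero d) : p.dilate n hn hle ((profWeight d).mul h k) =
    p.mul (p.dilate n hn hle h) (p.dilate n hn hle k) :=
  p.hat_injective fun ξ => by
    rw [hat_dilate, hat_mul, hat_mul, fconv, fconv]
    simp only [hat_dilate]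
    have h1 := integral_dilate
      (fun η => (profWeight d).hat h η * (profWeight d).hat k (n⁻¹ • ξ - η)) hn
    have h2 : ∀ η, ((n ^ d)⁻¹ : ℂ) * (profWeight d).hat h (n⁻¹ • η) *
        (((n ^ d)⁻¹ : ℂ) * (profWeight d).hat k (n⁻¹ • (ξ - η))) = ((n ^ d)⁻¹ : ℂ) ^ 2 *
        ((profWeight d).hat h (n⁻¹ • η) * (profWeight d).hat k (n⁻¹ • ξ - n⁻¹ • η)) := fun η => by
      rw [smul_sub]; ring
    simp only [h2]
    rw [integral_const_mul, h1, Complex.real_smul]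
    have : (n : ℂ) ≠ 0 := by exact_mod_cast hn.ne'
    push_cast
    field_simp

theorem dilate_quintic (h : CZero d) : p.dilate n hn hle ((profWeight d).quintic h) =
    p.quintic (p.dilate n hn hle h) := by
  simp only [quintic, quartic, dilate_mul, dilate_conjRefl]

/-- The symbol is at most `(2πn)⁴ (1 + |ξ|/n)⁴`, and the spare decay of the profile absorbs the last
factor. -/
theorem norm_propagator_dilate_sub_le (t : ℝ) (h : CZero d) :
    ‖propagator t (p.dilate n hn hle h) - p.dilate n hn hle h‖ ≤
      |t| * (2 * Real.pi * n) ^ 4 * ‖h‖ := by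
  refine CZero.norm_le (by positivity) fun ξ => ?_
  have h1 := norm_propagator_sub_apply_le t (p.dilate n hn hle h) ξ
  refine h1.trans ?_
  have h2 : ‖(p.dilate n hn hle h) ξ‖ * (1 + ‖ξ‖ / n) ^ 4 ≤ ‖h‖ := by
    have h3 := p.norm_dilate_le hn hle h ξ
    rw [← p.hat_dilate hn hle, hat, norm_mul, Complex.norm_real,
      Real.norm_of_nonneg (p.pos ξ).le] at h3
    have h4 : p.toFun ξ * (‖(p.dilate n hn hle h) ξ‖ * (1 + ‖ξ‖ / n) ^ 4) ≤
        p.toFun ξ * ‖h (n⁻¹ • ξ)‖ := by linarith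
    exact (le_of_mul_le_mul_left h4 (p.pos ξ)).trans (CZero.norm_apply_le h _)
  have h5 : symbol ξ ≤ (2 * Real.pi * n) ^ 4 * (1 + ‖ξ‖ / n) ^ 4 := by
    rw [symbol, ← mul_pow]
    have : 2 * Real.pi * ‖ξ‖ ≤ 2 * Real.pi * n * (1 + ‖ξ‖ / n) := by
      rw [mul_add, mul_assoc (2 * Real.pi) n (‖ξ‖ / n), mul_div_cancel₀ _ hn.ne']
      have : 0 ≤ 2 * Real.pi * n := by positivity
      linarith
    gcongr
  calc |t| * symbol ξ * ‖(p.dilate n hn hle h) ξ‖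
      ≤ |t| * ((2 * Real.pi * n) ^ 4 * (1 + ‖ξ‖ / n) ^ 4) * ‖(p.dilate n hn hle h) ξ‖ := by gcongr
    _ = |t| * (2 * Real.pi * n) ^ 4 * (‖(p.dilate n hn hle h) ξ‖ * (1 + ‖ξ‖ / n) ^ 4) := by ring
    _ ≤ _ := by gcongr

/-- The dispersion has a small effect on functions at frequency scale `n`. -/
theorem norm_quintic_sub_field_le {μ ν τ L A : ℝ} (hμ : |μ| = 1) (hν : 0 ≤ ν) (hτ : 0 ≤ τ)
    (hτL : τ ≤ L) {h : CZero d} (hA : ‖h‖ ≤ A) :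
    ‖(Complex.I * μ) • p.quintic (p.dilate n hn hle h) - p.field μ ν τ (p.dilate n hn hle h)‖ ≤
      ν * L * (2 * Real.pi * n) ^ 4 * (((profWeight d).const ^ 4 + 5 * p.const ^ 4) * A ^ 5) := by
  have hA0 : 0 ≤ A := (norm_nonneg _).trans hA
  set y := p.dilate n hn hle h with hy
  have hyA : ‖y‖ ≤ A := (p.norm_dilate_apply_le hn hle h).trans hA
  -- Two effects are separated: the outer propagator acting on the nonlinearity, which is again a
  -- dilated profile, and the inner one acting on `y`.
  have e : (Complex.I * μ) • p.quintic y - p.field μ ν τ y =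
      (Complex.I * μ) • propagator (-(ν * τ)) ((propagator (ν * τ) (p.quintic y) - p.quintic y) +
        (p.quintic y - p.quintic (propagator (ν * τ) y))) := by
    have : propagator (-(ν * τ)) (propagator (ν * τ) (p.quintic y)) = p.quintic y := by
      rw [propagator_add, neg_add_cancel, propagator_zero]
    rw [sub_add_sub_cancel, map_sub, this, field]
    ext x; simp [mul_sub]
  have hL : 0 ≤ L := hτ.trans hτL
  have hντ : |ν * τ| ≤ ν * L := by rw [abs_of_nonneg (by positivity)]; gcongr
  have h1 : ‖propagator (ν * τ) (p.quintic y) - p.quintic y‖ ≤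
      ν * L * (2 * Real.pi * n) ^ 4 * ((profWeight d).const ^ 4 * A ^ 5) := by
    rw [hy, ← p.dilate_quintic hn hle]
    refine (p.norm_propagator_dilate_sub_le hn hle _ _).trans ?_
    have := (profWeight d).norm_quintic_le hA
    gcongr
  have h2 : ‖p.quintic y - p.quintic (propagator (ν * τ) y)‖ ≤
      5 * p.const ^ 4 * A ^ 4 * (ν * L * (2 * Real.pi * n) ^ 4 * A) := by
    refine (p.norm_quintic_sub_le hyA (by rwa [LinearIsometry.norm_map])).trans ?_
    have h3 := p.norm_propagator_dilate_sub_le hn hle (ν * τ) h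
    rw [norm_sub_rev]
    have := p.const_nonneg
    gcongr
    refine h3.trans ?_
    gcongr
  rw [e, norm_smul, norm_I_mul hμ, one_mul, LinearIsometry.norm_map]
  refine (norm_add_le _ _).trans ((add_le_add h1 h2).trans_eq ?_)
  ring

end ConvWeight

/-! ### Reduction of norm inflation to the dispersionless flow -/

/-- Arbitrarily small perturbations of nice data become arbitrarily large arbitrarily fast. -/
def NormInflation (d : ℕ) (s μ : ℝ) : Prop :=
  ∀ (V : Rd d → ℂ) (hV : MemFourierHs s V), Continuous V → HasCompactSupport V →
    ∀ κ > 0, ∀ T > 0, ∀ R : ℝ, ∃ t, 0 ≤ t ∧ t ≤ T ∧ ∃ v : ℝ → Hs d s,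
      IsStrongSolution μ (Icc 0 t) (fun r => Hs.toDist (v r)) ∧
        ‖v 0 - Hs.ofFourier s V hV‖ ≤ κ ∧ R ≤ ‖v t‖

/-- After dilation the Sobolev weight is `(n⁻² + |ξ|²)^s`, an approximation of the homogeneous
weight; estimates uniform in `n` must be made for this expression. -/
theorem sobolev_dilate (s : ℝ) {n : ℝ} (hn : 0 < n) (ξ : Rd d) :
    (1 + ‖ξ‖ ^ 2) ^ s = n ^ (2 * s) * ((n ^ 2)⁻¹ + ‖n⁻¹ • ξ‖ ^ 2) ^ s := by
  rw [norm_inv_smul hn, Real.rpow_mul hn.le, Real.rpow_two, ← Real.mul_rpow (by positivity)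
    (by positivity)]
  congr 1
  field_simp

theorem integral_sobolev_dilate (s : ℝ) {n : ℝ} (hn : 0 < n) (H : Rd d → ℂ) :
    ∫ ξ, (1 + ‖ξ‖ ^ 2) ^ s * ‖H (n⁻¹ • ξ)‖ ^ 2 =
      n ^ (2 * s) * n ^ d * ∫ ξ, ((n ^ 2)⁻¹ + ‖ξ‖ ^ 2) ^ s * ‖H ξ‖ ^ 2 := by
  have h := integral_dilate (fun ξ => ((n ^ 2)⁻¹ + ‖ξ‖ ^ 2) ^ s * ‖H ξ‖ ^ 2) hn
  rw [smul_eq_mul] at h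
  rw [mul_assoc, ← h, ← integral_const_mul]
  refine integral_congr_ae (ae_of_all _ fun ξ => ?_)
  simp only
  rw [sobolev_dilate s hn ξ, mul_assoc]

theorem memFourierHs_dilate {s : ℝ} {n : ℝ} (hn : 0 < n) {G : Rd d → ℂ} (hG : Measurable G)
    (hi : Integrable fun ξ => ((n ^ 2)⁻¹ + ‖ξ‖ ^ 2) ^ s * ‖G ξ‖ ^ 2) :
    MemFourierHs s fun ξ => G (n⁻¹ • ξ) := by
  have hm : AEStronglyMeasurable (fun ξ : Rd d => (bracket s ξ : ℂ) * G (n⁻¹ • ξ)) volume := by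
    refine ((Complex.continuous_ofReal.comp (continuous_bracket s)).aestronglyMeasurable).mul ?_
    exact (hG.comp (by fun_prop)).aestronglyMeasurable
  rw [MemFourierHs, memLp_two_iff_integrable_sq_norm hm]
  refine ((integrable_dilate hi hn).const_mul (n ^ (2 * s))).congr (ae_of_all _ fun ξ => ?_)
  simp only
  rw [norm_mul, Complex.norm_real, Real.norm_of_nonneg (bracket_pos s ξ).le, mul_pow, bracket_sq,
    sobolev_dilate s hn ξ, mul_assoc]

theorem hasDerivWithinAt_clm_comp {E F : Type*} [NormedAddCommGroup E] [NormedSpace ℂ E]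
    [NormedSpace ℝ E] [IsScalarTower ℝ ℂ E]
    [NormedAddCommGroup F] [NormedSpace ℂ F] [NormedSpace ℝ F] [IsScalarTower ℝ ℂ F]
    (L : E →L[ℂ] F) {y : ℝ → E} {y' : E} {S : Set ℝ}
    {t : ℝ} (hy : HasDerivWithinAt y y' S t) : HasDerivWithinAt (fun t => L (y t)) (L y') S t :=
  (L.restrictScalars ℝ).hasFDerivAt.comp_hasDerivWithinAt t hy

namespace ConvWeight

variable (p : ConvWeight d)

theorem toHs_ofHat {s : ℝ} (hs : s < d / 2 + 1) {V : Rd d → ℂ} (hc : Continuous V)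
    (h0 : Tendsto (fun ξ => (p.toFun ξ : ℂ)⁻¹ * V ξ) (cocompact _) (𝓝 0))
    (hV : MemFourierHs s V) : p.toHs s hs (p.ofHat V hc h0) = Hs.ofFourier s V hV := by
  have h : p.hat (p.ofHat V hc h0) = V := funext fun ξ => p.hat_ofHat hc h0 ξ
  rw [toHs_apply]
  congr 1

/-- With `M = n^(d/2-s)` all powers of `n` from the dilation cancel. -/
theorem norm_toHs_dilate_sq {s n M : ℝ} (hs : s < d / 2 + 1) (hn : 0 < n) (hM : 0 < M)
    (hMn : M ^ 2 = n ^ ((d : ℝ) - 2 * s))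
    (hle : ∀ ξ, polyWeight d (d + 1) n ξ ≤ p.toFun ξ) (h : CZero d) :
    ‖(M : ℂ) • p.toHs s hs (p.dilate n hn hle h)‖ ^ 2 =
      ∫ ξ, ((n ^ 2)⁻¹ + ‖ξ‖ ^ 2) ^ s * ‖(profWeight d).hat h ξ‖ ^ 2 := by
  rw [norm_smul, Complex.norm_real, Real.norm_of_nonneg hM.le, mul_pow, toHs_apply,
    Hs.norm_ofFourier_sq]
  have h1 : ∀ ξ, (1 + ‖ξ‖ ^ 2) ^ s * ‖p.hat (p.dilate n hn hle h) ξ‖ ^ 2 =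
      ((n ^ d)⁻¹) ^ 2 * ((1 + ‖ξ‖ ^ 2) ^ s * ‖(profWeight d).hat h (n⁻¹ • ξ)‖ ^ 2) := fun ξ => by
    rw [hat_dilate, norm_mul, norm_inv, norm_pow, Complex.norm_real, Real.norm_of_nonneg hn.le]
    ring
  simp only [h1]
  rw [integral_const_mul, integral_sobolev_dilate s hn, hMn, Real.rpow_sub hn, Real.rpow_natCast]
  have : n ^ (2 * s) ≠ 0 := (Real.rpow_pos_of_pos hn _).ne'
  field_simp

theorem norm_integral_hat_mul_le (h : CZero d) {G : Rd d → ℂ} {b : ℝ} (hb : ∀ ξ, ‖G ξ‖ ≤ b) :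
    ‖∫ ξ, p.hat h ξ * G ξ‖ ≤ ‖h‖ * (∫ ξ, p.toFun ξ) * b := by
  have h1 : ∀ ξ, ‖p.hat h ξ * G ξ‖ ≤ ‖h‖ * p.toFun ξ * b := fun ξ => by
    rw [norm_mul]
    have h1 := p.norm_hat_le h ξ
    rw [mul_comm] at h1
    exact mul_le_mul h1 (hb ξ) (norm_nonneg _) ((norm_nonneg _).trans h1)
  refine (norm_integral_le_of_norm_le ((p.integrable_toFun.const_mul _).mul_const b)
    (ae_of_all _ h1)).trans_eq ?_
  rw [integral_mul_const, integral_const_mul]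

theorem integral_hat_dilate_mul {n : ℝ} (hn : 0 < n)
    (hle : ∀ ξ, polyWeight d (d + 1) n ξ ≤ p.toFun ξ) (h : CZero d) (G : Rd d → ℂ) :
    ∫ ξ, p.hat (p.dilate n hn hle h) ξ * G (n⁻¹ • ξ) = ∫ ξ, (profWeight d).hat h ξ * G ξ := by
  have h1 := integral_dilate (fun ξ => (profWeight d).hat h ξ * G ξ) hn
  simp only [hat_dilate, mul_assoc]
  rw [integral_const_mul, h1, Complex.real_smul]
  have : (n : ℂ) ≠ 0 := by exact_mod_cast hn.ne'
  push_cast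
  field_simp

end ConvWeight

theorem polyWeight_le_scaleWeight {n c : ℝ} (hn : 1 ≤ n) (hc : 0 < c) (hc1 : c ≤ 1) (ξ : Rd d) :
    polyWeight d (d + 1) n ξ ≤ (scaleWeight d n c hn hc hc1).toFun ξ := by
  rw [scaleWeight_toFun]
  have := mul_pos hc (polyWeight_pos (k := d + 1 + (d + 1)) one_pos ξ)
  linarith

theorem exists_le_polyWeight {V : Rd d → ℂ} (hc : Continuous V) (hV : HasCompactSupport V) (k : ℕ) :
    ∃ B, 0 ≤ B ∧ ∀ ξ, ‖V ξ‖ ≤ B * polyWeight d k 1 ξ := by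
  obtain ⟨B, hB⟩ := (hc.mul (f := fun ξ : Rd d => V ξ) (g := fun ξ => (((1 + ‖ξ‖) ^ k : ℝ) : ℂ))
    (by fun_prop)).bounded_above_of_compact_support (hV.mul_right)
  refine ⟨B, (norm_nonneg _).trans (hB 0), fun ξ => ?_⟩
  have h1 := hB ξ
  rw [polyWeight_one, ← div_eq_mul_inv, le_div_iff₀ (by positivity)]
  rwa [Pi.mul_apply, norm_mul, Complex.norm_real, Real.norm_of_nonneg (by positivity)] at h1

/-- The size of a compactly supported function in the weighted space. -/
theorem norm_ofHat_scaleWeight_le {n c : ℝ} (hn : 1 ≤ n) (hc : 0 < c) (hc1 : c ≤ 1)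
    {V : Rd d → ℂ} (hV : Continuous V)
    (h0 : Tendsto (fun ξ => ((scaleWeight d n c hn hc hc1).toFun ξ : ℂ)⁻¹ * V ξ) (cocompact _)
      (𝓝 0)) {B : ℝ} (hB : 0 ≤ B) (h : ∀ ξ, ‖V ξ‖ ≤ B * polyWeight d (d + 1 + (d + 1)) 1 ξ) :
    ‖(scaleWeight d n c hn hc hc1).ofHat V hV h0‖ ≤ B / c := by
  refine (scaleWeight d n c hn hc hc1).norm_le_of_norm_hat_le (by positivity) fun ξ => ?_
  rw [ConvWeight.hat_ofHat]
  refine (h ξ).trans ?_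
  have h1 := polyWeight_pos (d := d) (k := d + 1) (zero_lt_one.trans_le hn) ξ
  rw [scaleWeight_toFun, mul_add, ← mul_assoc, div_mul_cancel₀ _ hc.ne']
  have : 0 ≤ B / c * polyWeight d (d + 1) n ξ := by positivity
  linarith

/-- The dilated dispersionless solution is an approximate solution, and shadowing gives an exact one
with the datum `V` added; `E` is the shadowing error. The norm at the final time is bounded below by
duality with the dilated `G`: the profile contributes at least `(R + 1) B`, the errors at most `B`,
and `B` bounds the dual norm of `G` after the scaling factor `M` has been removed. -/
theorem inflation_at_scale {s μ : ℝ} (hμ : |μ| = 1) (hs : s < d / 2 + 1) {y : ℝ → CZero d}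
    (hy : ∀ τ, HasDerivAt y ((Complex.I * μ) • (profWeight d).quintic (y τ)) τ) {L : ℝ}
    (hL : 0 ≤ L) {G : Rd d → ℂ} (hGm : Measurable G) {b : ℝ} (hGb : ∀ ξ, ‖G ξ‖ ≤ b) {κ R B A : ℝ}
    (hκ : 0 ≤ κ) (hB : 0 < B) (hA : 0 ≤ A) (hyA : ∀ τ ∈ Icc 0 L, ‖y τ‖ ≤ A) {n c M : ℝ} (hn : 1 ≤ n)
    (hc : 0 < c) (hc1 : c ≤ 1) (hM : 0 < M) (hMn : M ^ 2 = n ^ ((d : ℝ) - 2 * s))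
    (h1 : ∫ ξ, ((n ^ 2)⁻¹ + ‖ξ‖ ^ 2) ^ s * ‖(profWeight d).hat (y 0) ξ‖ ^ 2 ≤ κ ^ 2)
    (h2 : Integrable fun ξ => ((n ^ 2)⁻¹ + ‖ξ‖ ^ 2) ^ (-s) * ‖G ξ‖ ^ 2)
    (h3 : ∫ ξ, ((n ^ 2)⁻¹ + ‖ξ‖ ^ 2) ^ (-s) * ‖G ξ‖ ^ 2 ≤ B ^ 2)
    (h4 : (R + 1) * B ≤ ‖∫ ξ, (profWeight d).hat (y L) ξ * G ξ‖)
    {V : Rd d → ℂ} (hV : MemFourierHs s V) (hVc : Continuous V) (hVs : HasCompactSupport V) {D : ℝ}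
    (hD : 0 ≤ D) (hVD : ∀ ξ, ‖V ξ‖ ≤ D * polyWeight d (d + 1 + (d + 1)) 1 ξ) {E : ℝ}
    (hE : E = (M⁻¹ * (D / c) + (M ^ 4)⁻¹ * L * (2 * Real.pi * n) ^ 4 *
      (((profWeight d).const ^ 4 + 5 * scaleConst d ^ 4) * A ^ 5) * L) *
        Real.exp (2 * (5 * scaleConst d ^ 4 * (2 * A) ^ 4) * L))
    (hEA : E ≤ A)
    (hEB : (E + (M ^ 4)⁻¹ * L * (2 * Real.pi * n) ^ 4 * A) * (2 * polyMass d (d + 1)) * b ≤ B) :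
    ∃ v : ℝ → Hs d s, IsStrongSolution μ (Icc 0 (L / M ^ 4)) (fun r => Hs.toDist (v r)) ∧
        ‖v 0 - Hs.ofFourier s V hV‖ ≤ κ ∧ R ≤ ‖v (L / M ^ 4)‖ := by
  have hn0 : 0 < n := by linarith
  set p := scaleWeight d n c hn hc hc1 with hp
  have hpc : p.const = scaleConst d := rfl
  have hle : ∀ ξ, polyWeight d (d + 1) n ξ ≤ p.toFun ξ := polyWeight_le_scaleWeight hn hc hc1
  have hb : 0 ≤ b := (norm_nonneg _).trans (hGb 0)
  have hC := scaleConst_nonneg d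
  have hC1 := (profWeight d).const_nonneg
  have h0 := p.tendsto_of_hasCompactSupport hVs
  -- The factor `M⁻¹` offsets the amplitude `M` of the solution, so that the actual datum is `V`
  -- plus the profile.
  set x₀ : CZero d := (M⁻¹ : ℂ) • p.ofHat V hVc h0 + p.dilate n hn0 hle (y 0) with hx₀
  have hx : ‖x₀ - p.dilate n hn0 hle (y 0)‖ ≤ M⁻¹ * (D / c) := by
    rw [hx₀, add_sub_cancel_right, norm_smul, norm_inv, Complex.norm_real,
      Real.norm_of_nonneg hM.le]
    gcongr
    exact norm_ofHat_scaleWeight_le hn hc hc1 hVc h0 hD hVD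
  obtain ⟨z, hz0, hz, hzy⟩ := exists_solution_near (F := p.field μ (M ^ 4)⁻¹) (τ := L) (A := A)
    (K := 5 * scaleConst d ^ 4 * (2 * A) ^ 4) (e := (M ^ 4)⁻¹ * L * (2 * Real.pi * n) ^ 4 *
      (((profWeight d).const ^ 4 + 5 * scaleConst d ^ 4) * A ^ 5)) (e₀ := M⁻¹ * (D / c)) hL hA
    (by positivity) (by positivity) (by positivity) (p.continuous_field μ _)
    (fun t x y hx hy => by
      have := p.norm_field_sub_le hμ (M ^ 4)⁻¹ t hx hy
      rwa [hpc] at this)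
    (fun t => p.field_zero _ _ t) (y := fun t => p.dilate n hn0 hle (y t))
    (y' := fun t => p.dilate n hn0 hle ((Complex.I * μ) • (profWeight d).quintic (y t)))
    (fun t _ => hasDerivWithinAt_clm_comp _ (hy t).hasDerivWithinAt)
    (fun t ht => (p.norm_dilate_apply_le hn0 hle _).trans (hyA t ht))
    (fun t ht => by
      rw [map_smul, p.dilate_quintic hn0 hle]
      exact p.norm_quintic_sub_field_le hn0 hle hμ (by positivity) ht.1 ht.2 (hyA t ht))
    hx (by rw [← hE]; exact hEA)
  refine ⟨fun t => (M : ℂ) • p.toHs s hs (propagator t (z (M ^ 4 * t))),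
    p.isStrongSolution hM hs hz, ?_, ?_⟩
  · have e1 : (M : ℂ) • p.toHs s hs (propagator 0 (z (M ^ 4 * 0))) - Hs.ofFourier s V hV =
        (M : ℂ) • p.toHs s hs (p.dilate n hn0 hle (y 0)) := by
      have : (M : ℂ) ≠ 0 := by exact_mod_cast hM.ne'
      rw [mul_zero, hz0, propagator_zero, hx₀, map_add, map_smul, smul_add, smul_smul,
        mul_inv_cancel₀ this, one_smul, p.toHs_ofHat hs hVc h0 hV, add_sub_cancel_left]
    simp only
    rw [e1]
    refine le_of_sq_le_sq ?_ hκ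
    rw [p.norm_toHs_dilate_sq hs hn0 hM hMn hle]
    exact h1
  · set t := L / M ^ 4 with ht
    have ht0 : 0 ≤ t := by positivity
    have e1 : M ^ 4 * t = L := by rw [ht]; field_simp
    simp only
    rw [e1]
    set w := propagator t (z L) with hw
    have hLm : L ∈ Icc 0 L := ⟨hL, le_rfl⟩
    have hwy : ‖w - p.dilate n hn0 hle (y L)‖ ≤ E + (M ^ 4)⁻¹ * L * (2 * Real.pi * n) ^ 4 * A := by
      have a1 : ‖propagator t (z L) - propagator t (p.dilate n hn0 hle (y L))‖ ≤ E := by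
        rw [← map_sub, LinearIsometry.norm_map, hE]
        exact hzy L hLm
      have a2 := p.norm_propagator_dilate_sub_le hn0 hle t (y L)
      have a3 : |t| * (2 * Real.pi * n) ^ 4 * ‖y L‖ ≤
          (M ^ 4)⁻¹ * L * (2 * Real.pi * n) ^ 4 * A := by
        rw [abs_of_nonneg ht0, ht, div_eq_inv_mul]
        have := hyA L hLm
        gcongr
      have := norm_sub_le_norm_sub_add_norm_sub w (propagator t (p.dilate n hn0 hle (y L)))
        (p.dilate n hn0 hle (y L))
      linarith
    have hGn := memFourierHs_dilate hn0 hGm h2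
    have b1 := Hs.norm_integral_mul_le (p.memFourierHs_hat hs w) hGn
    -- Since `n^(-2s) n^d = M²`, the dilated `G` has a dual norm of at most `M B`; this `M` is the
    -- amplitude of the solution.
    have b2 : Real.sqrt (∫ ξ, (1 + ‖ξ‖ ^ 2) ^ (-s) * ‖G (n⁻¹ • ξ)‖ ^ 2) ≤ M * B := by
      rw [Real.sqrt_le_left (by positivity), integral_sobolev_dilate _ hn0, mul_pow, hMn]
      have : n ^ (2 * -s) * n ^ d = n ^ ((d : ℝ) - 2 * s) := by
        rw [← Real.rpow_natCast n d, ← Real.rpow_add hn0]; congr 1; ring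
      rw [this]
      gcongr
    have hint : ∀ h : CZero d, Integrable fun ξ => p.hat h ξ * G (n⁻¹ • ξ) := fun h =>
      (p.integrable_hat h).mul_bdd (c := b)
        (hGm.comp (by fun_prop : Measurable fun ξ : Rd d => n⁻¹ • ξ)).aestronglyMeasurable
        (ae_of_all _ fun ξ => hGb _)
    have b3 : (∫ ξ, p.hat w ξ * G (n⁻¹ • ξ)) =
        (∫ ξ, p.hat (w - p.dilate n hn0 hle (y L)) ξ * G (n⁻¹ • ξ)) +
          ∫ ξ, (profWeight d).hat (y L) ξ * G ξ := by
      rw [← p.integral_hat_dilate_mul hn0 hle, ← integral_add (hint _) (hint _)]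
      refine integral_congr_ae (ae_of_all _ fun ξ => ?_)
      simp only [ConvWeight.hat_sub]; ring
    have b4 : ‖∫ ξ, p.hat (w - p.dilate n hn0 hle (y L)) ξ * G (n⁻¹ • ξ)‖ ≤ B := by
      refine (p.norm_integral_hat_mul_le _ fun ξ => hGb _).trans (le_trans ?_ hEB)
      have := integral_scaleWeight_le (d := d) hn hc hc1
      have i0 : 0 ≤ ∫ ξ, p.toFun ξ := integral_nonneg fun ξ => (p.pos ξ).le
      gcongr
      exact (norm_nonneg _).trans hwy
    have b5 : R * B ≤ ‖∫ ξ, p.hat w ξ * G (n⁻¹ • ξ)‖ := by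
      rw [b3]
      have := norm_sub_le_norm_add (∫ ξ, (profWeight d).hat (y L) ξ * G ξ)
        (∫ ξ, p.hat (w - p.dilate n hn0 hle (y L)) ξ * G (n⁻¹ • ξ))
      rw [add_comm] at this
      linarith
    clear_value w
    have b6 : R * B ≤ ‖p.toHs s hs w‖ * (M * B) :=
      b5.trans (b1.trans (mul_le_mul_of_nonneg_left b2 (norm_nonneg _)))
    rw [norm_smul, Complex.norm_real, Real.norm_of_nonneg hM.le]
    refine le_of_mul_le_mul_right (b6.trans_eq ?_) hB
    ring

/-- A bounded perturbation at unit scale of a profile at frequency scale `n` with amplitude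
`n ^ (d/2 - s)` follows the dispersionless flow of the profile. -/
theorem exists_inflation_of_profile {s μ : ℝ} (hμ : |μ| = 1) (hs : s < d / 2 - 1)
    {y : ℝ → CZero d}
    (hy : ∀ τ, HasDerivAt y ((Complex.I * μ) • (profWeight d).quintic (y τ)) τ) {L : ℝ}
    (hL : 0 ≤ L) {G : Rd d → ℂ} (hGm : Measurable G) {b : ℝ} (hGb : ∀ ξ, ‖G ξ‖ ≤ b) {κ R B : ℝ}
    (hκ : 0 ≤ κ) (hB : 0 < B)
    (h1 : ∀ n : ℝ, 1 ≤ n → ∫ ξ, ((n ^ 2)⁻¹ + ‖ξ‖ ^ 2) ^ s * ‖(profWeight d).hat (y 0) ξ‖ ^ 2 ≤ κ ^ 2)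
    (h2 : ∀ n : ℝ, 1 ≤ n → Integrable fun ξ => ((n ^ 2)⁻¹ + ‖ξ‖ ^ 2) ^ (-s) * ‖G ξ‖ ^ 2)
    (h3 : ∀ n : ℝ, 1 ≤ n → ∫ ξ, ((n ^ 2)⁻¹ + ‖ξ‖ ^ 2) ^ (-s) * ‖G ξ‖ ^ 2 ≤ B ^ 2)
    (h4 : (R + 1) * B ≤ ‖∫ ξ, (profWeight d).hat (y L) ξ * G ξ‖)
    {V : Rd d → ℂ} (hV : MemFourierHs s V) (hVc : Continuous V) (hVs : HasCompactSupport V)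
    {T : ℝ} (hT : 0 < T) : ∃ t, 0 ≤ t ∧ t ≤ T ∧ ∃ v : ℝ → Hs d s,
      IsStrongSolution μ (Icc 0 t) (fun r => Hs.toDist (v r)) ∧
        ‖v 0 - Hs.ofFourier s V hV‖ ≤ κ ∧ R ≤ ‖v t‖ := by
  obtain ⟨D, hD, hVD⟩ := exists_le_polyWeight hVc hVs (d + 1 + (d + 1))
  have hyc : Continuous y := continuous_iff_continuousAt.2 fun τ => (hy τ).continuousAt
  obtain ⟨A₀, hA₀⟩ := isCompact_Icc.exists_bound_of_continuousOn (s := Icc 0 L) hyc.continuousOn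
  set A := |A₀| + 1 with hA
  have hA0 : 0 < A := by positivity
  have hyA : ∀ τ ∈ Icc 0 L, ‖y τ‖ ≤ A := fun τ hτ =>
    (hA₀ τ hτ).trans ((le_abs_self _).trans (by rw [hA]; linarith))
  set α : ℝ := d / 2 - s with hα
  have hα1 : 1 < α := by rw [hα]; linarith
  -- With `M = n^α` and the unit scale coefficient `c = n^(-α/2)`, the background has size `D/(M c)
  -- = D n^(-α/2)`, the dispersion has strength `(n/M)⁴ = n^(-4(α-1))` and the elapsed time is `L
  -- n^(-4α)`. All three tend to zero because `α > 1`.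
  have t1 : Tendsto (fun n : ℝ => n ^ (-(α / 2))) atTop (𝓝 0) :=
    tendsto_rpow_neg_atTop (by linarith)
  have t2 : Tendsto (fun n : ℝ => n ^ (-(4 * (α - 1)))) atTop (𝓝 0) :=
    tendsto_rpow_neg_atTop (by linarith)
  have t3 : Tendsto (fun n : ℝ => n ^ (-(4 * α))) atTop (𝓝 0) :=
    tendsto_rpow_neg_atTop (by linarith)
  set K := (((profWeight d).const ^ 4 + 5 * scaleConst d ^ 4) * A ^ 5) with hK
  set X := Real.exp (2 * (5 * scaleConst d ^ 4 * (2 * A) ^ 4) * L) with hX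
  have tE : Tendsto (fun n : ℝ => (n ^ (-(α / 2)) * D +
      n ^ (-(4 * (α - 1))) * (L * (2 * Real.pi) ^ 4 * K * L)) * X) atTop (𝓝 0) := by
    simpa using ((t1.mul_const D).add (t2.mul_const (L * (2 * Real.pi) ^ 4 * K * L))).mul_const X
  have tF : Tendsto (fun n : ℝ => ((n ^ (-(α / 2)) * D +
      n ^ (-(4 * (α - 1))) * (L * (2 * Real.pi) ^ 4 * K * L)) * X +
      n ^ (-(4 * (α - 1))) * (L * (2 * Real.pi) ^ 4 * A)) * (2 * polyMass d (d + 1)) * b)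
      atTop (𝓝 0) := by
    simpa using ((tE.add (t2.mul_const (L * (2 * Real.pi) ^ 4 * A))).mul_const
      (2 * polyMass d (d + 1))).mul_const b
  have tG : Tendsto (fun n : ℝ => L * n ^ (-(4 * α))) atTop (𝓝 0) := by
    simpa using t3.const_mul L
  obtain ⟨n, hn, nE, nF, nG⟩ := ((eventually_ge_atTop (1 : ℝ)).and
    ((tE.eventually_le_const hA0).and ((tF.eventually_le_const hB).and
      (tG.eventually_le_const hT)))).exists
  have hn0 : 0 < n := by linarith
  have hM : 0 < n ^ α := Real.rpow_pos_of_pos hn0 _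
  have hc : 0 < n ^ (-(α / 2)) := Real.rpow_pos_of_pos hn0 _
  have hc1 : n ^ (-(α / 2)) ≤ 1 := Real.rpow_le_one_of_one_le_of_nonpos hn (by linarith)
  have e1 : (n ^ α)⁻¹ * (D / n ^ (-(α / 2))) = n ^ (-(α / 2)) * D := by
    have h : (n ^ α)⁻¹ = n ^ (-(α / 2)) * n ^ (-(α / 2)) := by
      rw [← Real.rpow_add hn0, ← Real.rpow_neg hn0.le]; congr 1; ring
    rw [h]; field_simp
  have e0 : ((n ^ α) ^ 4)⁻¹ = n ^ (-(4 * α)) := by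
    rw [← Real.rpow_mul_natCast hn0.le, ← Real.rpow_neg hn0.le]; congr 1; push_cast; ring
  have e2 : ∀ W, ((n ^ α) ^ 4)⁻¹ * L * (2 * Real.pi * n) ^ 4 * W =
      n ^ (-(4 * (α - 1))) * (L * (2 * Real.pi) ^ 4 * W) := fun W => by
    have h : n ^ (-(4 * (α - 1))) = n ^ (-(4 * α)) * n ^ 4 := by
      rw [← Real.rpow_natCast n 4, ← Real.rpow_add hn0]; congr 1; push_cast; ring
    rw [e0, h]; ring
  have e3 : L / (n ^ α) ^ 4 = L * n ^ (-(4 * α)) := by rw [div_eq_mul_inv, e0]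
  have e4 : ((n ^ α)⁻¹ * (D / n ^ (-(α / 2))) + ((n ^ α) ^ 4)⁻¹ * L * (2 * Real.pi * n) ^ 4 *
      K * L) * X = (n ^ (-(α / 2)) * D +
      n ^ (-(4 * (α - 1))) * (L * (2 * Real.pi) ^ 4 * K * L)) * X := by
    rw [e1, e2]; ring
  obtain ⟨v, hv⟩ := inflation_at_scale hμ (by linarith) hy hL hGm hGb hκ hB hA0.le hyA hn hc hc1 hM
    (by rw [← Real.rpow_mul_natCast hn0.le]; congr 1; rw [hα]; push_cast; ring)
    (h1 n hn) (h2 n hn) (h3 n hn) h4 hV hVc hVs hD hVD rfl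
    (by rw [← hK, ← hX, e4]; exact nE) (by rw [← hK, ← hX, e4, e2]; exact nF)
  exact ⟨L / (n ^ α) ^ 4, by positivity, by rw [e3]; exact nG, v, hv⟩

/-! ### The dispersionless flow -/

theorem exists_linear_flow {E : Type*} [NormedAddCommGroup E] [NormedSpace ℂ E] [NormedSpace ℝ E]
    [IsScalarTower ℝ ℂ E] [CompleteSpace E] (B : E →L[ℂ] E) (h : E) :
    ∃ y : ℝ → E, y 0 = h ∧ ∀ τ, HasDerivAt y (B (y τ)) τ := by
  refine ⟨fun τ => (NormedSpace.exp ((τ : ℂ) • B)) h, by simp, fun τ => ?_⟩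
  have h1 : HasDerivAt (fun u : ℂ => NormedSpace.exp (u • B))
      (B * NormedSpace.exp ((τ : ℂ) • B)) (τ : ℂ) := hasDerivAt_exp_smul_const' B (τ : ℂ)
  have h2 : HasDerivAt (fun u : ℂ => (NormedSpace.exp (u • B)) h)
      ((B * NormedSpace.exp ((τ : ℂ) • B)) h) (τ : ℂ) :=
    (ContinuousLinearMap.apply ℂ E h).hasFDerivAt.comp_hasDerivAt (τ : ℂ) h1
  have h3 := h2.scomp τ (h := fun τ : ℝ => (τ : ℂ)) (hasDerivAt_id (τ : ℂ)).comp_ofReal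
  rwa [one_smul] at h3

namespace ConvWeight

variable (p : ConvWeight d)

theorem hasDerivAt_ev {y : ℝ → CZero d} {y' : CZero d} {τ : ℝ} (hy : HasDerivAt y y' τ) (x : Rd d) :
    HasDerivAt (fun τ => p.ev (y τ) x) (p.ev y' x) τ := by
  rw [← hasDerivWithinAt_univ] at hy ⊢
  exact hasDerivWithinAt_clm_comp (p.evCLM x) hy

theorem exp_of_hasDerivAt {f : ℝ → ℂ} {c : ℂ} (hf : ∀ τ, HasDerivAt f (c * f τ) τ) (τ : ℝ) :
    f τ = Complex.exp (c * τ) * f 0 := by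
  have h1 : ∀ τ : ℝ, HasDerivAt (fun τ : ℝ => Complex.exp (-(c * τ)) * f τ) 0 τ := fun τ => by
    have h2 : HasDerivAt (fun τ : ℝ => -(c * (τ : ℂ))) (-c) τ := by
      simpa using ((hasDerivAt_id (τ : ℂ)).comp_ofReal.const_mul c).fun_neg
    refine (h2.cexp.mul (hf τ)).congr_deriv ?_
    ring
  have h3 := is_const_of_deriv_eq_zero (fun τ => (h1 τ).differentiableAt) (fun τ => (h1 τ).deriv) τ 0
  simp only [Complex.ofReal_zero, mul_zero, neg_zero, Complex.exp_zero, one_mul] at h3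
  rw [← h3, ← mul_assoc, ← Complex.exp_add, add_neg_cancel, Complex.exp_zero, one_mul]

/-- The flow of the equation without dispersion. -/
theorem exists_dispersionless_flow (μ : ℝ) (h : CZero d) : ∃ y : ℝ → CZero d, y 0 = h ∧
    (∀ τ, HasDerivAt y ((Complex.I * μ) • p.quintic (y τ)) τ) ∧
    ∀ τ x, p.ev (y τ) x = Complex.exp (Complex.I * ((μ * τ * ‖p.ev h x‖ ^ 4 : ℝ) : ℂ)) *
      p.ev h x := by
  -- The potential is frozen at `|h|⁴`, which makes the equation linear. Its solutions rotate in
  -- phase at each point, so `|y| = |h|` at all times, and the frozen equation is the nonlinear one.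
  obtain ⟨y, hy0, hy⟩ := exists_linear_flow ((Complex.I * (μ : ℂ)) • p.mul (p.quartic h)) h
  have key : ∀ τ x, p.ev (y τ) x = Complex.exp (Complex.I * ((μ * τ * ‖p.ev h x‖ ^ 4 : ℝ) : ℂ)) *
      p.ev h x := fun τ x => by
    have h1 : ∀ τ, HasDerivAt (fun τ => p.ev (y τ) x)
        ((Complex.I * μ * (‖p.ev h x‖ : ℂ) ^ 4) * p.ev (y τ) x) τ := fun τ => by
      refine (p.hasDerivAt_ev (hy τ) x).congr_deriv ?_
      rw [← evCLM_apply, smul_apply, map_smul, evCLM_apply, ev_mul, ev_quartic,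
        smul_eq_mul]
      ring
    have h2 := exp_of_hasDerivAt h1 τ
    rw [h2, hy0]
    congr 2
    push_cast; ring
  refine ⟨y, hy0, fun τ => ?_, key⟩
  have e : p.quintic (y τ) = p.mul (p.quartic h) (y τ) := by
    refine p.ev_injective fun x => ?_
    rw [ev_quintic, ev_mul, ev_quartic]
    congr 3
    rw [key, norm_mul, norm_phase, one_mul]
  rw [e]
  exact hy τ

/-- The `L²` norm on the Fourier side is the Fourier transform of `|u|²` at frequency zero, so it is
determined by the modulus. This gives conservation of mass. -/
theorem integral_norm_hat_sq_eq {h k : CZero d} (H : ∀ x, ‖p.ev h x‖ = ‖p.ev k x‖) :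
    ∫ ξ, ‖p.hat h ξ‖ ^ 2 = ∫ ξ, ‖p.hat k ξ‖ ^ 2 := by
  have h1 : p.mul h (conjRefl h) = p.mul k (conjRefl k) := p.ev_injective fun x => by
    rw [ev_mul, ev_mul, ev_conjRefl, ev_conjRefl, Complex.star_def,
      Complex.mul_conj, Complex.mul_conj, Complex.normSq_eq_norm_sq, Complex.normSq_eq_norm_sq, H]
  have h2 : ∀ h : CZero d, p.hat (p.mul h (conjRefl h)) 0 = ((∫ ξ, ‖p.hat h ξ‖ ^ 2 : ℝ) : ℂ) :=
    fun h => by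
      rw [hat_mul, fconv, ← integral_complex_ofReal]
      refine integral_congr_ae (ae_of_all _ fun ξ => ?_)
      simp only [hat_conjRefl, zero_sub, neg_neg]
      rw [Complex.star_def, Complex.mul_conj, Complex.normSq_eq_norm_sq]
  have h3 := h2 h
  rw [h1, h2] at h3
  exact_mod_cast h3.symm

theorem integrable_norm_hat_sq (h : CZero d) : Integrable fun ξ => ‖p.hat h ξ‖ ^ 2 := by
  have h1 := p.memFourierHs_hat zero_lt_half_add_one h
  have h2 := (memLp_two_iff_integrable_sq_norm h1.1).1 h1
  simpa [bracket_zero] using h2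

/-- Fourier inversion in the weighted space. -/
theorem hat_eq_fourier_ev {h : CZero d} (hi : Integrable (p.ev h)) : p.hat h = 𝓕 (p.ev h) := by
  have h1 : Integrable (𝓕 (p.hat h)) := by
    have : 𝓕 (p.hat h) = fun x => p.ev h (-x) := by
      ext x
      rw [ev, Real.fourierInv_eq_fourier_neg, neg_neg]
    rw [this]
    exact hi.comp_neg
  exact ((p.continuous_hat h).fourier_fourierInv_eq (p.integrable_hat h) h1).symm

end ConvWeight

/-! ### The case `s < 0`: transfer to low frequencies -/

theorem SchwartzMap.integrable_norm_pow (φ : 𝓢(Rd d, ℂ)) {k : ℕ} (hk : 1 ≤ k) :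
    Integrable fun x => ‖φ x‖ ^ k := by
  obtain ⟨m, rfl⟩ := Nat.exists_eq_add_of_le' hk
  have h := (φ.integrable (μ := volume)).norm.bdd_mul (c := SchwartzMap.seminorm ℝ 0 0 φ ^ m)
    (f := fun x => ‖φ x‖ ^ m) (φ.continuous.norm.pow m).aestronglyMeasurable (ae_of_all _ fun x => ?_)
  · refine h.congr (ae_of_all _ fun x => ?_)
    simp only [pow_succ]
  · rw [norm_pow, norm_norm]
    gcongr
    exact φ.norm_le_seminorm ℝ x

theorem fourier_mul_fourierChar (f : Rd d → ℂ) (a ξ : Rd d) :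
    𝓕 (fun x => f x * Real.fourierChar (inner ℝ a x)) ξ = 𝓕 f (ξ - a) := by
  rw [Real.fourier_eq, Real.fourier_eq]
  refine integral_congr_ae (ae_of_all _ fun x => ?_)
  simp only [Circle.smul_def, smul_eq_mul, inner_sub_right]
  rw [real_inner_comm x a, neg_sub, sub_eq_add_neg, AddChar.map_add_eq_mul, Circle.coe_mul]
  ring

theorem tendsto_fourier_cocompact (f : Rd d → ℂ) : Tendsto (𝓕 f) (cocompact _) (𝓝 0) := by
  have := tendsto_integral_exp_inner_smul_cocompact f
  exact this

namespace ConvWeight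

variable (p : ConvWeight d)

/-- There is a function with compactly supported Fourier transform that is nonnegative. -/
theorem exists_nonneg_bump : ∃ (β : CZero d) (g : Rd d → ℝ), HasCompactSupport (p.hat β) ∧
    Continuous g ∧ (∀ x, 0 ≤ g x) ∧ (∀ x, p.ev β x = g x) ∧
    (∀ k : ℕ, 1 ≤ k → Integrable fun x => g x ^ k) ∧ 0 < ∫ x, g x ^ 5 := by
  set f : ContDiffBump (0 : Rd d) := ⟨1, 2, one_pos, one_lt_two⟩ with hf
  have hg₁ : HasCompactSupport (Complex.ofRealCLM ∘ f) := f.hasCompactSupport.comp_left rfl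
  have hg₂ : ContDiff ℝ (⊤ : ℕ∞) (Complex.ofRealCLM ∘ f) :=
    Complex.ofRealCLM.contDiff.comp f.contDiff
  set χ : 𝓢(Rd d, ℂ) := hg₁.toSchwartzMap hg₂ with hχ
  have hχx : ∀ x, χ x = (f x : ℂ) := fun x => rfl
  have hχs : HasCompactSupport χ := hg₁
  set h₀ := p.ofHat χ χ.continuous (p.tendsto_of_hasCompactSupport hχs) with hh₀
  have hhat : p.hat h₀ = χ := funext fun ξ => p.hat_ofHat _ _ ξ
  set φ : 𝓢(Rd d, ℂ) := 𝓕⁻ χ with hφ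
  have hev : ∀ x, p.ev h₀ x = φ x := fun x => by
    rw [ev, hhat, hφ, SchwartzMap.fourierInv_coe]
  -- The autocorrelation of the bump `χ` has compact support, and in physical space it is `|φ|² ≥
  -- 0`.
  refine ⟨p.mul h₀ (conjRefl h₀), fun x => ‖φ x‖ ^ 2, ?_, by fun_prop, fun x => by positivity,
    fun x => ?_, fun k hk => ?_, ?_⟩
  · have e : p.hat (p.mul h₀ (conjRefl h₀)) = convolution (p.hat h₀) (p.hat (conjRefl h₀))
        (ContinuousLinearMap.mul ℂ ℂ) volume := by
      ext ξ; rw [hat_mul, fconv_eq]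
    rw [e, hhat]
    refine HasCompactSupport.convolution _ hχs ?_
    have e2 : p.hat (conjRefl h₀) = (fun z => star z) ∘ χ ∘ (Homeomorph.neg (Rd d)) := by
      ext ξ; rw [hat_conjRefl, hhat]; rfl
    rw [e2]
    exact (hχs.comp_homeomorph _).comp_left (by simp)
  · rw [ev_mul, ev_conjRefl, hev, Complex.star_def, Complex.mul_conj, Complex.normSq_eq_norm_sq]
  · simp only [← pow_mul]
    exact φ.integrable_norm_pow (by omega)
  · simp only [← pow_mul]
    rw [integral_pos_iff_support_of_nonneg (fun x => by positivity)
      (φ.integrable_norm_pow (by norm_num))]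
    refine IsOpen.measure_pos _ (Continuous.isOpen_support (by fun_prop)) ⟨0, ?_⟩
    simp only [Function.mem_support]
    refine pow_ne_zero _ (norm_ne_zero_iff.2 ?_)
    have h1 : φ 0 = ((∫ ξ, f ξ : ℝ) : ℂ) := by
      rw [← hev, ev_eq, ← integral_complex_ofReal]
      refine integral_congr_ae (ae_of_all _ fun ξ => ?_)
      simp [hhat, hχx]
    rw [h1]
    exact_mod_cast f.integral_pos.ne'

theorem ev_translate {β h : CZero d} {a : Rd d} (hh : ∀ ξ, p.hat h ξ = p.hat β (ξ - a)) (x : Rd d) :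
    p.ev h x = p.ev β x * Real.fourierChar (inner ℝ a x) := by
  rw [ev_eq, ev_eq, ← integral_mul_const]
  refine Eq.trans ?_ (integral_sub_right_eq_self (fun ξ => Real.fourierChar (inner ℝ ξ x) •
    p.hat β ξ * (Real.fourierChar (inner ℝ a x) : ℂ)) a)
  refine integral_congr_ae (ae_of_all _ fun ξ => ?_)
  simp only [hh, Circle.smul_def, smul_eq_mul]
  rw [show inner ℝ ξ x = inner ℝ (ξ - a) x + inner ℝ a x by rw [← inner_add_left, sub_add_cancel],
    AddChar.map_add_eq_mul, Circle.coe_mul]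
  ring

/-- On the unit circle `|1 + E|² = (1 + E)(1 + E⁻¹)`, so the expression is `g⁵ E⁻¹ (1 + E)⁵`,
expanded by the binomial theorem. The term `5 g⁵` does not oscillate. -/
theorem quintic_two_waves {g : ℝ} (hg : 0 ≤ g) {E : ℂ} (hE : ‖E‖ = 1) :
    (‖(g : ℂ) * (E + E ^ 2)‖ : ℂ) ^ 4 * ((g : ℂ) * (E + E ^ 2)) =
      (g : ℂ) ^ 5 * (E⁻¹ + 5 + 10 * E + 10 * E ^ 2 + 5 * E ^ 3 + E ^ 4) := by
  have hE0 : E ≠ 0 := by rintro rfl; simp at hE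
  have h1 : (‖E + E ^ 2‖ : ℂ) ^ 2 = (1 + E) * (1 + E⁻¹) := by
    have h2 : E + E ^ 2 = E * (1 + E) := by ring
    rw [h2, norm_mul, hE, one_mul, ← Complex.ofReal_pow, ← Complex.normSq_eq_norm_sq,
      ← Complex.mul_conj, map_add, map_one, ← Complex.inv_eq_conj hE]
  rw [norm_mul, Complex.norm_real, Real.norm_of_nonneg hg]
  push_cast
  rw [mul_pow, show (‖E + E ^ 2‖ : ℂ) ^ 4 = ((‖E + E ^ 2‖ : ℂ) ^ 2) ^ 2 by ring, h1]
  field_simp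
  ring

end ConvWeight

theorem fourierChar_mul_inner_smul (m : ℕ) (K : ℝ) (e x : Rd d) :
    (Real.fourierChar (inner ℝ ((m * K) • e) x) : ℂ) =
      (Real.fourierChar (inner ℝ (K • e) x) : ℂ) ^ m := by
  rw [mul_smul, inner_smul_left, ← Circle.coe_pow, ← AddChar.map_nsmul_eq_pow, nsmul_eq_mul]
  simp

theorem integral_add_six {f₀ f₁ f₂ f₃ f₄ f₅ : Rd d → ℂ} (h₀ : Integrable f₀) (h₁ : Integrable f₁)
    (h₂ : Integrable f₂) (h₃ : Integrable f₃) (h₄ : Integrable f₄) (h₅ : Integrable f₅) :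
    ∫ x, (f₀ x + f₁ x + f₂ x + f₃ x + f₄ x + f₅ x) = (∫ x, f₀ x) + (∫ x, f₁ x) + (∫ x, f₂ x) +
      (∫ x, f₃ x) + (∫ x, f₄ x) + ∫ x, f₅ x := by
  have a₁ : Integrable fun x => f₀ x + f₁ x := h₀.add h₁
  have a₂ : Integrable fun x => f₀ x + f₁ x + f₂ x := a₁.add h₂
  have a₃ : Integrable fun x => f₀ x + f₁ x + f₂ x + f₃ x := a₂.add h₃
  have a₄ : Integrable fun x => f₀ x + f₁ x + f₂ x + f₃ x + f₄ x := a₃.add h₄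
  rw [integral_add a₄ h₅, integral_add a₃ h₄, integral_add a₂ h₃, integral_add a₁ h₂,
    integral_add h₀ h₁]

/-- The Fourier transform of the nonlinearity for the sum of two waves. -/
theorem fourier_quintic_two_waves {g : Rd d → ℝ} (hg : Integrable fun x => (g x : ℂ) ^ 5)
    (a ξ : Rd d) :
    𝓕 (fun x => (g x : ℂ) ^ 5 * ((Real.fourierChar (inner ℝ a x) : ℂ)⁻¹ + 5 +
      10 * (Real.fourierChar (inner ℝ a x) : ℂ) + 10 * (Real.fourierChar (inner ℝ a x) : ℂ) ^ 2 +
      5 * (Real.fourierChar (inner ℝ a x) : ℂ) ^ 3 + (Real.fourierChar (inner ℝ a x) : ℂ) ^ 4) :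
      Rd d → ℂ) ξ =
    𝓕 (fun x => (g x : ℂ) ^ 5 : Rd d → ℂ) (ξ + a) + 5 * 𝓕 (fun x => (g x : ℂ) ^ 5 : Rd d → ℂ) ξ +
      10 * 𝓕 (fun x => (g x : ℂ) ^ 5 : Rd d → ℂ) (ξ - a) + 10 * 𝓕 (fun x => (g x : ℂ) ^ 5 : Rd d → ℂ) (ξ - (2 : ℝ) • a) +
      5 * 𝓕 (fun x => (g x : ℂ) ^ 5 : Rd d → ℂ) (ξ - (3 : ℝ) • a) +
      𝓕 (fun x => (g x : ℂ) ^ 5 : Rd d → ℂ) (ξ - (4 : ℝ) • a) := by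
  set f : Rd d → ℂ := fun x => (g x : ℂ) ^ 5 with hf
  have hpow : ∀ (m : ℕ) (x : Rd d), (Real.fourierChar (inner ℝ ((m : ℝ) • a) x) : ℂ) =
      (Real.fourierChar (inner ℝ a x) : ℂ) ^ m := fun m x => by
    have := fourierChar_mul_inner_smul m 1 a x
    rwa [mul_one, one_smul] at this
  have hinv : ∀ x : Rd d, (Real.fourierChar (inner ℝ (-a) x) : ℂ) =
      (Real.fourierChar (inner ℝ a x) : ℂ)⁻¹ := fun x => by
    rw [inner_neg_left, AddChar.map_neg_eq_inv, Circle.coe_inv]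
  have hi : ∀ b : Rd d, Integrable fun x =>
      Real.fourierChar (-inner ℝ x ξ) • (f x * (Real.fourierChar (inner ℝ b x) : ℂ)) := fun b => by
    have h1 : Integrable fun x => f x * (Real.fourierChar (inner ℝ b x) : ℂ) :=
      hg.mul_bdd (c := 1) (by
        refine Continuous.aestronglyMeasurable ?_
        exact (by fun_prop : Continuous fun z : Circle => (z : ℂ)).comp (Real.continuous_fourierChar.comp (by fun_prop)))
        (ae_of_all _ fun x => (Circle.norm_coe _).le)
    exact (Real.fourierIntegral_convergent_iff ξ).2 h1
  have key : ∀ b : Rd d, 𝓕 f (ξ - b) = ∫ x,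
      Real.fourierChar (-inner ℝ x ξ) • (f x * (Real.fourierChar (inner ℝ b x) : ℂ)) := fun b => by
    rw [← fourier_mul_fourierChar, Real.fourier_eq]
  have k0 := key 0
  rw [sub_zero] at k0
  have kn := key (-a)
  rw [sub_neg_eq_add] at kn
  rw [kn, k0, key a, key _, key _, key _, Real.fourier_eq]
  rw [← integral_const_mul, ← integral_const_mul, ← integral_const_mul, ← integral_const_mul,
    ← integral_add_six (hi _) ((hi _).const_mul _) ((hi _).const_mul _) ((hi _).const_mul _)
      ((hi _).const_mul _) (hi _)]
  refine integral_congr_ae (ae_of_all _ fun x => ?_)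
  have h2 := hpow 2 x
  have h3 := hpow 3 x
  have h4 := hpow 4 x
  push_cast at h2 h3 h4
  simp only [Circle.smul_def, smul_eq_mul]
  rw [hinv, h2, h3, h4]
  simp only [inner_zero_left, AddChar.map_zero_eq_one, Circle.coe_one]
  ring

theorem norm_smul_sub_ge {e ξ : Rd d} (he : ‖e‖ = 1) {K r m : ℝ} (hξ : ‖ξ‖ ≤ r) (hK : 0 ≤ K)
    (hm : 1 ≤ m) : K - r ≤ ‖ξ - m • (K • e)‖ := by
  have h1 := norm_sub_norm_le (m • (K • e)) ξ
  rw [norm_smul, norm_smul, he, Real.norm_of_nonneg hK, Real.norm_of_nonneg (by linarith),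
    norm_sub_rev] at h1
  nlinarith

/-- Two high frequency waves of bounded size and energy whose quintic interaction has a nonvanishing
low frequency component. -/
theorem exists_bump_profile (hd : 0 < d) (p : ConvWeight d) : ∃ r > 0, ∃ q > 0, ∃ D ≥ 0, ∃ N ≥ 0,
    ∃ K₀ ≥ 4 * r, ∀ K ≥ K₀, ∃ h : CZero d, (∀ ξ, ‖ξ‖ ≤ K / 2 → p.hat h ξ = 0) ∧
      ∫ ξ, ‖p.hat h ξ‖ ^ 2 ≤ D ∧ Integrable (p.ev h) ∧ (Integrable fun x => ‖p.ev h x‖ ^ 9) ∧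
      ∫ x, ‖p.ev h x‖ ^ 9 ≤ N ∧ ∀ ξ, ‖ξ‖ ≤ r → q ≤ (p.hat (p.quintic h) ξ).re := by
  obtain ⟨β, g, hβ, hgc, hg0, hg, hgi, hgq⟩ := p.exists_nonneg_bump
  set q := ∫ x, g x ^ 5 with hq
  have hg5 : Integrable fun x => (g x : ℂ) ^ 5 := by
    have := (hgi 5 (by norm_num)).ofReal (𝕜 := ℂ)
    simpa using this
  set Γ : Rd d → ℂ := 𝓕 (fun x => (g x : ℂ) ^ 5 : Rd d → ℂ) with hΓ
  have hΓ0 : Γ 0 = q := by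
    rw [hΓ, Real.fourier_eq, hq, ← integral_complex_ofReal]
    refine integral_congr_ae (ae_of_all _ fun x => ?_)
    simp
  have hΓc : Continuous Γ := by
    have h1 := continuous_fourierInv hg5
    have h2 : Γ = fun ξ => 𝓕⁻ (fun x => (g x : ℂ) ^ 5 : Rd d → ℂ) (-ξ) := by
      ext ξ; rw [Real.fourierInv_eq_fourier_neg, neg_neg]
    rw [h2]
    exact h1.comp continuous_neg
  obtain ⟨r, hr, hrΓ⟩ : ∃ r > 0, ∀ ξ, ‖ξ‖ ≤ r → q / 2 ≤ (Γ ξ).re := by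
    have h1 : Tendsto (fun ξ => (Γ ξ).re) (𝓝 0) (𝓝 q) := by
      have h0 : (Γ 0).re = q := by rw [hΓ0, Complex.ofReal_re]
      rw [← h0]
      exact (Complex.continuous_re.comp hΓc).tendsto 0
    have h2 := h1.eventually_const_le (show q / 2 < q by linarith)
    obtain ⟨r, hr, h3⟩ := Metric.eventually_nhds_iff.1 h2
    refine ⟨r / 2, by positivity, fun ξ hξ => h3 ?_⟩
    rw [dist_zero_right]; linarith
  -- The coefficients of the oscillating terms add up to `1 + 10 + 10 + 5 + 1 = 27`. Together they
  -- cost at most `q`, against at least `5q/2` from the nonoscillating term.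
  obtain ⟨R, hR⟩ : ∃ R, ∀ ξ, R ≤ ‖ξ‖ → ‖Γ ξ‖ ≤ q / 27 := by
    have h1 := (tendsto_zero_iff_norm_tendsto_zero.1
      (tendsto_fourier_cocompact (fun x => (g x : ℂ) ^ 5 : Rd d → ℂ))).eventually_le_const
      (show 0 < q / 27 by positivity)
    rw [← Metric.cobounded_eq_cocompact, ← comap_norm_atTop, eventually_comap] at h1
    obtain ⟨R, hR⟩ := eventually_atTop.1 h1
    exact ⟨R, fun ξ hξ => hR _ hξ ξ rfl⟩
  obtain ⟨ρ, hρ⟩ : ∃ ρ, ∀ ξ, ρ ≤ ‖ξ‖ → p.hat β ξ = 0 := by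
    obtain ⟨ρ, hρ⟩ := hβ.isCompact.isBounded.exists_norm_le
    refine ⟨ρ + 1, fun ξ hξ => ?_⟩
    by_contra h
    have := hρ ξ (subset_tsupport _ h)
    linarith
  set e : Rd d := EuclideanSpace.single ⟨0, hd⟩ 1 with he
  have he1 : ‖e‖ = 1 := by simp [he]
  refine ⟨r, hr, q, hgq, 4 * ∫ ξ, ‖p.hat β ξ‖ ^ 2, by positivity, 2 ^ 9 * ∫ x, g x ^ 9, ?_,
    -- The bound `4r` puts `|ξ| ≤ r` inside the region where `h` has no Fourier mass, `2ρ` makes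
    -- both translates of `β` vanish on `|ξ| ≤ K/2`, and `R + r` makes the shifted copies of `Γ`
    -- small on `|ξ| ≤ r`.
    max (4 * r) (max (2 * ρ) (R + r)), le_max_left _ _, fun K hK => ?_⟩
  · exact mul_nonneg (by norm_num) (integral_nonneg fun x => pow_nonneg (hg0 x) _)
  have hK1 : 4 * r ≤ K := (le_max_left _ _).trans hK
  have hK2 : 2 * ρ ≤ K := (le_max_left _ _).trans ((le_max_right _ _).trans hK)
  have hK3 : R + r ≤ K := (le_max_right _ _).trans ((le_max_right _ _).trans hK)
  have hK0 : 0 < K := by linarith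
  set a : Rd d := K • e with ha
  have hshift : ∀ b : Rd d, ∃ k : CZero d, ∀ ξ, p.hat k ξ = p.hat β (ξ - b) := fun b => by
    have hc : HasCompactSupport fun ξ => p.hat β (ξ - b) :=
      hβ.comp_homeomorph (Homeomorph.subRight b)
    exact ⟨p.ofHat _ ((p.continuous_hat β).comp (by fun_prop)) (p.tendsto_of_hasCompactSupport hc),
      fun ξ => p.hat_ofHat _ _ ξ⟩
  obtain ⟨k₁, hk₁⟩ := hshift a
  obtain ⟨k₂, hk₂⟩ := hshift ((2 : ℝ) • a)
  have hhat : ∀ ξ, p.hat (k₁ + k₂) ξ = p.hat β (ξ - a) + p.hat β (ξ - (2 : ℝ) • a) := fun ξ => by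
    rw [ConvWeight.hat_add, hk₁, hk₂]
  have hev : ∀ x, p.ev (k₁ + k₂) x = (g x : ℂ) * ((Real.fourierChar (inner ℝ a x) : ℂ) +
      (Real.fourierChar (inner ℝ a x) : ℂ) ^ 2) := fun x => by
    have h1 := fourierChar_mul_inner_smul 2 1 a x
    rw [mul_one, one_smul] at h1
    push_cast at h1
    rw [← ConvWeight.evCLM_apply, map_add, ConvWeight.evCLM_apply, ConvWeight.evCLM_apply,
      p.ev_translate hk₁, p.ev_translate hk₂, hg, h1]
    ring
  have hevn : ∀ x, ‖p.ev (k₁ + k₂) x‖ ≤ 2 * g x := fun x => by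
    rw [hev, norm_mul, Complex.norm_real, Real.norm_of_nonneg (hg0 x), mul_comm]
    have : ‖(Real.fourierChar (inner ℝ a x) : ℂ) + (Real.fourierChar (inner ℝ a x) : ℂ) ^ 2‖ ≤ 2 := by
      refine (norm_add_le _ _).trans ?_
      rw [norm_pow, Circle.norm_coe]; norm_num
    have := hg0 x
    gcongr
  have hevi : Integrable (p.ev (k₁ + k₂)) := by
    have h1 := (hgi 1 le_rfl).const_mul 2
    simp only [pow_one] at h1
    exact h1.mono' (p.continuous_ev _).aestronglyMeasurable (ae_of_all _ hevn)
  have hev9 : ∀ x, ‖p.ev (k₁ + k₂) x‖ ^ 9 ≤ 2 ^ 9 * g x ^ 9 := fun x => by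
    rw [← mul_pow]; gcongr; exact hevn x
  have hi9 := (hgi 9 (by norm_num)).const_mul (2 ^ 9)
  refine ⟨k₁ + k₂, fun ξ hξ => ?_, ?_, hevi, ?_, ?_, fun ξ hξ => ?_⟩
  · have h1 := norm_smul_sub_ge he1 hξ hK0.le (le_refl 1)
    have h2 := norm_smul_sub_ge he1 hξ hK0.le (one_le_two)
    rw [one_smul] at h1
    rw [hhat, hρ _ (by linarith), hρ _ (by linarith), add_zero]
  · have hi := p.integrable_norm_hat_sq β
    have h1 : ∀ ξ, ‖p.hat (k₁ + k₂) ξ‖ ^ 2 ≤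
        2 * (‖p.hat β (ξ - a)‖ ^ 2 + ‖p.hat β (ξ - (2 : ℝ) • a)‖ ^ 2) := fun ξ => by
      rw [hhat]
      have h1 := norm_add_le (p.hat β (ξ - a)) (p.hat β (ξ - (2 : ℝ) • a))
      have h2 := norm_nonneg (p.hat β (ξ - a) + p.hat β (ξ - (2 : ℝ) • a))
      nlinarith [sq_nonneg (‖p.hat β (ξ - a)‖ - ‖p.hat β (ξ - (2 : ℝ) • a)‖)]
    refine (integral_mono (p.integrable_norm_hat_sq _) (((hi.comp_sub_right a).add
      (hi.comp_sub_right ((2 : ℝ) • a))).const_mul 2) h1).trans_eq ?_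
    simp only [Pi.add_apply]
    rw [integral_const_mul, integral_add (hi.comp_sub_right a) (hi.comp_sub_right _),
      integral_sub_right_eq_self (fun ξ => ‖p.hat β ξ‖ ^ 2),
      integral_sub_right_eq_self (fun ξ => ‖p.hat β ξ‖ ^ 2)]
    ring
  · refine hi9.mono' (((p.continuous_ev _).norm.pow 9).aestronglyMeasurable) (ae_of_all _ fun x => ?_)
    rw [Real.norm_of_nonneg (by positivity)]
    exact hev9 x
  · rw [← integral_const_mul]
    exact integral_mono_of_nonneg (ae_of_all _ fun x => by positivity) hi9 (ae_of_all _ hev9)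
  · have hQ : p.ev (p.quintic (k₁ + k₂)) = fun x => (g x : ℂ) ^ 5 *
        ((Real.fourierChar (inner ℝ a x) : ℂ)⁻¹ + 5 +
        10 * (Real.fourierChar (inner ℝ a x) : ℂ) + 10 * (Real.fourierChar (inner ℝ a x) : ℂ) ^ 2 +
        5 * (Real.fourierChar (inner ℝ a x) : ℂ) ^ 3 +
        (Real.fourierChar (inner ℝ a x) : ℂ) ^ 4) := by
      ext x
      rw [ConvWeight.ev_quintic, hev]
      exact ConvWeight.quintic_two_waves (hg0 x) (Circle.norm_coe _)
    have hQi : Integrable (p.ev (p.quintic (k₁ + k₂))) := by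
      have h1 := (hgi 5 (by norm_num)).const_mul (2 ^ 5)
      refine h1.mono' (p.continuous_ev _).aestronglyMeasurable (ae_of_all _ fun x => ?_)
      rw [ConvWeight.ev_quintic, norm_mul, norm_pow, Complex.norm_real, norm_norm, ← pow_succ,
        ← mul_pow]
      gcongr
      exact hevn x
    rw [p.hat_eq_fourier_ev hQi, hQ, fourier_quintic_two_waves hg5 a ξ]
    have b0 := hrΓ ξ hξ
    have low : ∀ b : Rd d, R ≤ ‖b‖ → -(q / 27) ≤ (Γ b).re := fun b hb => by
      have h1 := hR b hb
      have h2 := Complex.abs_re_le_norm (Γ b)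
      have h3 := neg_abs_le (Γ b).re
      linarith
    have c1 := low (ξ - a) (by
      have := norm_smul_sub_ge he1 hξ hK0.le (le_refl 1)
      rw [one_smul] at this
      linarith)
    have c2 := low (ξ - (2 : ℝ) • a) (by
      have := norm_smul_sub_ge he1 hξ hK0.le one_le_two
      linarith)
    have c3 := low (ξ - (3 : ℝ) • a) (by
      have := norm_smul_sub_ge he1 hξ hK0.le (show (1 : ℝ) ≤ 3 by norm_num)
      linarith)
    have c4 := low (ξ - (4 : ℝ) • a) (by
      have := norm_smul_sub_ge he1 hξ hK0.le (show (1 : ℝ) ≤ 4 by norm_num)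
      linarith)
    have c5 := low (ξ + a) (by
      have := norm_smul_sub_ge (e := e) (ξ := -ξ) (r := r) he1 (by rwa [norm_neg]) hK0.le (le_refl 1)
      rw [one_smul, ← neg_add', norm_neg] at this
      linarith)
    have e5 : ∀ z : ℂ, (5 * z).re = 5 * z.re := fun z => by simp
    have e10 : ∀ z : ℂ, (10 * z).re = 10 * z.re := fun z => by simp
    simp only [Complex.add_re, e5, e10]
    linarith

namespace ConvWeight

variable (p : ConvWeight d)

theorem quintic_smul {c : ℝ} (hc : 0 ≤ c) (h : CZero d) :
    p.quintic ((c : ℂ) • h) = ((c ^ 5 : ℝ) : ℂ) • p.quintic h := p.ev_injective fun x => by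
  have e : ∀ (c : ℂ) (h : CZero d), p.ev (c • h) x = c * p.ev h x := fun c h => by
    rw [← evCLM_apply, map_smul, evCLM_apply, smul_eq_mul]
  rw [ev_quintic, e, e, ev_quintic, norm_mul, Complex.norm_real, Real.norm_of_nonneg hc]
  push_cast; ring

theorem ev_smul (c : ℂ) (h : CZero d) (x : Rd d) : p.ev (c • h) x = c * p.ev h x := by
  rw [← evCLM_apply, map_smul, evCLM_apply, smul_eq_mul]

/-- The second order Taylor expansion of the dispersionless flow. -/
theorem norm_hat_flow_sub_le {μ L : ℝ} (hμ : |μ| = 1) {y : ℝ → CZero d} {h : CZero d}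
    (hev : ∀ τ x, p.ev (y τ) x = Complex.exp (Complex.I * ((μ * τ * ‖p.ev h x‖ ^ 4 : ℝ) : ℂ)) *
      p.ev h x) (hi : Integrable fun x => ‖p.ev h x‖ ^ 9) (ξ : Rd d) :
    ‖p.hat (y L) ξ - p.hat h ξ - Complex.I * μ * L * p.hat (p.quintic h) ξ‖ ≤
      L ^ 2 * ∫ x, ‖p.ev h x‖ ^ 9 := by
  set w : CZero d := y L - h - (Complex.I * μ * L) • p.quintic h with hw
  have hhat : p.hat w ξ = p.hat (y L) ξ - p.hat h ξ - Complex.I * μ * L * p.hat (p.quintic h) ξ := by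
    rw [hw, hat_sub, hat_sub, hat_smul]
  -- The phase is `θ = μ L |h|⁴`, and the quadratic remainder `θ²` times `|h|` gives the ninth
  -- power.
  have hevw : ∀ x, ‖p.ev w x‖ ≤ L ^ 2 * ‖p.ev h x‖ ^ 9 := fun x => by
    have e1 : p.ev w x = (Complex.exp (Complex.I * ((μ * L * ‖p.ev h x‖ ^ 4 : ℝ) : ℂ)) - 1 -
        Complex.I * ((μ * L * ‖p.ev h x‖ ^ 4 : ℝ) : ℂ)) * p.ev h x := by
      rw [← evCLM_apply, hw, map_sub, map_sub, map_smul, evCLM_apply, evCLM_apply, evCLM_apply,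
        hev, ev_quintic, smul_eq_mul]
      push_cast; ring
    rw [e1, norm_mul]
    have h1 := norm_exp_I_mul_sub_one_sub_le (μ * L * ‖p.ev h x‖ ^ 4)
    calc _ ≤ (μ * L * ‖p.ev h x‖ ^ 4) ^ 2 * ‖p.ev h x‖ := by gcongr
      _ = |μ| ^ 2 * L ^ 2 * ‖p.ev h x‖ ^ 9 := by rw [sq_abs]; ring
      _ = _ := by rw [hμ]; ring
  have hwi : Integrable (p.ev w) :=
    (hi.const_mul (L ^ 2)).mono' (p.continuous_ev _).aestronglyMeasurable (ae_of_all _ hevw)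
  rw [← hhat, p.hat_eq_fourier_ev hwi, ← integral_const_mul]
  refine (VectorFourier.norm_fourierIntegral_le_integral_norm _ _ _ _ _).trans ?_
  exact integral_mono hwi.norm (hi.const_mul _) hevw

end ConvWeight

/-- The two-wave profile with amplitude `c` is run for the time `L = η/c⁴` and tested against the
indicator of `|ξ| ≤ r`. The constants are fixed in the order `η`, `c`, `K`: first the first order
term dominates, then the output exceeds `R`, and finally the datum is small, since `s < 0` and all
other constants of the profile are independent of `K`. -/
theorem NormInflation.of_neg (hd : 0 < d) {s μ : ℝ} (hμ : |μ| = 1) (hs : s < d / 2 - 1)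
    (hs0 : s < 0) : NormInflation d s μ := by
  intro V hV hVc hVs κ hκ T hT R
  set p := profWeight d with hp
  obtain ⟨r, hr, q, hq, D, hD, N, hN, K₀, hK₀, hprof⟩ := exists_bump_profile hd p
  set S : Set (Rd d) := Metric.closedBall 0 r with hS
  have hSm : MeasurableSet S := Metric.isClosed_closedBall.measurableSet
  have hSf : volume S < ⊤ := measure_closedBall_lt_top
  set vol := (volume S).toReal with hvol
  have hvol0 : 0 < vol := ENNReal.toReal_pos (Metric.measure_closedBall_pos _ _ hr).ne' hSf.ne
  have hmem : ∀ ξ, ξ ∈ S → ‖ξ‖ ≤ r := fun ξ hξ => by simpa [hS] using hξ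
  set B := Real.sqrt ((1 + r ^ 2) ^ (-s) * vol) with hB
  have hB0 : 0 < B := Real.sqrt_pos.2 (mul_pos (Real.rpow_pos_of_pos (by positivity) _) hvol0)
  set G : Rd d → ℂ := S.indicator fun _ => 1 with hG
  have hGm : Measurable G := measurable_const.indicator hSm
  have hGb : ∀ ξ, ‖G ξ‖ ≤ 1 := fun ξ => by
    rw [hG]; by_cases h : ξ ∈ S <;> simp [h]
  have hGi : ∀ n : ℝ, (fun ξ => ((n ^ 2)⁻¹ + ‖ξ‖ ^ 2) ^ (-s) * ‖G ξ‖ ^ 2) =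
      S.indicator fun ξ => ((n ^ 2)⁻¹ + ‖ξ‖ ^ 2) ^ (-s) := fun n => by
    ext ξ; rw [hG]; by_cases h : ξ ∈ S <;> simp [h]
  have hGle : ∀ n : ℝ, 1 ≤ n → ∀ ξ ∈ S, ((n ^ 2)⁻¹ + ‖ξ‖ ^ 2) ^ (-s) ≤ (1 + r ^ 2) ^ (-s) :=
    fun n hn ξ hξ => by
      refine Real.rpow_le_rpow (by positivity) ?_ (by linarith)
      have h1 : (n ^ 2)⁻¹ ≤ 1 := inv_le_one_of_one_le₀ (one_le_pow₀ hn)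
      have h2 := hmem ξ hξ
      gcongr
  have hint : ∀ n : ℝ, 1 ≤ n → IntegrableOn (fun ξ : Rd d => ((n ^ 2)⁻¹ + ‖ξ‖ ^ 2) ^ (-s)) S :=
    fun n hn => by
      refine ContinuousOn.integrableOn_compact (isCompact_closedBall _ _) ?_
      refine ContinuousOn.rpow_const (by fun_prop) fun ξ _ => Or.inl ?_
      have : 0 < n := by linarith
      positivity
  -- At time `η/c⁴` the first order term is at least `c η q` and the remainder at most `c η² N`;
  -- this choice makes the remainder at most half of it.
  set η := q / (2 * (N + 1)) with hη
  have hη0 : 0 < η := by positivity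
  have hηN : η ^ 2 * N ≤ η * q / 2 := by
    have : η * N ≤ q / 2 := by
      rw [hη, div_mul_eq_mul_div, div_le_iff₀ (by positivity)]
      nlinarith
    nlinarith
  set c := 2 * (|R| + 1) * B / (vol * η * q) with hc
  have hc0 : 0 < c := by positivity
  have hcle : (R + 1) * B ≤ c * vol * (η * q / 2) := by
    have h1 : c * vol * (η * q / 2) = (|R| + 1) * B := by rw [hc]; field_simp
    rw [h1]
    have := le_abs_self R
    gcongr
  obtain ⟨K, hKK₀, hKκ⟩ : ∃ K ≥ max K₀ 1, (K / 2) ^ (2 * s) * (c ^ 2 * D) ≤ κ ^ 2 := by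
    have h1 : Tendsto (fun K : ℝ => (K / 2) ^ (-(2 * -s)) * (c ^ 2 * D)) atTop
        (𝓝 (0 * (c ^ 2 * D))) :=
      ((tendsto_rpow_neg_atTop (by linarith)).comp
        (tendsto_id.atTop_div_const two_pos)).mul_const _
    rw [zero_mul] at h1
    obtain ⟨K, h2, h3⟩ := ((eventually_ge_atTop (max K₀ 1)).and
      (h1.eventually_le_const (show 0 < κ ^ 2 by positivity))).exists
    exact ⟨K, h2, by simpa using h3⟩
  have hK1 : 1 ≤ K := (le_max_right _ _).trans hKK₀
  have hKK : K₀ ≤ K := (le_max_left _ _).trans hKK₀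
  obtain ⟨h, hh0, hhD, -, hh9, hhN, hhq⟩ := hprof K hKK
  obtain ⟨y, hy0, hy, hyev⟩ := p.exists_dispersionless_flow μ ((c : ℂ) • h)
  have hevc : ∀ x, ‖p.ev ((c : ℂ) • h) x‖ ^ 9 = c ^ 9 * ‖p.ev h x‖ ^ 9 := fun x => by
    rw [p.ev_smul, norm_mul, Complex.norm_real, Real.norm_of_nonneg hc0.le, mul_pow]
  set L := η / c ^ 4 with hL
  have hL0 : 0 < L := by positivity
  have hrem := fun ξ => p.norm_hat_flow_sub_le (L := L) hμ hyev
    (by simp only [hevc]; exact hh9.const_mul _) ξ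
  simp only [hevc] at hrem
  -- Multiplication by `-iμ` turns the first order term `iμL` times the quintic into one with
  -- positive real part. On `S` the initial profile vanishes.
  have hlow : ∀ ξ ∈ S, c * (η * q / 2) ≤ (-Complex.I * μ * p.hat (y L) ξ).re := fun ξ hξ => by
    have hξr := hmem ξ hξ
    have h1 := hrem ξ
    have h2 : p.hat ((c : ℂ) • h) ξ = 0 := by
      rw [ConvWeight.hat_smul, hh0 ξ (by linarith), mul_zero]
    rw [h2, sub_zero, integral_const_mul, p.quintic_smul hc0.le, ConvWeight.hat_smul] at h1
    have h3 : ‖-Complex.I * μ * (p.hat (y L) ξ - Complex.I * μ * L *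
        (((c ^ 5 : ℝ) : ℂ) * p.hat (p.quintic h) ξ))‖ ≤ L ^ 2 * (c ^ 9 * N) := by
      rw [norm_mul, neg_mul, norm_neg, ConvWeight.norm_I_mul hμ, one_mul]
      refine h1.trans ?_
      gcongr
    have hμ2 : (μ : ℂ) * μ = 1 := by
      have : μ * μ = 1 := by rw [← abs_mul_abs_self, hμ, one_mul]
      exact_mod_cast this
    have h4 : -Complex.I * μ * (p.hat (y L) ξ - Complex.I * μ * L *
        (((c ^ 5 : ℝ) : ℂ) * p.hat (p.quintic h) ξ)) = -Complex.I * μ * p.hat (y L) ξ -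
          ((L * c ^ 5 : ℝ) : ℂ) * p.hat (p.quintic h) ξ := by
      have : -Complex.I * μ * (Complex.I * μ * L * (((c ^ 5 : ℝ) : ℂ) * p.hat (p.quintic h) ξ)) =
          -(Complex.I * Complex.I) * (μ * μ) * (L * ((c ^ 5 : ℝ) : ℂ) * p.hat (p.quintic h) ξ) := by
        ring
      rw [mul_sub, this, hμ2, Complex.I_mul_I]
      push_cast; ring
    rw [h4] at h3
    have h5 := (Complex.abs_re_le_norm _).trans h3
    rw [Complex.sub_re, Complex.re_ofReal_mul] at h5
    have h6 := neg_le_of_abs_le h5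
    have h7 := mul_le_mul_of_nonneg_left (hhq ξ hξr) (show 0 ≤ L * c ^ 5 by positivity)
    have e1 : L * c ^ 5 = η * c := by rw [hL]; field_simp
    have e2 : L ^ 2 * (c ^ 9 * N) = c * (η ^ 2 * N) := by rw [hL]; field_simp
    rw [e2] at h6
    rw [e1] at h6 h7
    nlinarith
  refine exists_inflation_of_profile (G := G) (B := B) hμ hs hy hL0.le hGm hGb hκ.le hB0 ?_ ?_ ?_ ?_
    hV hVc hVs hT
  · intro n hn
    have hn0 : 0 < n := by linarith
    have hb : ∀ ξ, ((n ^ 2)⁻¹ + ‖ξ‖ ^ 2) ^ s * ‖p.hat (y 0) ξ‖ ^ 2 ≤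
        (K / 2) ^ (2 * s) * (c ^ 2 * ‖p.hat h ξ‖ ^ 2) := fun ξ => by
      rw [hy0, ConvWeight.hat_smul, norm_mul, Complex.norm_real, Real.norm_of_nonneg hc0.le, mul_pow]
      rcases le_total ‖ξ‖ (K / 2) with h1 | h1
      · rw [hh0 ξ h1]; simp
      · have : ((n ^ 2)⁻¹ + ‖ξ‖ ^ 2) ^ s ≤ (K / 2) ^ (2 * s) := by
          rw [Real.rpow_mul (by positivity), Real.rpow_two]
          refine Real.rpow_le_rpow_of_nonpos (by positivity) ?_ hs0.le
          have : (K / 2) ^ 2 ≤ ‖ξ‖ ^ 2 := by gcongr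
          have : 0 < (n ^ 2)⁻¹ := by positivity
          linarith
        gcongr
    refine (integral_mono_of_nonneg (ae_of_all _ fun ξ => by positivity)
      (((p.integrable_norm_hat_sq h).const_mul _).const_mul _) (ae_of_all _ hb)).trans ?_
    rw [integral_const_mul, integral_const_mul]
    refine le_trans ?_ hKκ
    gcongr
  · intro n hn
    rw [hGi]
    exact (hint n hn).integrable_indicator hSm
  · intro n hn
    rw [hGi, integral_indicator hSm, hB, Real.sq_sqrt (by positivity)]
    refine (setIntegral_mono_on (hint n hn) (integrableOn_const hSf.ne) hSm (hGle n hn)).trans_eq ?_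
    rw [setIntegral_const, smul_eq_mul, mul_comm]; rfl
  · have e1 : ∫ ξ, p.hat (y L) ξ * G ξ = ∫ ξ in S, p.hat (y L) ξ := by
      rw [← integral_indicator hSm]
      refine integral_congr_ae (ae_of_all _ fun ξ => ?_)
      rw [hG]; by_cases h : ξ ∈ S <;> simp [h]
    rw [e1]
    have hi : IntegrableOn (fun ξ => -Complex.I * μ * p.hat (y L) ξ) S :=
      ((p.integrable_hat (y L)).const_mul _).integrableOn
    have e2 : ‖∫ ξ in S, p.hat (y L) ξ‖ = ‖∫ ξ in S, -Complex.I * μ * p.hat (y L) ξ‖ := by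
      rw [integral_const_mul, norm_mul, neg_mul, norm_neg, ConvWeight.norm_I_mul hμ, one_mul]
    rw [e2]
    refine le_trans ?_ (Complex.re_le_norm _)
    have e3 : (∫ ξ in S, -Complex.I * μ * p.hat (y L) ξ).re =
        ∫ ξ in S, (-Complex.I * μ * p.hat (y L) ξ).re := (integral_re hi).symm
    rw [e3]
    refine hcle.trans ?_
    have h8 := setIntegral_mono_on (integrableOn_const (C := c * (η * q / 2)) hSf.ne) hi.re hSm hlow
    rw [setIntegral_const, smul_eq_mul] at h8
    calc _ = vol * (c * (η * q / 2)) := by ring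
      _ ≤ _ := h8

/-! ### The case `s > 0`: transfer to high frequencies -/

theorem norm_average_pow_le {w : ℂ} (hw : ‖w‖ = 1) (N : ℕ) :
    ‖(N : ℂ)⁻¹ * ∑ j ∈ Finset.range N, w ^ j‖ ≤ 1 := by
  rw [norm_mul, norm_inv, Complex.norm_natCast]
  rcases Nat.eq_zero_or_pos N with rfl | hN
  · simp
  rw [inv_mul_le_iff₀ (by exact_mod_cast hN), mul_one]
  refine (norm_sum_le _ _).trans ?_
  simp [hw]

theorem tendsto_average_pow {w : ℂ} (hw : ‖w‖ = 1) (hw1 : w ≠ 1) :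
    Tendsto (fun N : ℕ => (N : ℂ)⁻¹ * ∑ j ∈ Finset.range N, w ^ j) atTop (𝓝 0) := by
  have h1 : Tendsto (fun N : ℕ => (N : ℝ)⁻¹ * (2 / ‖w - 1‖)) atTop (𝓝 0) := by
    simpa using (tendsto_inv_atTop_nhds_zero_nat (𝕜 := ℝ)).mul_const (2 / ‖w - 1‖)
  refine squeeze_zero_norm (fun N => ?_) h1
  rw [norm_mul, norm_inv, Complex.norm_natCast]
  gcongr
  rw [geom_sum_eq hw1, norm_div]
  gcongr
  refine (norm_sub_le _ _).trans ?_
  rw [norm_pow, hw]; norm_num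

/-- The time averages of the energy of an oscillating integral tend to zero, if the phase has no
level sets of positive measure. -/
theorem tendsto_average_norm_sq {X : Type*} [MeasurableSpace X] {ν : Measure X} [SFinite ν]
    {a : X → ℂ} (ha : Integrable a ν) {w : X → ℂ} (hw : Measurable w) (hw1 : ∀ x, ‖w x‖ = 1)
    (hne : ∀ x, ∀ᵐ y ∂ν, w x * star (w y) ≠ 1) :
    Tendsto (fun N : ℕ => (N : ℝ)⁻¹ * ∑ j ∈ Finset.range N, ‖∫ x, w x ^ j * a x ∂ν‖ ^ 2) atTop
      (𝓝 0) := by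
  have hwa : ∀ j : ℕ, Integrable (fun x => w x ^ j * a x) ν := fun j =>
    ha.bdd_mul (c := 1) (hw.pow_const j).aestronglyMeasurable
      (ae_of_all _ fun x => by simp [hw1])
  have hA : Integrable (fun z : X × X => a z.1 * star (a z.2)) (ν.prod ν) :=
    ha.mul_prod ((Complex.conjCLE : ℂ →L[ℝ] ℂ).integrable_comp ha)
  set W : X × X → ℂ := fun z => w z.1 * star (w z.2) with hW
  have hWm : Measurable W := (hw.comp measurable_fst).mul
    (continuous_star.measurable.comp (hw.comp measurable_snd))
  have hW1 : ∀ z, ‖W z‖ = 1 := fun z => by simp [hW, hw1]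
  -- Each squared modulus is a double integral, in which the `j`-th power falls on `W(x, y) = w(x)
  -- conj(w(y))`. The averages of `W^j` are bounded by 1 and tend to zero where `W ≠ 1`, and Fubini
  -- makes the remaining set null.
  have key : ∀ N : ℕ, (((N : ℝ)⁻¹ * ∑ j ∈ Finset.range N, ‖∫ x, w x ^ j * a x ∂ν‖ ^ 2 : ℝ) : ℂ) =
      ∫ z, ((N : ℂ)⁻¹ * ∑ j ∈ Finset.range N, W z ^ j) * (a z.1 * star (a z.2)) ∂(ν.prod ν) := by
    intro N
    have h1 : ∀ j : ℕ, ((‖∫ x, w x ^ j * a x ∂ν‖ ^ 2 : ℝ) : ℂ) =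
        ∫ z, W z ^ j * (a z.1 * star (a z.2)) ∂(ν.prod ν) := fun j => by
      rw [← Complex.normSq_eq_norm_sq, ← Complex.mul_conj, ← integral_conj, ← integral_prod_mul]
      refine integral_congr_ae (ae_of_all _ fun z => ?_)
      simp only [hW, map_mul, map_pow, mul_pow, Complex.star_def]
      ring
    have h2 : ∀ j : ℕ, Integrable (fun z => W z ^ j * (a z.1 * star (a z.2))) (ν.prod ν) :=
      fun j => hA.bdd_mul (c := 1) (hWm.pow_const j).aestronglyMeasurable
        (ae_of_all _ fun x => by simp [hW1])
    push_cast
    simp only [mul_assoc, Finset.sum_mul]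
    rw [integral_const_mul, integral_finsetSum _ fun j _ => h2 j]
    congr 1
    refine Finset.sum_congr rfl fun j _ => ?_
    rw [← h1]; push_cast; rfl
  have hae : ∀ᵐ z ∂(ν.prod ν), W z ≠ 1 := by
    have hm : MeasurableSet {z : X × X | W z ≠ 1} := (hWm (measurableSet_singleton 1)).compl
    exact (Measure.ae_prod_iff_ae_ae hm).2 (ae_of_all _ hne)
  have hlim : Tendsto (fun N : ℕ => ∫ z, ((N : ℂ)⁻¹ * ∑ j ∈ Finset.range N, W z ^ j) *
      (a z.1 * star (a z.2)) ∂(ν.prod ν)) atTop (𝓝 (∫ z, (0 : ℂ) ∂(ν.prod ν))) := by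
    refine tendsto_integral_of_dominated_convergence (fun z => ‖a z.1 * star (a z.2)‖)
      (fun N => ?_) hA.norm (fun N => ae_of_all _ fun z => ?_) ?_
    · refine AEStronglyMeasurable.mul ?_ hA.1
      exact (measurable_const.mul (Finset.measurable_sum _ fun j _ =>
        hWm.pow_const j)).aestronglyMeasurable
    · rw [norm_mul]
      exact mul_le_of_le_one_left (norm_nonneg _) (norm_average_pow_le (hW1 z) N)
    · filter_upwards [hae] with z hz
      simpa using (tendsto_average_pow (hW1 z) hz).mul_const (a z.1 * star (a z.2))
  simp only [← key, integral_zero] at hlim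
  have := (Complex.continuous_re.tendsto 0).comp hlim
  simpa only [Function.comp_def, Complex.ofReal_re, Complex.zero_re] using this

/-- The energy of an oscillating integral leaves every ball of the frequency space. -/
theorem exists_setIntegral_fourier_lt {a : Rd d → ℂ} (ha : Integrable a) {w : Rd d → ℂ}
    (hw : Measurable w) (hw1 : ∀ x, ‖w x‖ = 1) (hne : ∀ x, ∀ᵐ y, w x * star (w y) ≠ 1)
    {S : Set (Rd d)} (hSf : volume S < ⊤) {δ : ℝ} (hδ : 0 < δ)
    (hc : ∀ j : ℕ, Continuous (𝓕 (fun x => w x ^ j * a x : Rd d → ℂ))) :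
    ∃ j : ℕ, ∫ ξ in S, ‖𝓕 (fun x => w x ^ j * a x : Rd d → ℂ) ξ‖ ^ 2 < δ := by
  set F : ℕ → Rd d → ℂ := fun j => 𝓕 (fun x => w x ^ j * a x : Rd d → ℂ) with hF
  have hFb : ∀ j ξ, ‖F j ξ‖ ≤ ∫ x, ‖a x‖ := fun j ξ => by
    refine (VectorFourier.norm_fourierIntegral_le_integral_norm _ _ _ _ _).trans_eq ?_
    refine integral_congr_ae (ae_of_all _ fun x => ?_)
    simp [hw1]
  have : IsFiniteMeasure (volume.restrict S) := ⟨by rwa [Measure.restrict_apply_univ]⟩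
  have hFi : ∀ j, Integrable (fun ξ => ‖F j ξ‖ ^ 2) (volume.restrict S) := fun j =>
    Integrable.of_bound (C := (∫ x, ‖a x‖) ^ 2) ((hc j).norm.pow 2).aestronglyMeasurable
      (ae_of_all _ fun ξ => by
        rw [Real.norm_of_nonneg (by positivity)]
        have := hFb j ξ
        gcongr)
  have hpt : ∀ ξ, Tendsto (fun N : ℕ => (N : ℝ)⁻¹ * ∑ j ∈ Finset.range N, ‖F j ξ‖ ^ 2) atTop
      (𝓝 0) := fun ξ => by
    have hχ : Integrable fun x => Real.fourierChar (-inner ℝ x ξ) • a x :=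
      (Real.fourierIntegral_convergent_iff ξ).2 ha
    have h1 := tendsto_average_norm_sq hχ hw hw1 hne
    refine h1.congr fun N => ?_
    congr 1
    refine Finset.sum_congr rfl fun j _ => ?_
    rw [hF]
    simp only [Real.fourier_eq]
    congr 2
    refine integral_congr_ae (ae_of_all _ fun x => ?_)
    simp only [Circle.smul_def, smul_eq_mul]
    ring
  have hlim : Tendsto (fun N : ℕ => ∫ ξ in S, (N : ℝ)⁻¹ * ∑ j ∈ Finset.range N, ‖F j ξ‖ ^ 2) atTop
      (𝓝 (∫ ξ in S, (0 : ℝ))) := by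
    refine tendsto_integral_of_dominated_convergence (fun _ => (∫ x, ‖a x‖) ^ 2) (fun N => ?_)
      (integrable_const _) (fun N => ae_of_all _ fun ξ => ?_) (ae_of_all _ hpt)
    · exact (continuous_const.mul (continuous_finsetSum _ fun j _ =>
        (hc j).norm.pow 2)).aestronglyMeasurable
    · rw [Real.norm_of_nonneg (by positivity)]
      rcases Nat.eq_zero_or_pos N with rfl | hN
      · simp; positivity
      rw [inv_mul_le_iff₀ (by exact_mod_cast hN)]
      refine (Finset.sum_le_card_nsmul _ _ ((∫ x, ‖a x‖) ^ 2) fun j _ => ?_).trans_eq (by simp)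
      have := hFb j ξ
      gcongr
  -- If every term were at least `δ`, so would be all their averages, which tend to zero.
  by_contra! hcon
  rw [integral_zero] at hlim
  obtain ⟨N, hN1, hN2⟩ := ((eventually_ge_atTop 1).and (hlim.eventually_lt_const hδ)).exists
  rw [integral_const_mul, integral_finsetSum _ fun j _ => hFi j] at hN2
  have h3 : (N : ℝ) * δ ≤ ∑ j ∈ Finset.range N, ∫ ξ in S, ‖F j ξ‖ ^ 2 := by
    have := Finset.card_nsmul_le_sum (Finset.range N) (fun j => ∫ ξ in S, ‖F j ξ‖ ^ 2) δ
      fun j _ => hcon j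
    simpa using this
  have hN0 : (0 : ℝ) < N := by exact_mod_cast hN1
  rw [inv_mul_lt_iff₀ hN0] at hN2
  linarith

/-- The Gaussian `exp (-π |x|²)`. -/
def gauss (x : Rd d) : ℝ := Real.exp (-Real.pi * ‖x‖ ^ 2)

theorem gauss_pos (x : Rd d) : 0 < gauss x := Real.exp_pos _

theorem gauss_le_one (x : Rd d) : gauss x ≤ 1 :=
  Real.exp_le_one_iff.2 (by have := Real.pi_pos; nlinarith [sq_nonneg ‖x‖])

theorem continuous_gauss : Continuous (gauss : Rd d → ℝ) := by unfold gauss; fun_prop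

theorem norm_eq_of_gauss_eq {x y : Rd d} (h : gauss x = gauss y) : ‖x‖ = ‖y‖ := by
  have h1 := Real.exp_injective h
  have h2 : ‖x‖ ^ 2 = ‖y‖ ^ 2 := mul_left_cancel₀ (neg_ne_zero.2 Real.pi_ne_zero) h1
  exact (pow_left_inj₀ (norm_nonneg _) (norm_nonneg _) two_ne_zero).1 h2

theorem fourierInv_gauss (x : Rd d) : 𝓕⁻ (fun ξ => (gauss ξ : ℂ) : Rd d → ℂ) x = gauss x := by
  have h := fourier_gaussian_innerProductSpace (V := Rd d) (b := Real.pi)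
    (by simpa using Real.pi_pos) (-x)
  have e : (fun ξ => (gauss ξ : ℂ) : Rd d → ℂ) =
      fun v => Complex.exp (-(Real.pi : ℂ) * (‖v‖ : ℂ) ^ 2) := by
    ext v; simp [gauss]
  have hπ : (Real.pi : ℂ) ≠ 0 := by exact_mod_cast Real.pi_ne_zero
  rw [Real.fourierInv_eq_fourier_neg, e, h, div_self hπ, Complex.one_cpow, one_mul, norm_neg, gauss]
  push_cast
  congr 1
  field_simp

theorem exists_gauss : ∃ h : CZero d, ∀ ξ, (profWeight d).hat h ξ = gauss ξ := by
  have h0 : Tendsto (fun ξ : Rd d => ((profWeight d).toFun ξ : ℂ)⁻¹ * (gauss ξ : ℂ)) (cocompact _)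
      (𝓝 0) := by
    have h1 : Tendsto (fun ξ : Rd d => Real.exp 2 *
        ((1 + ‖ξ‖) ^ (d + 5) * Real.exp (-(1 + ‖ξ‖)))) (cocompact _) (𝓝 (Real.exp 2 * 0)) :=
      ((Real.tendsto_pow_mul_exp_neg_atTop_nhds_zero (d + 5)).comp
        (tendsto_atTop_add_const_left _ 1 tendsto_norm_cocompact_atTop)).const_mul _
    rw [mul_zero] at h1
    refine squeeze_zero_norm (fun ξ => ?_) h1
    rw [norm_mul, norm_inv, Complex.norm_real, Complex.norm_real, Real.norm_of_nonneg (gauss_pos ξ).le,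
      Real.norm_of_nonneg ((profWeight d).pos ξ).le, profWeight_toFun, inv_inv, mul_left_comm,
      ← Real.exp_add, gauss]
    gcongr
    have := Real.pi_gt_three
    nlinarith [sq_nonneg (‖ξ‖ - 1), sq_nonneg ‖ξ‖]
  exact ⟨(profWeight d).ofHat _ (Complex.continuous_ofReal.comp continuous_gauss) h0,
    fun ξ => (profWeight d).hat_ofHat _ _ ξ⟩

/-- A small multiple of the Gaussian is run for an integer time `j` at which at least half of its
conserved mass lies outside `|ξ| ≤ A`. As `s > 0`, that mass alone has a large `H^s` norm when `A`
is large. -/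
theorem NormInflation.of_pos (hd : 0 < d) {s μ : ℝ} (hμ : |μ| = 1) (hs : s < d / 2 - 1)
    (hs0 : 0 < s) : NormInflation d s μ := by
  intro V hV hVc hVs κ hκ T hT R
  have : Nonempty (Fin d) := ⟨⟨0, hd⟩⟩
  set p := profWeight d with hp
  obtain ⟨h, hh⟩ : ∃ h : CZero d, ∀ ξ, p.hat h ξ = gauss ξ := exists_gauss
  have hhat : p.hat h = fun ξ => (gauss ξ : ℂ) := funext hh
  have hev : ∀ x, p.ev h x = gauss x := fun x => by
    rw [ConvWeight.ev, hhat, fourierInv_gauss]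
  have hgi : Integrable fun x : Rd d => (gauss x : ℂ) := hhat ▸ p.integrable_hat h
  have hg2 : Integrable fun x : Rd d => gauss x ^ 2 := by
    have := p.integrable_norm_hat_sq h
    simp only [hh, Complex.norm_real, Real.norm_of_nonneg (gauss_pos _).le] at this
    exact this
  set m₀ := ∫ x : Rd d, gauss x ^ 2 with hm₀
  have hm₀0 : 0 < m₀ := by
    rw [hm₀, integral_pos_iff_support_of_nonneg (fun x => by positivity) hg2]
    have : Function.support (fun x : Rd d => gauss x ^ 2) = univ := by
      ext x; simpa using (gauss_pos x).ne'
    rw [this]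
    simp
  have hSi : Integrable fun ξ : Rd d => (1 + ‖ξ‖ ^ 2) ^ s * gauss ξ ^ 2 := by
    have hsi : MemFourierHs s (p.hat h) := p.memFourierHs_hat (by linarith) h
    have := (memLp_two_iff_integrable_sq_norm hsi.1).1 hsi
    refine this.congr (ae_of_all _ fun ξ => ?_)
    simp only [hh]
    rw [norm_mul, Complex.norm_real, Complex.norm_real, Real.norm_of_nonneg (gauss_pos _).le,
      Real.norm_of_nonneg (bracket_pos _ _).le, mul_pow, bracket_sq]
  set S := ∫ ξ : Rd d, (1 + ‖ξ‖ ^ 2) ^ s * gauss ξ ^ 2 with hS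
  have hS0 : 0 ≤ S := integral_nonneg fun ξ => by positivity
  -- Besides making the datum small, `c ≤ 1` keeps the differences of the phases below `2π`, so that
  -- equal exponentials mean equal phases.
  obtain ⟨c, hc0, hc1, hcκ⟩ : ∃ c > 0, c ≤ 1 ∧ c ^ 2 * S ≤ κ ^ 2 := by
    refine ⟨min 1 (κ / Real.sqrt (S + 1)), by positivity, min_le_left _ _, ?_⟩
    have h1 : (min 1 (κ / Real.sqrt (S + 1))) ^ 2 ≤ (κ / Real.sqrt (S + 1)) ^ 2 := by
      gcongr; exact min_le_right _ _
    rw [div_pow, Real.sq_sqrt (by positivity)] at h1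
    calc _ ≤ κ ^ 2 / (S + 1) * S := by gcongr
      _ ≤ κ ^ 2 / (S + 1) * (S + 1) := by gcongr; linarith
      _ = κ ^ 2 := by field_simp
  set m := c ^ 2 * m₀ with hm
  have hm0 : 0 < m := by positivity
  -- A mass of at least `m/2` beyond radius `A` has an `H^s` size of at least `A^s √(m/2)`, hence at
  -- least `|R| + 1`.
  obtain ⟨A, hA1, hA⟩ : ∃ A ≥ (1 : ℝ), (|R| + 1) * A ^ (-s) ≤ Real.sqrt (m / 2) := by
    have h1 := (tendsto_rpow_neg_atTop hs0).const_mul (|R| + 1)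
    rw [mul_zero] at h1
    exact ((eventually_ge_atTop 1).and
      (h1.eventually_le_const (show 0 < Real.sqrt (m / 2) by positivity))).exists
  have hA0 : 0 < A := by linarith
  obtain ⟨y, hy0, hy, hyev⟩ := p.exists_dispersionless_flow μ ((c : ℂ) • h)
  have hevc : ∀ x, p.ev ((c : ℂ) • h) x = ((c * gauss x : ℝ) : ℂ) := fun x => by
    rw [p.ev_smul, hev]; push_cast; ring
  set φ : Rd d → ℝ := fun x => μ * (c * gauss x) ^ 4 with hφ
  set w : Rd d → ℂ := fun x => Complex.exp (Complex.I * (φ x : ℂ)) with hw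
  have hφc : Continuous φ := by have := continuous_gauss (d := d); fun_prop
  have hwm : Continuous w := by fun_prop
  have hw1 : ∀ x, ‖w x‖ = 1 := fun x => norm_phase _
  have hyw : ∀ j : ℕ, p.ev (y j) = fun x => w x ^ j * ((c * gauss x : ℝ) : ℂ) := fun j => by
    ext x
    have e1 : ‖((c * gauss x : ℝ) : ℂ)‖ = c * gauss x := by
      rw [Complex.norm_real, Real.norm_of_nonneg (mul_pos hc0 (gauss_pos x)).le]
    rw [hyev, hevc, e1, hw, ← Complex.exp_nat_mul]
    congr 2
    rw [hφ]; push_cast; ring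
  have hai : Integrable fun x : Rd d => ((c * gauss x : ℝ) : ℂ) := by
    push_cast; exact hgi.const_mul _
  have hyi : ∀ j : ℕ, Integrable (p.ev (y j)) := fun j => by
    rw [hyw]
    exact hai.bdd_mul (c := 1) (hwm.pow j).aestronglyMeasurable (ae_of_all _ fun x => by simp [hw1])
  have hyhat : ∀ j : ℕ, p.hat (y j) =
      𝓕 (fun x => w x ^ j * ((c * gauss x : ℝ) : ℂ) : Rd d → ℂ) := fun j => by
    rw [p.hat_eq_fourier_ev (hyi j), hyw]
  -- Equal phases force equal values of the Gaussian, hence `|x| = |y|`, and spheres are null sets.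
  have hne : ∀ x, ∀ᵐ y, w x * star (w y) ≠ 1 := fun x => by
    have hnull : volume (Metric.sphere (0 : Rd d) ‖x‖) = 0 := Measure.addHaar_sphere _ _ _
    refine measure_mono_null (fun y hy => ?_) hnull
    simp only [ne_eq, mem_compl_iff, mem_ofPred_eq, not_not] at hy
    have e1 : w x * star (w y) = Complex.exp (Complex.I * ((φ x - φ y : ℝ) : ℂ)) := by
      rw [hw, Complex.star_def, ← Complex.exp_conj, ← Complex.exp_add, map_mul, Complex.conj_I,
        Complex.conj_ofReal]
      push_cast; ring_nf
    rw [e1, Complex.exp_eq_one_iff] at hy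
    obtain ⟨k, hk⟩ := hy
    have h2 : φ x - φ y = k * (2 * Real.pi) := by
      have : ((φ x - φ y : ℝ) : ℂ) = ((k * (2 * Real.pi) : ℝ) : ℂ) := by
        refine mul_left_cancel₀ Complex.I_ne_zero ?_
        rw [hk]; push_cast; ring
      exact_mod_cast this
    have hb : ∀ z : Rd d, 0 ≤ (c * gauss z) ^ 4 ∧ (c * gauss z) ^ 4 ≤ 1 := fun z => by
      have h3 := gauss_pos z
      have h4 := gauss_le_one z
      exact ⟨by positivity, pow_le_one₀ (by positivity) (by nlinarith)⟩
    have h5 : φ x - φ y = μ * ((c * gauss x) ^ 4 - (c * gauss y) ^ 4) := by rw [hφ]; ring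
    have h6 : |φ x - φ y| ≤ 1 := by
      rw [h5, abs_mul, hμ, one_mul, abs_le]
      have := hb x
      have := hb y
      constructor <;> linarith
    have hk0 : k = 0 := by
      by_contra hk0
      have h7 : (1 : ℝ) ≤ |(k : ℝ)| := by exact_mod_cast Int.one_le_abs hk0
      rw [h2, abs_mul, abs_of_pos Real.two_pi_pos] at h6
      nlinarith [Real.pi_gt_three]
    rw [hk0, h5] at h2
    have hμ0 : μ ≠ 0 := by rintro rfl; simp at hμ
    have h8 : (c * gauss x) ^ 4 = (c * gauss y) ^ 4 := by
      have : (c * gauss x) ^ 4 - (c * gauss y) ^ 4 = 0 := by simpa [hμ0] using h2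
      linarith
    have h9 := (pow_left_inj₀ (mul_pos hc0 (gauss_pos x)).le (mul_pos hc0 (gauss_pos y)).le
      four_ne_zero).1 h8
    rw [mem_sphere_zero_iff_norm]
    exact (norm_eq_of_gauss_eq (mul_left_cancel₀ hc0.ne' h9)).symm
  obtain ⟨j, hj⟩ := exists_setIntegral_fourier_lt hai hwm.measurable hw1 hne
    (measure_closedBall_lt_top (x := (0 : Rd d)) (r := A)) (half_pos hm0)
    (fun j => by rw [← hyhat]; exact p.continuous_hat _)
  rw [← hyhat] at hj
  have hmass : ∫ ξ, ‖p.hat (y j) ξ‖ ^ 2 = m := by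
    rw [p.integral_norm_hat_sq_eq (k := (c : ℂ) • h), hm, hm₀, ← integral_const_mul]
    · refine integral_congr_ae (ae_of_all _ fun ξ => ?_)
      simp only
      rw [ConvWeight.hat_smul, hh, norm_mul, Complex.norm_real, Complex.norm_real,
        Real.norm_of_nonneg (gauss_pos ξ).le, Real.norm_of_nonneg hc0.le, mul_pow]
    · intro x
      rw [hyev, norm_mul, norm_phase, one_mul]
  set U : Set (Rd d) := (Metric.closedBall 0 A)ᶜ with hU
  have hUm : MeasurableSet U := Metric.isClosed_closedBall.measurableSet.compl
  have hUA : ∀ ξ ∈ U, A ≤ ‖ξ‖ := fun ξ hξ => by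
    simp only [hU, mem_compl_iff, Metric.mem_closedBall, dist_zero_right, not_le] at hξ
    exact hξ.le
  set I := ∫ ξ in U, ‖p.hat (y j) ξ‖ ^ 2 with hI
  have hyj := p.integrable_norm_hat_sq (y j)
  have hIm : m / 2 ≤ I := by
    have := integral_add_compl (Metric.isClosed_closedBall (x := (0 : Rd d)) (ε := A)).measurableSet
      hyj
    rw [hmass] at this
    linarith
  have hI0 : 0 < I := by linarith
  have hB0 : 0 < A ^ (-s) * Real.sqrt I :=
    mul_pos (Real.rpow_pos_of_pos hA0 _) (Real.sqrt_pos.2 hI0)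
  -- Pairing with the conjugate of the solution beyond radius `A` gives `I`, while the dual norm is
  -- at most `A^(-s) √I`; the quotient is `A^s √I`.
  set G : Rd d → ℂ := U.indicator fun ξ => star (p.hat (y j) ξ) with hG
  have hGn : ∀ ξ, ‖G ξ‖ ^ 2 = U.indicator (fun ξ => ‖p.hat (y j) ξ‖ ^ 2) ξ := fun ξ => by
    rw [hG]; by_cases h : ξ ∈ U <;> simp [h]
  have hUi : Integrable (U.indicator fun ξ => ‖p.hat (y j) ξ‖ ^ 2) := hyj.indicator hUm
  have hGle : ∀ n : ℝ, 1 ≤ n → ∀ ξ, ((n ^ 2)⁻¹ + ‖ξ‖ ^ 2) ^ (-s) * ‖G ξ‖ ^ 2 ≤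
      (A ^ (-s)) ^ 2 * U.indicator (fun ξ => ‖p.hat (y j) ξ‖ ^ 2) ξ := fun n hn ξ => by
    rw [hGn]
    by_cases h : ξ ∈ U
    · have h1 := hUA ξ h
      have h2 : ((n ^ 2)⁻¹ + ‖ξ‖ ^ 2) ^ (-s) ≤ (A ^ (-s)) ^ 2 := by
        rw [← Real.rpow_mul_natCast hA0.le, mul_comm, Real.rpow_mul hA0.le]
        refine Real.rpow_le_rpow_of_nonpos (by positivity) ?_ (by linarith)
        have h3 : A ^ 2 ≤ ‖ξ‖ ^ 2 := by gcongr
        have h4 : 0 ≤ (n ^ 2)⁻¹ := by positivity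
        push_cast
        rw [Real.rpow_two]
        linarith
      rw [indicator_of_mem h]
      gcongr
    · simp [h]
  have hGm : Measurable G := ((p.continuous_hat (y j)).star.measurable).indicator hUm
  have hGi : ∀ n : ℝ, 1 ≤ n →
      Integrable fun ξ => ((n ^ 2)⁻¹ + ‖ξ‖ ^ 2) ^ (-s) * ‖G ξ‖ ^ 2 := fun n hn => by
    refine (hUi.const_mul ((A ^ (-s)) ^ 2)).mono' ?_ (ae_of_all _ fun ξ => ?_)
    · refine AEStronglyMeasurable.mul (Continuous.aestronglyMeasurable ?_)
        (hGm.norm.pow_const 2).aestronglyMeasurable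
      refine Continuous.rpow_const (by fun_prop) fun ξ => Or.inl ?_
      have : 0 < n := by linarith
      positivity
    · rw [Real.norm_of_nonneg (by positivity)]
      exact hGle n hn ξ
  refine exists_inflation_of_profile (G := G) (B := A ^ (-s) * Real.sqrt I)
    (b := p.bound * ‖y j‖) (L := j) hμ hs hy (Nat.cast_nonneg j) hGm (fun ξ => ?_) hκ.le hB0
    (fun n hn => ?_) hGi (fun n hn => ?_) ?_ hV hVc hVs hT
  · have h1 := p.norm_hat_le (y j) ξ
    have h2 := p.le_bound ξ
    have h3 := p.bound_nonneg
    rw [hG]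
    by_cases h : ξ ∈ U
    · rw [indicator_of_mem h, norm_star]
      exact h1.trans (by gcongr)
    · rw [indicator_of_notMem h, norm_zero]
      positivity
  · have hb : ∀ ξ, ((n ^ 2)⁻¹ + ‖ξ‖ ^ 2) ^ s * ‖p.hat (y 0) ξ‖ ^ 2 ≤
        c ^ 2 * ((1 + ‖ξ‖ ^ 2) ^ s * gauss ξ ^ 2) := fun ξ => by
      rw [hy0, ConvWeight.hat_smul, norm_mul, hh, Complex.norm_real, Complex.norm_real,
        Real.norm_of_nonneg hc0.le, Real.norm_of_nonneg (gauss_pos ξ).le, mul_pow]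
      have h1 : (n ^ 2)⁻¹ ≤ 1 := inv_le_one_of_one_le₀ (one_le_pow₀ hn)
      have h2 : ((n ^ 2)⁻¹ + ‖ξ‖ ^ 2) ^ s ≤ (1 + ‖ξ‖ ^ 2) ^ s :=
        Real.rpow_le_rpow (by positivity) (by linarith) hs0.le
      calc _ ≤ (1 + ‖ξ‖ ^ 2) ^ s * (c ^ 2 * gauss ξ ^ 2) := by gcongr
        _ = _ := by ring
    refine (integral_mono_of_nonneg (ae_of_all _ fun ξ => by positivity) (hSi.const_mul _)
      (ae_of_all _ hb)).trans ?_
    rw [integral_const_mul]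
    exact hcκ
  · refine (integral_mono (hGi n hn) (hUi.const_mul _) (hGle n hn)).trans_eq ?_
    rw [integral_const_mul, integral_indicator hUm, mul_pow, Real.sq_sqrt hI0.le]
  · have e1 : ∫ ξ, p.hat (y j) ξ * G ξ = (I : ℂ) := by
      rw [hI, ← integral_indicator hUm, ← integral_complex_ofReal]
      refine integral_congr_ae (ae_of_all _ fun ξ => ?_)
      simp only [hG]
      by_cases h : ξ ∈ U
      · rw [indicator_of_mem h, indicator_of_mem h, Complex.star_def, Complex.mul_conj,
          Complex.normSq_eq_norm_sq]
      · simp [h]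
    rw [e1, Complex.norm_real, Real.norm_of_nonneg hI0.le]
    have h1 : Real.sqrt (m / 2) ≤ Real.sqrt I := Real.sqrt_le_sqrt hIm
    have h2 : R + 1 ≤ |R| + 1 := by linarith [le_abs_self R]
    calc (R + 1) * (A ^ (-s) * Real.sqrt I) ≤ (|R| + 1) * (A ^ (-s) * Real.sqrt I) := by gcongr
      _ = (|R| + 1) * A ^ (-s) * Real.sqrt I := by ring
      _ ≤ Real.sqrt I * Real.sqrt I := by
        have := hA.trans h1
        gcongr
      _ = I := Real.mul_self_sqrt hI0.le

/-! ### The critical case `d = 1`, `s = -1/2` -/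

namespace ConvWeight

variable (p : ConvWeight d)

theorem mul_comm (h k : CZero d) : p.mul h k = p.mul k h := p.ev_injective fun x => by
  rw [ev_mul, ev_mul, _root_.mul_comm]

/-- A perturbation that interacts weakly with everything has a small effect on the nonlinearity. -/
theorem norm_quintic_add_sub_le {f g : CZero d} {A κ : ℝ} (hA : ‖g‖ ≤ A) (hA' : ‖f + g‖ ≤ A)
    (hκ : 0 ≤ κ) (h1 : ∀ k, ‖p.mul f k‖ ≤ κ * ‖k‖) (h2 : ∀ k, ‖p.mul (conjRefl f) k‖ ≤ κ * ‖k‖) :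
    ‖p.quintic (f + g) - p.quintic g‖ ≤ 5 * κ * p.const ^ 3 * A ^ 4 := by
  have hA0 : 0 ≤ A := (norm_nonneg _).trans hA
  have hC := p.const_nonneg
  -- Exchange of one factor `w' = w - e`: the difference is `(X - X') w + e X'`, and only the new
  -- term involves the weak interaction. Five exchanges give the constant 5.
  have step : ∀ {X X' w w' e : CZero d} {a b : ℝ}, w = e + w' → ‖w‖ ≤ A → ‖X - X'‖ ≤ a →
      ‖X'‖ ≤ b → (∀ k, ‖p.mul e k‖ ≤ κ * ‖k‖) →
      ‖p.mul X w - p.mul X' w'‖ ≤ p.const * a * A + κ * b := by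
    intro X X' w w' e a b hw hwA ha hb he
    have e1 : p.mul X w - p.mul X' w' = p.mul (X - X') w + p.mul e X' := by
      rw [p.mul_comm e X', hw]
      simp only [map_sub, map_add, sub_apply]
      abel
    rw [e1]
    refine (norm_add_le _ _).trans (add_le_add (p.norm_mul_le_of_le ha hwA) ((he X').trans ?_))
    gcongr
  have c1 : conjRefl (f + g) = conjRefl f + conjRefl g := map_add _ _ _
  have n1 : ‖conjRefl (f + g)‖ ≤ A := by rwa [LinearIsometry.norm_map]
  have n2 : ‖conjRefl g‖ ≤ A := by rwa [LinearIsometry.norm_map]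
  have a1 : ‖(f + g) - g‖ ≤ ‖f‖ := by rw [add_sub_cancel_right]
  have s1 : ‖p.mul (f + g) (conjRefl (f + g)) - p.mul g (conjRefl g)‖ ≤ 2 * κ * A := by
    have e1 : p.mul (f + g) (conjRefl (f + g)) - p.mul g (conjRefl g) =
        p.mul f (conjRefl (f + g)) + p.mul (conjRefl f) g := by
      rw [p.mul_comm (conjRefl f) g, c1]
      simp only [map_add, add_apply]
      abel
    rw [e1]
    refine (norm_add_le _ _).trans ((add_le_add (h1 _) (h2 _)).trans ?_)
    have := mul_le_mul_of_nonneg_left n1 hκ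
    have := mul_le_mul_of_nonneg_left hA hκ
    linarith
  have m1 := p.norm_mul_le_of_le hA n2
  have s2 := step rfl hA' s1 m1 h1
  have m2 := p.norm_mul_le_of_le m1 hA
  have s3 := step c1 n1 s2 m2 h2
  have m3 := p.norm_mul_le_of_le m2 n2
  have s4 := step rfl hA' s3 m3 h1
  refine s4.trans_eq ?_
  ring

end ConvWeight

/-- Functions at unit scale interact weakly. -/
theorem norm_mul_scaleWeight_le {n c : ℝ} (hn : 1 ≤ n) (hc : 0 < c) (hc1 : c ≤ 1) {f : CZero d}
    {B : ℝ} (hB : 0 ≤ B) (hf : ∀ ξ, ‖(scaleWeight d n c hn hc hc1).hat f ξ‖ ≤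
      B * polyWeight d (d + 1 + (d + 1)) 1 ξ) (k : CZero d) :
    ‖(scaleWeight d n c hn hc hc1).mul f k‖ ≤ B * scaleConst d * ‖k‖ := by
  have hn0 : 0 < n := by linarith
  set p := scaleWeight d n c hn hc hc1 with hp
  set ψ : Rd d → ℝ := polyWeight d (d + 1) n with hψ
  set ρ : Rd d → ℝ := polyWeight d (d + 1 + (d + 1)) 1 with hρ
  set σ : Rd d → ℝ := fun η => ((1 + ‖η‖) ^ (d + 1))⁻¹ with hσ
  have iρ : Integrable ρ := integrable_polyWeight (by omega) one_pos
  have iσ : Integrable σ := integrable_inv_one_add_norm_pow (by omega)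
  have pψ : ∀ η, 0 < ψ η := polyWeight_pos hn0
  have pρ : ∀ η, 0 < ρ η := polyWeight_pos one_pos
  have hC := scaleConst_nonneg d
  refine p.norm_le_of_norm_hat_le (by positivity) fun ξ => ?_
  rw [ConvWeight.hat_mul, ConvWeight.fconv]
  -- Here `f` is bounded by `ρ` alone, without the coefficient `c`. Products of `ρ` with `ψ` are
  -- absorbed by `ψ` and those with `c ρ` by `c ρ`, so no factor `1/c` is lost, in contrast to the
  -- bound through the norm of `f`.
  have hb : ∀ η, ‖p.hat f η * p.hat k (ξ - η)‖ ≤ B * ‖k‖ * (ψ ξ * σ η +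
      c * (2 ^ (d + 1 + (d + 1)) * ρ ξ) * (ρ η + ρ (ξ - η))) := fun η => by
    rw [norm_mul]
    have h1 := p.norm_hat_le k (ξ - η)
    have h2 := polyWeight_mul_one_le (k := d + 1) (l := d + 1) hn ξ η
    have h3 := mul_le_mul_of_nonneg_left
      (polyWeight_mul_le (k := d + 1 + (d + 1)) one_pos ξ η) hc.le
    have h4 : p.toFun (ξ - η) = ψ (ξ - η) + c * ρ (ξ - η) := rfl
    rw [h4] at h1
    simp only [← hψ, ← hρ] at h2 h3
    calc ‖p.hat f η‖ * ‖p.hat k (ξ - η)‖ ≤ (B * ρ η) * ((ψ (ξ - η) + c * ρ (ξ - η)) * ‖k‖) :=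
          mul_le_mul (hf η) h1 (norm_nonneg _) (mul_nonneg hB (pρ η).le)
      _ = B * ‖k‖ * (ψ (ξ - η) * ρ η + c * (ρ η * ρ (ξ - η))) := by ring
      _ ≤ _ := by
        refine mul_le_mul_of_nonneg_left ?_ (by positivity)
        simp only [hσ]
        linarith
  have i1 := iσ.const_mul (ψ ξ)
  have i2 := (iρ.add (iρ.comp_sub_left ξ)).const_mul (c * (2 ^ (d + 1 + (d + 1)) * ρ ξ))
  refine (norm_integral_le_of_norm_le ((i1.add i2).const_mul (B * ‖k‖)) (ae_of_all _ hb)).trans ?_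
  have e : ∫ η, B * ‖k‖ * ((fun x => ψ ξ * σ x) + fun x => c * (2 ^ (d + 1 + (d + 1)) * ρ ξ) *
      (ρ + fun t => ρ (ξ - t)) x) η = B * ‖k‖ * (ψ ξ * polyMass d (d + 1) +
        c * (2 ^ (d + 1 + (d + 1)) * ρ ξ) * (2 * polyMass d (d + 1 + (d + 1)))) := by
    have e' := integral_add iρ (iρ.comp_sub_left ξ)
    rw [integral_sub_left_eq_self, integral_polyWeight one_pos] at e'
    have e'' := integral_add i1 i2
    rw [integral_const_mul, integral_const_mul] at e''
    simp only [Pi.add_apply] at e'' ⊢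
    have e3 : ∫ η, σ η = polyMass d (d + 1) := rfl
    rw [integral_const_mul, e'', e', e3]
    ring
  rw [e]
  have m0 := polyMass_nonneg d (d + 1)
  have m1 := polyMass_anti (d := d) (k := d + 1) (l := d + 1 + (d + 1)) (by omega) (by omega)
  have e2 : (2 : ℝ) ^ (d + 1 + (d + 1)) * 2 = 2 ^ (2 * d + 3) := by
    rw [← pow_succ]; congr 1; omega
  have e3 : p.toFun ξ = ψ ξ + c * ρ ξ := rfl
  have m2 := polyMass_nonneg d (d + 1 + (d + 1))
  have hψξ := (pψ ξ).le
  have hρξ := (pρ ξ).le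
  rw [e3]
  calc _ = B * ‖k‖ * (1 * (ψ ξ * polyMass d (d + 1)) +
        2 ^ (2 * d + 3) * (c * ρ ξ * polyMass d (d + 1 + (d + 1)))) := by rw [← e2]; ring
    _ ≤ B * ‖k‖ * ((2 ^ (2 * d + 3) + 2) * (ψ ξ * polyMass d (d + 1)) +
        (2 ^ (2 * d + 3) + 2) * (c * ρ ξ * polyMass d (d + 1))) := by
      have : (1 : ℝ) ≤ 2 ^ (2 * d + 3) + 2 := by
        have : (0 : ℝ) ≤ 2 ^ (2 * d + 3) := by positivity
        linarith
      have : (2 : ℝ) ^ (2 * d + 3) ≤ 2 ^ (2 * d + 3) + 2 := by linarith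
      gcongr
    _ = _ := by rw [scaleConst]; ring

theorem not_integrable_sobolev_weight :
    ¬ Integrable fun ξ : Rd 1 => (1 + ‖ξ‖ ^ 2) ^ (-(1 / 2) : ℝ) := by
  intro h
  have h1 := (integrable_fun_norm_addHaar (volume : Measure (Rd 1))
    (f := fun y : ℝ => (1 + y ^ 2) ^ (-(1 / 2) : ℝ))).1 h
  simp only [finrank_euclideanSpace, Fintype.card_fin, Nat.sub_self, pow_zero, one_smul] at h1
  have h2 := h1.mono_set (Ioi_subset_Ioi (zero_le_one (α := ℝ)))
  refine not_integrableOn_Ioi_inv (a := 1) ?_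
  refine (h2.const_mul 2).mono' (measurable_inv.aestronglyMeasurable) ?_
  filter_upwards [ae_restrict_mem measurableSet_Ioi] with y hy
  have hy1 : (1 : ℝ) < y := hy
  have hy0 : 0 < y := by linarith
  rw [Real.norm_of_nonneg (by positivity), Real.rpow_neg (by positivity), ← Real.sqrt_eq_rpow,
    ← div_eq_mul_inv, inv_eq_one_div, div_le_div_iff₀ hy0 (Real.sqrt_pos.2 (by positivity)), one_mul]
  rw [Real.sqrt_le_left (by positivity)]
  nlinarith

/-- The integrals increase with the radius; a finite limit would make the weight integrable, which
it is not, as it decays like `1/|ξ|` on the line. This logarithmic divergence drives the inflation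
at the endpoint. -/
theorem tendsto_integral_sobolev_weight : Tendsto (fun R : ℝ =>
    ∫ ξ in Metric.closedBall (0 : Rd 1) R, (1 + ‖ξ‖ ^ 2) ^ (-(1 / 2) : ℝ)) atTop atTop := by
  set f : Rd 1 → ℝ := fun ξ => (1 + ‖ξ‖ ^ 2) ^ (-(1 / 2) : ℝ) with hf
  have hfc : Continuous f := Continuous.rpow_const (by fun_prop) fun ξ => Or.inl (by positivity)
  have hfi : ∀ R, IntegrableOn f (Metric.closedBall 0 R) := fun R =>
    hfc.continuousOn.integrableOn_compact (isCompact_closedBall _ _)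
  have hf0 : ∀ ξ, 0 ≤ f ξ := fun ξ => by positivity
  have hmono : Monotone fun R : ℝ => ∫ ξ in Metric.closedBall (0 : Rd 1) R, f ξ :=
    fun a b hab => setIntegral_mono_set (hfi b) (ae_of_all _ hf0)
      (Metric.closedBall_subset_closedBall hab).eventuallyLE
  rcases tendsto_atTop_of_monotone hmono with h | ⟨l, hl⟩
  · exact h
  · exfalso
    refine not_integrable_sobolev_weight ?_
    exact (aecover_closedBall tendsto_id).integrable_of_integral_tendsto_of_nonneg_ae l
      (fun R => hfi R) (ae_of_all _ hf0) hl

theorem hasDerivAt_add_smul {E : Type*} [NormedAddCommGroup E] [NormedSpace ℂ E] [NormedSpace ℝ E]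
    [IsScalarTower ℝ ℂ E] (x w : E) (t : ℝ) : HasDerivAt (fun t : ℝ => x + (t : ℂ) • w) w t := by
  have h := ((hasDerivAt_id (t : ℂ)).comp_ofReal.smul_const w).const_add x
  simpa using h

theorem ConvWeight.norm_hat_propagator (p : ConvWeight d) (t : ℝ) (h : CZero d) (ξ : Rd d) :
    ‖p.hat (propagator t h) ξ‖ = ‖p.hat h ξ‖ := by
  rw [ConvWeight.hat, ConvWeight.hat, propagator_apply, norm_mul, norm_mul, norm_mul, norm_phase,
    one_mul]

theorem ConvWeight.norm_field_sub_eq (p : ConvWeight d) {μ : ℝ} (hμ : |μ| = 1) (ν t : ℝ)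
    (x y : CZero d) : ‖p.field μ ν t x - p.field μ ν t y‖ =
      ‖p.quintic (propagator (ν * t) x) - p.quintic (propagator (ν * t) y)‖ := by
  have e : p.field μ ν t x - p.field μ ν t y = (Complex.I * (μ : ℂ)) • propagator (-(ν * t))
      (p.quintic (propagator (ν * t) x) - p.quintic (propagator (ν * t) y)) := by
    rw [map_sub, ConvWeight.field, ConvWeight.field]
    ext x; simp [mul_sub]
  rw [e, norm_smul, ConvWeight.norm_I_mul hμ, one_mul, LinearIsometry.norm_map]

theorem inv_pos_le_one {n : ℝ} (hn : 1 ≤ n) : 0 < n⁻¹ ∧ n⁻¹ ≤ 1 :=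
  ⟨inv_pos.2 (by linarith), inv_le_one_of_one_le₀ hn⟩

/-- The weight at frequency scale `n` for the scale-critical problem. -/
def criticalWeight (d : ℕ) (n : ℝ) (hn : 1 ≤ n) : ConvWeight d :=
  scaleWeight d n n⁻¹ hn (inv_pos_le_one hn).1 (inv_pos_le_one hn).2

theorem le_criticalWeight {n : ℝ} (hn : 1 ≤ n) (ξ : Rd d) :
    polyWeight d (d + 1) n ξ ≤ (criticalWeight d n hn).toFun ξ :=
  polyWeight_le_scaleWeight hn _ _ ξ

set_option maxHeartbeats 1000000 in
/-- The first order expansion of solutions with scale-critical data at frequency scale `n`. -/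
theorem exists_solution_first_order {μ : ℝ} (hμ : |μ| = 1) (h : CZero d) {V : Rd d → ℂ}
    (hVc : Continuous V) (hVs : HasCompactSupport V) : ∃ τ₀ > 0, ∃ E₁ ≥ 0, ∃ E₂ ≥ 0,
    ∀ τ, 0 ≤ τ → τ ≤ τ₀ → ∀ (n : ℝ) (hn : 1 ≤ n), ∃ z : ℝ → CZero d,
      z 0 = (n⁻¹ : ℂ) • (criticalWeight d n hn).ofHat V hVc
          ((criticalWeight d n hn).tendsto_of_hasCompactSupport hVs) +
        (criticalWeight d n hn).dilate n (zero_lt_one.trans_le hn) (le_criticalWeight hn) h ∧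
      (∀ t ∈ Icc 0 τ,
        HasDerivWithinAt z ((criticalWeight d n hn).field μ (n ^ 4)⁻¹ t (z t)) (Icc 0 τ) t) ∧
      ‖z τ - (z 0 + (τ : ℂ) • (Complex.I * (μ : ℂ)) •
        (criticalWeight d n hn).dilate n (zero_lt_one.trans_le hn) (le_criticalWeight hn)
          ((profWeight d).quintic h))‖ ≤ τ * (τ * E₁ + E₂ / n) := by
  obtain ⟨D, hD, hVD⟩ := exists_le_polyWeight hVc hVs (d + 1 + (d + 1))
  have hC := scaleConst_nonneg d
  have hC1 := (profWeight d).const_nonneg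
  set C := scaleConst d with hCdef
  set H := ‖h‖ with hH
  have hH0 : 0 ≤ H := norm_nonneg h
  set A := D + H + 1 with hA
  have hA0 : 0 < A := by positivity
  set K := 5 * C ^ 4 * (2 * A) ^ 4 with hK
  set X := Real.exp (2 * K) with hX
  have hX0 : 0 < X := Real.exp_pos _
  -- `F₁` collects the effects of order `τ`, namely the dispersion acting on `g` and the
  -- displacement `t • w` of the approximate solution; `F₂ / n` is the effect of the background `f`.
  set F₁ := (2 * Real.pi) ^ 4 * (((profWeight d).const ^ 4 + 5 * C ^ 4) * H ^ 5) +
    5 * C ^ 4 * A ^ 4 * (C ^ 4 * H ^ 5) with hF₁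
  set F₂ := 5 * (D * C) * C ^ 3 * A ^ 4 with hF₂
  have hF₁0 : 0 ≤ F₁ := by positivity
  have hF₂0 : 0 ≤ F₂ := by positivity
  -- The second bound keeps `‖t • w‖ ≤ 1`, so that the approximate solution stays in the ball of
  -- radius `A`; the third is the smallness condition for shadowing.
  refine ⟨min 1 (min (C ^ 4 * H ^ 5 + 1)⁻¹ (A / ((F₁ + F₂) * X + 1))), by positivity, F₁ * X,
    by positivity, F₂ * X, by positivity, fun τ hτ0 hτ n hn => ?_⟩
  have hτ1 : τ ≤ 1 := hτ.trans (min_le_left _ _)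
  have hτ2 : τ ≤ (C ^ 4 * H ^ 5 + 1)⁻¹ := hτ.trans ((min_le_right _ _).trans (min_le_left _ _))
  have hτ3 : τ ≤ A / ((F₁ + F₂) * X + 1) := hτ.trans ((min_le_right _ _).trans (min_le_right _ _))
  have hn0 : 0 < n := by linarith
  set p := criticalWeight d n hn with hp
  have hpC : p.const = C := rfl
  have hle : ∀ ξ, polyWeight d (d + 1) n ξ ≤ p.toFun ξ := le_criticalWeight hn
  have h0 := p.tendsto_of_hasCompactSupport hVs
  set f : CZero d := (n⁻¹ : ℂ) • p.ofHat V hVc h0 with hf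
  set g : CZero d := p.dilate n hn0 hle h with hg
  have hfhat : ∀ ξ, ‖p.hat f ξ‖ ≤ D / n * polyWeight d (d + 1 + (d + 1)) 1 ξ := fun ξ => by
    rw [hf, ConvWeight.hat_smul, p.hat_ofHat, norm_mul, norm_inv, Complex.norm_real,
      Real.norm_of_nonneg hn0.le]
    calc _ ≤ n⁻¹ * (D * polyWeight d (d + 1 + (d + 1)) 1 ξ) := by gcongr; exact hVD ξ
      _ = _ := by ring
  -- The background is bounded but not small in this norm: its factor `n⁻¹` is offset by the
  -- coefficient `n⁻¹` of the weight at unit scale. It is negligible only through its weak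
  -- interaction.
  have hfn : ‖f‖ ≤ D := by
    have := norm_ofHat_scaleWeight_le hn (inv_pos_le_one hn).1 (inv_pos_le_one hn).2 hVc h0 hD hVD
    rw [hf, norm_smul, norm_inv, Complex.norm_real, Real.norm_of_nonneg hn0.le]
    calc _ ≤ n⁻¹ * (D / n⁻¹) := by gcongr; exact this
      _ = D := by field_simp
  have hgn : ‖g‖ ≤ H := p.norm_dilate_apply_le hn0 hle h
  have hfg : ‖f + g‖ ≤ A := (norm_add_le _ _).trans (by rw [hA]; linarith)
  have hgA : ‖g‖ ≤ A := hgn.trans (by rw [hA]; linarith)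
  set w : CZero d := (Complex.I * (μ : ℂ)) • p.dilate n hn0 hle ((profWeight d).quintic h) with hw
  have hwg : w = (Complex.I * (μ : ℂ)) • p.quintic g := by rw [hw, p.dilate_quintic hn0 hle]
  have hwn : ‖w‖ ≤ C ^ 4 * H ^ 5 := by
    rw [hwg, norm_smul, ConvWeight.norm_I_mul hμ, one_mul]
    exact p.norm_quintic_le hgn
  have hyA : ∀ t ∈ Icc 0 τ, ‖f + g + (t : ℂ) • w‖ ≤ A := fun t ht => by
    have h1 : ‖(t : ℂ) • w‖ ≤ 1 := by
      rw [norm_smul, Complex.norm_real, Real.norm_of_nonneg ht.1]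
      calc t * ‖w‖ ≤ (C ^ 4 * H ^ 5 + 1)⁻¹ * (C ^ 4 * H ^ 5 + 1) :=
            mul_le_mul (ht.2.trans hτ2) (by linarith) (norm_nonneg _) (by positivity)
        _ = 1 := inv_mul_cancel₀ (by positivity)
    have h2 := norm_add_le (f + g) ((t : ℂ) • w)
    have h3 := norm_add_le f g
    rw [hA]; linarith
  have herr : ∀ t ∈ Icc 0 τ, ‖w - p.field μ (n ^ 4)⁻¹ t (f + g + (t : ℂ) • w)‖ ≤
      τ * F₁ + F₂ / n := fun t ht => by
    have a1 : ‖w - p.field μ (n ^ 4)⁻¹ t g‖ ≤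
        τ * ((2 * Real.pi) ^ 4 * (((profWeight d).const ^ 4 + 5 * C ^ 4) * H ^ 5)) := by
      rw [hwg]
      refine (p.norm_quintic_sub_field_le hn0 hle hμ (by positivity) ht.1 ht.2 le_rfl).trans_eq ?_
      rw [hpC, ← hH]
      field_simp
    have a2 : ‖p.field μ (n ^ 4)⁻¹ t (f + g) - p.field μ (n ^ 4)⁻¹ t g‖ ≤ F₂ / n := by
      rw [p.norm_field_sub_eq hμ, map_add]
      have hS : ∀ ξ, ‖p.hat (propagator ((n ^ 4)⁻¹ * t) f) ξ‖ ≤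
          D / n * polyWeight d (d + 1 + (d + 1)) 1 ξ := fun ξ => by
        rw [p.norm_hat_propagator]; exact hfhat ξ
      refine (p.norm_quintic_add_sub_le (A := A) (κ := D / n * C) (by rwa [LinearIsometry.norm_map])
        (by rwa [← map_add, LinearIsometry.norm_map]) (by positivity)
        (norm_mul_scaleWeight_le hn _ _ (by positivity) hS)
        (norm_mul_scaleWeight_le hn _ _ (by positivity) fun ξ => ?_)).trans_eq ?_
      · have e1 : ‖p.hat (conjRefl (propagator ((n ^ 4)⁻¹ * t) f)) ξ‖ =
            ‖p.hat (propagator ((n ^ 4)⁻¹ * t) f) (-ξ)‖ := by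
          rw [ConvWeight.hat_conjRefl, norm_star]
        refine (le_of_eq e1).trans ((hS (-ξ)).trans_eq ?_)
        rw [polyWeight_neg]
      · rw [hpC, hF₂]; ring
    have a3 : ‖p.field μ (n ^ 4)⁻¹ t (f + g) - p.field μ (n ^ 4)⁻¹ t (f + g + (t : ℂ) • w)‖ ≤
        τ * (5 * C ^ 4 * A ^ 4 * (C ^ 4 * H ^ 5)) := by
      refine (p.norm_field_sub_le hμ _ _ hfg (hyA t ht)).trans ?_
      rw [hpC, sub_add_cancel_left, norm_neg, norm_smul, Complex.norm_real,
        Real.norm_of_nonneg ht.1]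
      calc _ ≤ 5 * C ^ 4 * A ^ 4 * (τ * (C ^ 4 * H ^ 5)) := by
            have := ht.2
            gcongr
        _ = _ := by ring
    have e1 : w - p.field μ (n ^ 4)⁻¹ t (f + g + (t : ℂ) • w) =
        (w - p.field μ (n ^ 4)⁻¹ t g) -
        (p.field μ (n ^ 4)⁻¹ t (f + g) - p.field μ (n ^ 4)⁻¹ t g) +
        (p.field μ (n ^ 4)⁻¹ t (f + g) - p.field μ (n ^ 4)⁻¹ t (f + g + (t : ℂ) • w)) := by abel
    rw [e1]
    refine (norm_add_le _ _).trans ((add_le_add (norm_sub_le _ _) le_rfl).trans ?_)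
    rw [hF₁]
    linarith
  have hexp : Real.exp (2 * K * τ) ≤ X := by
    rw [hX]
    have : 0 ≤ 2 * K := by positivity
    exact Real.exp_le_exp.2 (by nlinarith)
  have hder : ∀ t ∈ Icc 0 τ, HasDerivWithinAt (fun t : ℝ => f + g + (t : ℂ) • w) w (Icc 0 τ) t := by
    clear_value f g w
    intro t _
    exact (hasDerivAt_add_smul (f + g) w t).hasDerivWithinAt
  have hF₂n : F₂ / n ≤ F₂ := div_le_self hF₂0 hn
  obtain ⟨z, hz0, hz, hzy⟩ := exists_solution_near (F := p.field μ (n ^ 4)⁻¹) (τ := τ) (A := A)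
    (K := K) (e := τ * F₁ + F₂ / n) (e₀ := 0) hτ0 hA0.le (by positivity) (by positivity) le_rfl
    (p.continuous_field μ _)
    (fun t x y hx hy => by
      have := p.norm_field_sub_le hμ (n ^ 4)⁻¹ t hx hy
      rwa [hpC] at this)
    (fun t => p.field_zero _ _ t) (y := fun t => f + g + (t : ℂ) • w) (y' := fun _ => w)
    hder hyA herr (x₀ := f + g)
    (by simp) (by
      rw [zero_add]
      calc (τ * F₁ + F₂ / n) * τ * Real.exp (2 * K * τ) ≤ (1 * F₁ + F₂) * τ * X := by gcongr
        _ ≤ ((F₁ + F₂) * X + 1) * τ := by nlinarith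
        _ ≤ ((F₁ + F₂) * X + 1) * (A / ((F₁ + F₂) * X + 1)) := by gcongr
        _ = A := by field_simp)
  refine ⟨z, hz0, hz, ?_⟩
  rw [hz0]
  refine (hzy τ ⟨hτ0, le_rfl⟩).trans ?_
  rw [zero_add]
  calc (τ * F₁ + F₂ / n) * τ * Real.exp (2 * K * τ) ≤ (τ * F₁ + F₂ / n) * τ * X := by gcongr
    _ = _ := by ring

/-- Turns an error in the weighted norm into a pointwise error of order `1/n`, the same order as the
dilated nonlinearity in dimension one. The choice `n⁻¹` of the unit scale coefficient serves this
purpose. -/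
theorem criticalWeight_one_le {n : ℝ} (hn : 1 ≤ n) (ξ : Rd 1) :
    (criticalWeight 1 n hn).toFun ξ ≤ 2 / n := by
  have hn0 : 0 < n := by linarith
  have h1 : ∀ k, ((1 + ‖ξ‖ / n) ^ k)⁻¹ ≤ 1 := fun k =>
    inv_le_one_of_one_le₀ (one_le_pow₀ (by have : 0 ≤ ‖ξ‖ / n := by positivity
                                           linarith))
  have h2 : ∀ k, ((1 + ‖ξ‖) ^ k)⁻¹ ≤ 1 := fun k =>
    inv_le_one_of_one_le₀ (one_le_pow₀ (by have := norm_nonneg ξ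
                                           linarith))
  have hn1 : 0 ≤ n⁻¹ := by positivity
  rw [criticalWeight, scaleWeight_toFun, polyWeight_one, polyWeight, pow_one]
  calc _ ≤ n⁻¹ * 1 + n⁻¹ * 1 := by
        gcongr
        · exact h1 _
        · exact h2 _
    _ = 2 / n := by ring

/-- An element of `H^(-1/2)(ℝ)` whose Fourier transform is not small on a long interval. -/
theorem le_norm_ofFourier_sq {V : Rd 1 → ℂ} (hV : MemFourierHs (-(1 / 2)) V) {a b δ : ℝ}
    (hab : a ≤ b) (hδ : 0 ≤ δ) (h : ∀ ξ, a < ‖ξ‖ → ‖ξ‖ ≤ b → δ ≤ ‖V ξ‖) :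
    δ ^ 2 * ((∫ ξ in Metric.closedBall (0 : Rd 1) b, (1 + ‖ξ‖ ^ 2) ^ (-(1 / 2) : ℝ)) -
      ∫ ξ in Metric.closedBall (0 : Rd 1) a, (1 + ‖ξ‖ ^ 2) ^ (-(1 / 2) : ℝ)) ≤
    ‖Hs.ofFourier (-(1 / 2)) V hV‖ ^ 2 := by
  have hfc : Continuous fun ξ : Rd 1 => (1 + ‖ξ‖ ^ 2) ^ (-(1 / 2) : ℝ) :=
    Continuous.rpow_const (by fun_prop) fun ξ => Or.inl (by positivity)
  have hfi : ∀ R, IntegrableOn (fun ξ : Rd 1 => (1 + ‖ξ‖ ^ 2) ^ (-(1 / 2) : ℝ))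
      (Metric.closedBall 0 R) := fun R =>
    hfc.continuousOn.integrableOn_compact (isCompact_closedBall _ _)
  have hVi : Integrable fun ξ : Rd 1 => (1 + ‖ξ‖ ^ 2) ^ (-(1 / 2) : ℝ) * ‖V ξ‖ ^ 2 := by
    refine ((memLp_two_iff_integrable_sq_norm hV.1).1 hV).congr (ae_of_all _ fun ξ => ?_)
    simp only
    rw [norm_mul, Complex.norm_real, Real.norm_of_nonneg (bracket_pos _ ξ).le, mul_pow, bracket_sq]
  have hm : MeasurableSet (Metric.closedBall (0 : Rd 1) b \ Metric.closedBall 0 a) :=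
    Metric.isClosed_closedBall.measurableSet.diff Metric.isClosed_closedBall.measurableSet
  rw [← setIntegral_sdiff Metric.isClosed_closedBall.measurableSet (hfi b)
    (Metric.closedBall_subset_closedBall hab), ← integral_const_mul, Hs.norm_ofFourier_sq]
  refine le_trans ?_ (setIntegral_le_integral (s := Metric.closedBall (0 : Rd 1) b \
    Metric.closedBall 0 a) hVi (ae_of_all _ fun ξ => by positivity))
  refine setIntegral_mono_on (((hfi b).mono_set sdiff_subset).const_mul _) hVi.integrableOn hm
    fun ξ hξ => ?_
  have h1 : ‖ξ‖ ≤ b := by simpa using hξ.1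
  have h2 : a < ‖ξ‖ := by simpa using hξ.2
  have := h ξ h2 h1
  rw [mul_comm]
  gcongr

/-- The waves have a fixed separation `K`, and a small amplitude `c` makes the datum small. At the
fixed time `τ` the first order term gives a Fourier transform of size at least `δ/n` for `R₀ < |ξ| ≤
r n`, which the amplitude `M = n` raises to `δ`. The squared `H^(-1/2)` norm is then at least `δ²`
times an integral that diverges with `n`. -/
theorem NormInflation.critical {μ : ℝ} (hμ : |μ| = 1) : NormInflation 1 (-(1 / 2)) μ := by
  intro V hV hVc hVs κ hκ T hT R
  have hs : (-(1 / 2) : ℝ) < ((1 : ℕ) : ℝ) / 2 + 1 := by norm_num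
  set P := profWeight 1 with hP
  obtain ⟨r, hr, q, hq, D, hD, N, hN, K₀, hK₀, hprof⟩ := exists_bump_profile one_pos P
  set K := max K₀ 1 with hK
  have hK1 : 1 ≤ K := le_max_right _ _
  have hKr : 4 * r ≤ K := hK₀.trans (le_max_left _ _)
  obtain ⟨h, hh0, hhD, -, -, -, hhq⟩ := hprof K (le_max_left _ _)
  set B := (K / 2) ^ (2 * (-(1 / 2)) : ℝ) with hB
  have hB0 : 0 ≤ B := by positivity
  set c := κ / Real.sqrt (B * D + 1) with hc
  have hBD : 0 < Real.sqrt (B * D + 1) := Real.sqrt_pos.2 (by positivity)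
  have hc0 : 0 < c := by positivity
  have hcκ : B * (c ^ 2 * D) ≤ κ ^ 2 := by
    have h1 : c ^ 2 * (B * D + 1) = κ ^ 2 := by
      rw [hc, div_pow, Real.sq_sqrt (by positivity), div_mul_cancel₀ _ (by positivity)]
    nlinarith [sq_nonneg c]
  set k : CZero 1 := (c : ℂ) • h with hk
  obtain ⟨τ₀, hτ₀, E₁, hE₁, E₂, hE₂, hsol⟩ := exists_solution_first_order hμ k hVc hVs
  set Q := c ^ 5 * q with hQ
  have hQ0 : 0 < Q := by positivity
  -- Small enough that the part of the error quadratic in `τ` takes at most a quarter of the first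
  -- order term; the part with `E₂ / n` takes another quarter once `n` is large.
  set τ := min τ₀ (Q / (8 * (E₁ + 1))) with hτ
  have hτ0 : 0 < τ := by positivity
  have hτE : 2 * (τ * E₁) ≤ Q / 4 := by
    have h1 : τ * (8 * (E₁ + 1)) ≤ Q := by
      rw [← le_div_iff₀ (by positivity)]; exact min_le_right _ _
    nlinarith
  obtain ⟨R₀, hR₀⟩ : ∃ R₀, ∀ ξ : Rd 1, R₀ < ‖ξ‖ → V ξ = 0 := by
    obtain ⟨R₀, h1⟩ := hVs.isCompact.isBounded.subset_closedBall 0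
    refine ⟨R₀, fun ξ hξ => image_eq_zero_of_notMem_tsupport fun h2 => ?_⟩
    have := h1 h2
    rw [mem_closedBall_zero_iff] at this
    linarith
  set δ := τ * Q / 2 with hδ
  have hδ0 : 0 < δ := by positivity
  obtain ⟨n, ⟨⟨⟨hn, hnR⟩, hnE⟩, hnT⟩, hnI⟩ := ((((eventually_ge_atTop (1 : ℝ)).and
    ((tendsto_id.const_mul_atTop hr).eventually_ge_atTop R₀)).and
    (eventually_ge_atTop (8 * E₂ / Q))).and (eventually_ge_atTop (τ / T))).and
    ((tendsto_integral_sobolev_weight.comp (tendsto_id.const_mul_atTop hr)).eventually_ge_atTop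
      (R ^ 2 / δ ^ 2 +
        ∫ ξ in Metric.closedBall (0 : Rd 1) R₀, (1 + ‖ξ‖ ^ 2) ^ (-(1 / 2) : ℝ))) |>.exists
  simp only [id, Function.comp] at hnR hnI
  have hn0 : 0 < n := by linarith
  have hnC : (n : ℂ) ≠ 0 := by exact_mod_cast hn0.ne'
  set p := criticalWeight 1 n hn with hp
  have hle : ∀ ξ, polyWeight 1 (1 + 1) n ξ ≤ p.toFun ξ := le_criticalWeight hn
  obtain ⟨z, hz0, hz, hzn⟩ := hsol τ hτ0.le (min_le_left _ _) n hn
  have h0 := p.tendsto_of_hasCompactSupport hVs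
  change z 0 = (n⁻¹ : ℂ) • p.ofHat V hVc h0 + p.dilate n hn0 hle k at hz0
  have hE₂n : 2 * (E₂ / n) ≤ Q / 4 := by
    rw [div_le_iff₀ hQ0] at hnE
    have : E₂ / n ≤ Q / 8 := by rw [div_le_iff₀ hn0]; linarith
    linarith
  refine ⟨τ / n ^ 4, by positivity, ?_, fun t => (n : ℂ) • p.toHs _ hs (propagator t (z (n ^ 4 * t))),
    p.isStrongSolution hn0 hs hz, ?_, ?_⟩
  · rw [div_le_iff₀ hT] at hnT
    rw [div_le_iff₀ (by positivity)]
    have : n ≤ n ^ 4 := le_self_pow₀ hn (by norm_num)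
    nlinarith
  · have e1 : (n : ℂ) • p.toHs _ hs (propagator 0 (z (n ^ 4 * 0))) - Hs.ofFourier _ V hV =
        (n : ℂ) • p.toHs _ hs (p.dilate n hn0 hle k) := by
      rw [mul_zero, hz0, propagator_zero, map_add, map_smul, smul_add, smul_smul,
        mul_inv_cancel₀ hnC, one_smul, p.toHs_ofHat hs hVc _ hV, add_sub_cancel_left]
    simp only
    rw [e1]
    refine le_of_sq_le_sq ?_ hκ.le
    rw [p.norm_toHs_dilate_sq hs hn0 hn0 (by norm_num) hle]
    have hb : ∀ ξ, ((n ^ 2)⁻¹ + ‖ξ‖ ^ 2) ^ (-(1 / 2) : ℝ) * ‖P.hat k ξ‖ ^ 2 ≤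
        B * (c ^ 2 * ‖P.hat h ξ‖ ^ 2) := fun ξ => by
      rw [hk, ConvWeight.hat_smul, norm_mul, Complex.norm_real, Real.norm_of_nonneg hc0.le, mul_pow]
      rcases le_total ‖ξ‖ (K / 2) with h1 | h1
      · rw [hh0 ξ h1]; simp
      · have : ((n ^ 2)⁻¹ + ‖ξ‖ ^ 2) ^ (-(1 / 2) : ℝ) ≤ B := by
          rw [hB, Real.rpow_mul (by positivity), Real.rpow_two]
          refine Real.rpow_le_rpow_of_nonpos (by positivity) ?_ (by norm_num)
          have : (K / 2) ^ 2 ≤ ‖ξ‖ ^ 2 := by gcongr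
          have : 0 < (n ^ 2)⁻¹ := by positivity
          linarith
        gcongr
    refine (integral_mono_of_nonneg (ae_of_all _ fun ξ => by positivity)
      (((P.integrable_norm_hat_sq h).const_mul _).const_mul _) (ae_of_all _ hb)).trans ?_
    rw [integral_const_mul, integral_const_mul]
    refine le_trans ?_ hcκ
    gcongr
  · have e1 : n ^ 4 * (τ / n ^ 4) = τ := by field_simp
    simp only
    rw [e1]
    -- In this range neither `V` nor the dilated initial profile has Fourier mass, so the first
    -- order term is all that remains besides the error.
    have hlow : ∀ ξ, R₀ < ‖ξ‖ → ‖ξ‖ ≤ r * n → δ / n ≤ ‖p.hat (z τ) ξ‖ := fun ξ h1 h2 => by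
      have h3 : ‖n⁻¹ • ξ‖ ≤ r := by
        rw [norm_inv_smul hn0, div_le_iff₀ hn0]; exact h2
      have h4 := hhq _ h3
      set x := z 0 + (τ : ℂ) • (Complex.I * (μ : ℂ)) • p.dilate n hn0 hle (P.quintic k) with hx
      have h5 : P.hat k (n⁻¹ • ξ) = 0 := by
        rw [hk, ConvWeight.hat_smul, hh0 _ (by linarith), mul_zero]
      have h6 : p.hat x ξ = τ * (Complex.I * μ * ((n : ℂ)⁻¹ *
          (((c ^ 5 : ℝ) : ℂ) * P.hat (P.quintic h) (n⁻¹ • ξ)))) := by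
        rw [hx, hz0]
        simp only [ConvWeight.hat_add, ConvWeight.hat_smul]
        rw [p.hat_ofHat, p.hat_dilate, p.hat_dilate, ← hP, h5, hR₀ ξ h1, hk, P.quintic_smul hc0.le, ConvWeight.hat_smul, pow_one]
        ring
      have h7 : τ * Q / n ≤ ‖p.hat x ξ‖ := by
        rw [h6, norm_mul, norm_mul (Complex.I * (μ : ℂ)), ConvWeight.norm_I_mul hμ, norm_mul,
          norm_mul, norm_inv,
          Complex.norm_real, Complex.norm_real, Complex.norm_real, Real.norm_of_nonneg hτ0.le,
          Real.norm_of_nonneg hn0.le, Real.norm_of_nonneg (by positivity : 0 ≤ c ^ 5), one_mul]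
        have := h4.trans (Complex.re_le_norm _)
        calc τ * Q / n = τ * (n⁻¹ * (c ^ 5 * q)) := by rw [hQ]; ring
          _ ≤ _ := by gcongr
      have h8 : ‖p.hat (z τ - x) ξ‖ ≤ 2 / n * (τ * (τ * E₁ + E₂ / n)) :=
        (p.norm_hat_le _ ξ).trans (mul_le_mul (criticalWeight_one_le hn ξ) hzn (norm_nonneg _)
          (by positivity))
      have h9 : p.hat x ξ = p.hat (z τ) ξ - p.hat (z τ - x) ξ := by
        rw [ConvWeight.hat_sub]; ring
      have h10 := h9 ▸ norm_sub_le (p.hat (z τ) ξ) (p.hat (z τ - x) ξ)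
      have h11 : 2 / n * (τ * (τ * E₁ + E₂ / n)) ≤ δ / n := by
        have : 2 * (τ * E₁ + E₂ / n) ≤ Q / 2 := by linarith
        calc _ = τ * (2 * (τ * E₁ + E₂ / n)) / n := by ring
          _ ≤ τ * (Q / 2) / n := by gcongr
          _ = δ / n := by rw [hδ]; ring
      have h12 : τ * Q / n = 2 * (δ / n) := by rw [hδ]; ring
      linarith
    have hnorm := le_norm_ofFourier_sq (p.memFourierHs_hat hs (propagator (τ / n ^ 4) (z τ))) hnR
      (by positivity : 0 ≤ δ / n) fun ξ h1 h2 => by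
        rw [p.norm_hat_propagator]; exact hlow ξ h1 h2
    rw [← p.toHs_apply hs] at hnorm
    refine le_of_abs_le (abs_le_of_sq_le_sq ?_ (norm_nonneg _))
    rw [norm_smul, mul_pow, Complex.norm_real, Real.norm_of_nonneg hn0.le]
    refine le_trans ?_ (mul_le_mul_of_nonneg_left hnorm (by positivity))
    rw [← mul_assoc, div_pow, mul_div_cancel₀ _ (by positivity), mul_comm, ← div_le_iff₀
      (by positivity)]
    linarith

/-! ### From norm inflation to discontinuity -/

/-- Closeness to `w` with `ε = 1` would bound all nearby solutions by `‖w‖ + 1`. Inflation is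
applied at a nice datum near `u₀` with this number as the level, and half-lines of time are not
needed: the solution lives on `[0, t]`. -/
theorem NormInflation.not_flowContinuousAt {s μ T : ℝ} (h : NormInflation d s μ) (hT : 0 < T)
    (u₀ : Hs d s) : ¬ FlowContinuousAt μ T u₀ := by
  rintro ⟨w, hw⟩
  obtain ⟨δ, hδ, hw⟩ := hw 1 one_pos
  obtain ⟨V, hV, hVc, hVs, hVu⟩ := Hs.exists_ofFourier_near u₀ (by positivity : 0 < δ / 3)
  obtain ⟨t, ht0, htT, v, hv, hv0, hvt⟩ :=
    h V hV hVc hVs (δ / 3) (by positivity) T hT (‖w‖ + 1)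
  have htm : t ∈ Icc (-T) T := ⟨by linarith, htT⟩
  have h1 := hw 0 t (by linarith) le_rfl ht0 htT v hv (by
    have := norm_sub_le_norm_sub_add_norm_sub (v 0) (Hs.ofFourier s V hV) u₀
    linarith) ⟨t, htm⟩ ⟨ht0, le_rfl⟩
  have h2 := w.norm_coe_le_norm ⟨t, htm⟩
  have h3 := norm_sub_norm_le (v t) (w ⟨t, htm⟩)
  simp only at h1
  linarith

theorem IsSolutionMap.flowContinuousAt {s μ T : ℝ} {Φ : Hs d s → C(Icc (-T) T, Hs d s)}
    (hΦ : IsSolutionMap μ Φ) {u₀ : Hs d s} (h : ContinuousAt Φ u₀) : FlowContinuousAt μ T u₀ := by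
  refine ⟨Φ u₀, fun ε hε => ?_⟩
  obtain ⟨δ, hδ, h1⟩ := Metric.continuousAt_iff.1 h ε hε
  refine ⟨δ, hδ, fun a b ha ha0 hb0 hb v hv hv0 t ht => ?_⟩
  rw [← hΦ a b ha ha0 hb0 hb v hv t ht, ← dist_eq_norm]
  exact (ContinuousMap.dist_apply_le_dist t).trans_lt (h1 (by rwa [dist_eq_norm]))

end

theorem corollary1p3 (d : ℕ) (s μ T : ℝ) (hμ : μ = 1 ∨ μ = -1)
    (hds : (d = 1 ∧ s ≤ -(1 / 2)) ∨ (2 ≤ d ∧ s < 0) ∨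
      (3 ≤ d ∧ d ≤ 5 ∧ 0 < s ∧ s < (d : ℝ) / 2 - 1 ∧ μ = 1))
    (hT : 0 < T) :
    (∀ Φ : Hs d s → C(Set.Icc (-T) T, Hs d s), IsSolutionMap μ Φ →
      ∀ u₀ : Hs d s, ¬ ContinuousAt Φ u₀) ∧
    (∀ u₀ : Hs d s, ¬ FlowContinuousAt μ T u₀) := by
  have hμ1 : |μ| = 1 := by rcases hμ with rfl | rfl <;> simp
  -- In every case `s ≤ d/2 - 1`, with equality only for `d = 1`, `s = -1/2`; in dimension at least
  -- two, `s < 0` already implies the strict inequality.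
  have hinf : NormInflation d s μ := by
    rcases hds with ⟨rfl, hs⟩ | ⟨hd, hs⟩ | ⟨hd, -, hs0, hs, -⟩
    · rcases hs.eq_or_lt with rfl | hs
      · exact .critical hμ1
      · exact .of_neg one_pos hμ1 (by norm_num; linarith) (by linarith)
    · have : (2 : ℝ) ≤ d := by exact_mod_cast hd
      exact .of_neg (by omega) hμ1 (by linarith) hs
    · exact .of_pos (by omega) hμ1 hs hs0
  exact ⟨fun Φ hΦ u₀ h => hinf.not_flowContinuousAt hT u₀ (hΦ.flowContinuousAt h),
    hinf.not_flowContinuousAt hT⟩
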